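/- Let $a>-1$ be real. For $t>0$ let $p_n(x;t)=\gamma_n x^n+\gamma_{n,1}x^{n-1}+\cdots$ ($n\ge 0$, $\gamma_n>0$, $\gamma_{0,1}=0$) be the orthonormal polynomials of the deformed Laguerre weight $w(x;t)=x^2(x+t)^a e^{-x}$ on $(0,\infty)$, and put $$a_n=\frac{\gamma_{n-1}}{\gamma_n}\ (n\ge 1),\quad b_n=\frac{\gamma_{n,1}}{\gamma_n}-\frac{\gamma_{n+1,1}}{\gamma_{n+1}},\quad \Gamma_n=\frac{\gamma_{n,1}}{\gamma_n},$$ $$\theta_n=2n+a+3-t-b_n,\qquad \kappa_n=(n+1)t-a_n^2-\Gamma_n,$$ $$Q_n(x;t)=\frac{p_n(x;t)}{p_n(0;t)},\qquad R_n=Q_n-Q_{n-1}\ (n\ge 1).$$ Then there are functions $\mu,\nu,C,\xi$ of $s>0$ and functions $q(z;s),p(z;s)$ of $z\in\mathbb C$, $s>0$, entire in $z$, such that the following holds for all $s>0$ and $z\in\mathbb C$. (Scaling limits.) With $t=s/4n$, as $n\to\infty$, $$4n\,\theta_n(t)\to\mu(s),\qquad n(n+a+2)+\Gamma_n(t)\to\nu(s),\qquad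 \kappa_n(t)\to-\tfrac14\mu(s),$$ $$n+\frac{\kappa_n-t}{\theta_n}\to C(s),\qquad n+a+2+\frac{\kappa_n+t}{\theta_{n-1}}\to -C(s),$$ $$n\Bigl(n+\frac{\kappa_n-t}{\theta_n}+n+a+2+\frac{\kappa_n+t}{\theta_{n-1}}\Bigr)\to\xi(s),$$ and $$Q_n\Bigl(-\frac z{4n};\frac s{4n}\Bigr)\to q(z;s),\qquad nR_n\Bigl(-\frac z{4n};\frac s{4n}\Bigr)\to p(z;s).$$ (Coefficients.) $\nu$ is twice continuously differentiable, $\mu+s=4s\dot\nu$, and $\sigma(s)=-\nu(s)+\tfrac14 s-a-2$ satisfies the Jimbo-Miwa-Okamoto $\sigma$-form of Painlevé III$'$ $$(s\ddot\sigma)^2-v_1v_2\dot\sigma^2+\dot\sigma(4\dot\sigma-1)(\sigma-s\dot\sigma)-\tfrac1{4^3}(v_1-v_2)^2=0,\qquad v_1=a+2,\ v_2=a-2.$$ Moreover $\mu,C,\xi$ are differentiable and satisfy the isomonodromy (compatibility) equations $$s(\dot\mu-2)=(2C+a+3)\mu,\qquad s\dot C=\xi-\tfrac14(\mu+s),\qquad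 s\dot\xi=-(2C+a+2)\xi+\tfrac14 s(2C+a).$$ (Lax pair.) $q$ and $p$ are differentiable in $s$ and satisfy the spectral derivatives $$(s-z)z\,\partial_z q=-zCq-(\mu+z)p,$$ $$(s-z)z\,\partial_z p=-z\bigl[\xi+\tfrac14(z-s)\bigr]q+[-2s+z(C+a+2)]p,$$ and the deformation derivatives $$(s-z)s\,\partial_s q=zCq+(\mu+s)p,$$ $$(s-z)s\,\partial_s p=z\xi q-[s(2C+a)-zC]p.$$ (Boundary values.) $q(0;s)=1$ and $p(0;s)=0$. -/

import Mathlib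

open Filter Topology

noncomputable section

namespace HardEdge

/-- The deformed Laguerre weight `w(x;t) = x² (x+t)^a e^{-x}` on `(0,∞)`. -/
def weight (a t x : ℝ) : ℝ := x ^ 2 * (x + t) ^ a * Real.exp (-x)

/-- The inner product `⟨P, Q⟩ = ∫₀^∞ w(x;t) P(x) Q(x) dx` on real polynomials. -/
def ip (a t : ℝ) (P Q : Polynomial ℝ) : ℝ :=
  ∫ x in Set.Ioi (0 : ℝ), weight a t x * (P.eval x * Q.eval x)

/-- The monic orthogonal polynomials `π_n(x;t)` of the weight, by the Gram-Schmidt process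
applied to `1, x, x², …`. -/
def monicPoly (a t : ℝ) (n : ℕ) : Polynomial ℝ :=
  Polynomial.X ^ n - ∑ k : Fin n,
    Polynomial.C (ip a t (Polynomial.X ^ n) (monicPoly a t k) /
      ip a t (monicPoly a t k) (monicPoly a t k)) * monicPoly a t k
termination_by n
decreasing_by exact k.2

/-- The orthonormal polynomials `p_n(x;t)`, with positive leading coefficient. -/
def orthoPoly (a t : ℝ) (n : ℕ) : Polynomial ℝ :=
  Polynomial.C (Real.sqrt (ip a t (monicPoly a t n) (monicPoly a t n)))⁻¹ * monicPoly a t n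

/-- `γ_n`, the coefficient of `x^n` in `p_n`. -/
def gam (a t : ℝ) (n : ℕ) : ℝ := (orthoPoly a t n).coeff n

/-- `γ_{n,1}`, the coefficient of `x^{n-1}` in `p_n`, with `γ_{0,1} = 0`. -/
def gamOne (a t : ℝ) : ℕ → ℝ
  | 0 => 0
  | n + 1 => (orthoPoly a t (n + 1)).coeff n

/-- The recurrence coefficient `a_n = γ_{n-1} / γ_n`, with `a_0 = 0`. -/
def recA (a t : ℝ) : ℕ → ℝ
  | 0 => 0
  | n + 1 => gam a t n / gam a t (n + 1)

/-- The recurrence coefficient `b_n = γ_{n,1} / γ_n - γ_{n+1,1} / γ_{n+1}`. -/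
def recB (a t : ℝ) (n : ℕ) : ℝ :=
  gamOne a t n / gam a t n - gamOne a t (n + 1) / gam a t (n + 1)

/-- `Γ_n(t) = γ_{n,1} / γ_n`. -/
def capGamma (a t : ℝ) (n : ℕ) : ℝ := gamOne a t n / gam a t n

/-- `θ_n(t) = 2n + a + 3 - t - b_n`. -/
def theta (a t : ℝ) (n : ℕ) : ℝ := 2 * n + a + 3 - t - recB a t n

/-- `κ_n(t) = (n+1) t - a_n² - γ_{n,1} / γ_n`. -/
def kappa (a t : ℝ) (n : ℕ) : ℝ := (n + 1) * t - recA a t n ^ 2 - capGamma a t n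

/-- `n + (κ_n - t) / θ_n`. -/
def combPlus (a t : ℝ) (n : ℕ) : ℝ := n + (kappa a t n - t) / theta a t n

/-- `n + a + 2 + (κ_n + t) / θ_{n-1}` (meant for `n ≥ 1`). -/
def combMinus (a t : ℝ) (n : ℕ) : ℝ := n + a + 2 + (kappa a t n + t) / theta a t (n - 1)

/-- The polynomial ratio `Q_n(x;t) = p_n(x;t) / p_n(0;t)` at a complex argument `x`. -/
def ratioQ (a t : ℝ) (n : ℕ) (x : ℂ) : ℂ :=
  Polynomial.aeval x (orthoPoly a t n) / ((orthoPoly a t n).eval 0 : ℝ)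

/-- `R_n(x;t) = Q_n(x;t) - Q_{n-1}(x;t)` (meant for `n ≥ 1`). -/
def ratioR (a t : ℝ) (n : ℕ) (x : ℂ) : ℂ := ratioQ a t n x - ratioQ a t (n - 1) x

/-- The Jimbo-Miwa-Okamoto `σ`-form of the Painlevé III′ equation with parameters `v₁, v₂`,
for a twice continuously differentiable function on `(0,∞)`. -/
def IsSigmaPIIIPrime (v₁ v₂ : ℝ) (σ : ℝ → ℝ) : Prop :=
  ContDiffOn ℝ 2 σ (Set.Ioi 0) ∧ ∀ t : ℝ, 0 < t →
    (t * deriv (deriv σ) t) ^ 2 - v₁ * v₂ * deriv σ t ^ 2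
      + deriv σ t * (4 * deriv σ t - 1) * (σ t - t * deriv σ t)
      - (v₁ - v₂) ^ 2 / 4 ^ 3 = 0


lemma ip_integrable (a t : ℝ) (ht : 0 < t) (P : Polynomial ℝ) :
    MeasureTheory.IntegrableOn (fun x => weight a t x * P.eval x) (Set.Ioi 0) := by
  refine integrable_of_isBigO_exp_neg (b := 1 / 4) (by norm_num) ?_ ?_
  · unfold weight
    refine ContinuousOn.mul (ContinuousOn.mul (ContinuousOn.mul (by fun_prop) ?_) (by fun_prop)) (by fun_prop)
    refine ContinuousOn.rpow_const (by fun_prop) fun x hx => Or.inl ?_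
    have : (0:ℝ) ≤ x := hx
    positivity
  · have h1 : (fun x : ℝ => (x + t) ^ a) =O[atTop] fun x => Real.exp ((1 / 4) * x) := by
      have := (isLittleO_rpow_exp_pos_mul_atTop a (b := 1 / 4) (by norm_num)).isBigO.comp_tendsto
        (tendsto_atTop_add_const_right atTop t tendsto_id)
      refine this.trans ?_
      refine Asymptotics.IsBigO.of_bound (Real.exp (1 / 4 * t)) (Eventually.of_forall fun x => ?_)
      simp only [Function.comp, id, Real.norm_eq_abs, Real.abs_exp, mul_add, Real.exp_add]
      rw [mul_comm, abs_of_pos (by positivity)]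
    have h2 : (fun x : ℝ => x ^ 2 * P.eval x) =O[atTop] fun x => Real.exp ((1 / 2) * x) := by
      have e : (fun x : ℝ => x ^ 2 * P.eval x) = fun x => (Polynomial.X ^ 2 * P).eval x := by
        ext x; simp
      rw [e]
      refine (Polynomial.isBigO_atTop_of_degree_le (Polynomial.X ^ 2 * P) (Polynomial.X ^ (Polynomial.X ^ 2 * P).natDegree) ?_).trans ?_
      · rw [Polynomial.degree_X_pow]; exact Polynomial.degree_le_natDegree
      · simpa using (isLittleO_pow_exp_pos_mul_atTop (Polynomial.X ^ 2 * P).natDegree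
          (b := 1 / 2) (by norm_num)).isBigO
    have h3 := (h1.mul h2).mul (Asymptotics.isBigO_refl (fun x : ℝ => Real.exp (-x)) atTop)
    refine (h3.congr (fun x => ?_) (fun x => ?_))
    · unfold weight; ring
    · rw [← Real.exp_add, ← Real.exp_add]; congr 1; ring

lemma ip_comm (a t : ℝ) (P Q : Polynomial ℝ) : ip a t P Q = ip a t Q P := by
  unfold ip; simp only [mul_comm]

lemma ip_sub_left (a t : ℝ) (ht : 0 < t) (P Q R : Polynomial ℝ) :
    ip a t (P - Q) R = ip a t P R - ip a t Q R := by
  unfold ip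
  have h (P) := ip_integrable a t ht (P * R)
  simp only [Polynomial.eval_mul] at h
  rw [← MeasureTheory.integral_sub (h P) (h Q)]
  congr 1; ext x; simp; ring

lemma ip_C_mul_left (a t c : ℝ) (P R : Polynomial ℝ) :
    ip a t (Polynomial.C c * P) R = c * ip a t P R := by
  unfold ip
  rw [← MeasureTheory.integral_const_mul]
  congr 1; ext x; simp; ring

lemma ip_sum_left (a t : ℝ) (ht : 0 < t) {ι : Type} (s : Finset ι) (P : ι → Polynomial ℝ)
    (R : Polynomial ℝ) : ip a t (∑ i ∈ s, P i) R = ∑ i ∈ s, ip a t (P i) R := by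
  classical
  induction s using Finset.induction_on with
  | empty => simp [ip]
  | insert i s hi ih =>
    rw [Finset.sum_insert hi, Finset.sum_insert hi, ← ih]
    have := ip_sub_left a t ht (P i + ∑ i ∈ s, P i) (∑ i ∈ s, P i) R
    rw [add_sub_cancel_right] at this
    linarith

lemma ip_self_pos (a t : ℝ) (ht : 0 < t) (P : Polynomial ℝ) (hP : P ≠ 0) : 0 < ip a t P P := by
  have h := ip_integrable a t ht (P * P)
  simp only [Polynomial.eval_mul] at h
  have hw : ∀ x ∈ Set.Ioi (0:ℝ), 0 < weight a t x := fun x hx => by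
    have : (0:ℝ) < x := hx
    unfold weight; positivity
  have hnn : 0 ≤ᵐ[MeasureTheory.volume.restrict (Set.Ioi 0)]
      fun x => weight a t x * (P.eval x * P.eval x) := by
    filter_upwards [MeasureTheory.ae_restrict_mem measurableSet_Ioi] with x hx
    exact mul_nonneg (hw x hx).le (mul_self_nonneg _)
  unfold ip
  rw [MeasureTheory.setIntegral_pos_iff_support_of_nonneg_ae hnn h]
  refine lt_of_lt_of_le ?_ (MeasureTheory.measure_mono
    (s := Set.Ioi 0 \ (P.roots.toFinset : Set ℝ)) ?_)
  · rw [MeasureTheory.measure_sdiff_null (Finset.measure_zero _ _)]; simp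
  · rintro x ⟨hx, hr⟩
    refine ⟨?_, hx⟩
    have : P.eval x ≠ 0 := by
      intro h0; apply hr; simp [hP, h0]
    exact mul_ne_zero (hw x hx).ne' (mul_ne_zero this this)

lemma monicPoly_monic (a t : ℝ) (n : ℕ) :
    (monicPoly a t n).Monic ∧ (monicPoly a t n).natDegree = n := by
  induction n using Nat.strong_induction_on with
  | _ n ih =>
    rw [monicPoly]
    generalize hS : (∑ k : Fin n, Polynomial.C (ip a t (Polynomial.X ^ n) (monicPoly a t k) /
      ip a t (monicPoly a t k) (monicPoly a t k)) * monicPoly a t k) = S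
    have hd : S.degree < n := by
      rw [← hS, ← Polynomial.mem_degreeLT]
      refine Submodule.sum_mem _ fun k _ => Polynomial.mem_degreeLT.2 ?_
      rw [← Polynomial.smul_eq_C_mul]
      refine lt_of_le_of_lt (Polynomial.degree_smul_le _ _) ?_
      rw [Polynomial.degree_eq_natDegree (ih k k.2).1.ne_zero, (ih k k.2).2]
      exact_mod_cast k.2
    have hm := Polynomial.monic_X_pow_sub (n := n) (p := S) hd
    refine ⟨hm, ?_⟩
    apply Polynomial.natDegree_eq_of_degree_eq_some
    rw [Polynomial.degree_sub_eq_left_of_degree_lt (by simpa using hd)]; simp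

lemma monicPoly_orth (a t : ℝ) (ht : 0 < t) (n : ℕ) :
    ∀ m < n, ip a t (monicPoly a t n) (monicPoly a t m) = 0 := by
  induction n using Nat.strong_induction_on with
  | _ n ih =>
    intro m hm
    rw [monicPoly, ip_sub_left a t ht, ip_sum_left a t ht, Finset.sum_eq_single ⟨m, hm⟩]
    · rw [ip_C_mul_left, div_mul_cancel₀, sub_self]
      exact (ip_self_pos a t ht _ (monicPoly_monic a t m).1.ne_zero).ne'
    · intro k _ hk
      rw [ip_C_mul_left]
      have hk' : (k : ℕ) ≠ m := fun h => hk (Fin.ext h)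
      rcases lt_or_gt_of_ne hk' with h | h
      · rw [ip_comm a t (monicPoly a t k) (monicPoly a t m), ih m hm k h, mul_zero]
      · rw [ih k k.2 m h, mul_zero]
    · simp

/-- The `p_n` are orthonormal, of exact degree `n`, with positive leading coefficient. -/
theorem orthoPoly_orthonormal (a t : ℝ) (ht : 0 < t) :
    (∀ n, (orthoPoly a t n).natDegree = n ∧ 0 < gam a t n) ∧
    ∀ m n, ip a t (orthoPoly a t m) (orthoPoly a t n) = if m = n then 1 else 0 := by
  have hp (n) := ip_self_pos a t ht _ (monicPoly_monic a t n).1.ne_zero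
  have hs (n) : 0 < (Real.sqrt (ip a t (monicPoly a t n) (monicPoly a t n)))⁻¹ :=
    inv_pos.2 (Real.sqrt_pos.2 (hp n))
  refine ⟨fun n => ⟨?_, ?_⟩, fun m n => ?_⟩
  · unfold orthoPoly
    rw [Polynomial.natDegree_C_mul (hs n).ne', (monicPoly_monic a t n).2]
  · have h1 : (monicPoly a t n).coeff n = 1 := by
      have := (monicPoly_monic a t n).1.coeff_natDegree
      rwa [(monicPoly_monic a t n).2] at this
    unfold gam orthoPoly
    rw [Polynomial.coeff_C_mul, h1, mul_one]; exact hs n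
  · unfold orthoPoly
    rw [ip_C_mul_left, ip_comm a t (monicPoly a t m) (Polynomial.C _ * _), ip_C_mul_left]
    split_ifs with h
    · subst h
      rw [← mul_assoc, ← mul_inv, Real.mul_self_sqrt (hp m).le, inv_mul_cancel₀ (hp m).ne']
    · rcases lt_or_gt_of_ne h with h | h
      · rw [monicPoly_orth a t ht n m h]; simp
      · rw [ip_comm a t (monicPoly a t n) (monicPoly a t m), monicPoly_orth a t ht m n h]; simp

end HardEdge

end

noncomputable section

namespace HardEdge

open Polynomial MeasureTheory

/-! For fixed `n` everything is governed by two functions of `t`: `Y_n = a ∫ p_n² w / (x + t)`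
(`capY`) and `y_n = Q_{n-1}(-t) / Q_n(-t)` (`diagRatio`). The logarithmic derivative of the weight
is rational with poles only at `0` and `-t`. Integration by parts (`moment_pearson`) and the
Christoffel-Darboux formula therefore express the recurrence coefficients, the `x`-derivatives
(`spectral_fst`, `spectral_snd`) and the `t`-derivatives (`toda`) through `y_n` and `Y_n`, and give
a closed planar system for this pair (`hasDerivAt_capY`, `hasDerivAt_diagRatio`).

With `t = s/4n` and `r = n (1 - y_n)`, the system for `(r, Y)` depends on `n` only through `ε = 1/n`
and is regular at `ε = 0` (`hasDerivAt_scaled`). The limiting system is `s r' = s/4 - (a+2) r - r² +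
2 r² Y`, `s Y' = -a + (a+2) Y + 2 r Y - 2 r Y²`. No asymptotics of orthogonal polynomials are
needed; convergence follows from bounds, compactness and uniqueness: (1) The identity
`endpointProd_eq` makes the coefficients of `Q_n(-τ)` nonnegative and bounded by `n.choose k / 2^k`,
whence `0 < r ≤ s/8` with a positive lower bound independent of `n`; `Y_n` is bounded by `capY_eq`,
and `r Y` is confined to `[a, 0]` in the limit when `a ≤ 0` (`capX_bound`). (2) Along any
ultrafilter the scaled pair converges pointwise, and the limit solves the limiting system on all of
`(0, ∞)` (`hasDerivAt_of_tendsto_ode`). (3) Only one global solution obeys the bounds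
(`IsLimitSolution.unique`): in suitable variables the difference of two solutions solves a
cooperative linear system, and it would have to outgrow the bounds either at `∞` or at `0`
(`saddle_trivial`). So all ultrafilter limits agree and the full sequence converges.

The other limits follow algebraically, with `μ = -s (1 - Y)`, `C = -r Y`, `ξ = r (a - r Y)`. The
Taylor coefficients of `Q_n` and `n R_n` obey recursions with convergent coefficients and factorial
bounds uniform in `n`, so they converge and so do their sums. The limits of the recursions are the
spectral equations. The coefficients also obey differential equations in `s`, whose limits, combined
with the spectral equations, give the deformation equations. Finally `ν' = Y/4`, and the `σ`-form
becomes a polynomial identity in `s`, `r`, `Y`. -/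

/-! ### The moment functional: integration by parts and differentiation in `t`. -/

lemma integrableOn_rpow_exp_poly (b t : ℝ) (ht : 0 < t) (P : ℝ[X]) :
    IntegrableOn (fun x => (x + t) ^ b * Real.exp (-x) * P.eval x) (Set.Ioi 0) := by
  refine integrable_of_isBigO_exp_neg (b := 1 / 4) (by norm_num) ?_ ?_
  · refine ContinuousOn.mul (ContinuousOn.mul ?_ (by fun_prop)) (by fun_prop)
    refine ContinuousOn.rpow_const (by fun_prop) fun x hx => Or.inl ?_
    have : (0:ℝ) ≤ x := hx
    positivity
  · have h1 : (fun x : ℝ => (x + t) ^ b) =O[atTop] fun x => Real.exp ((1 / 4) * x) := by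
      have := (isLittleO_rpow_exp_pos_mul_atTop b (b := 1 / 4) (by norm_num)).isBigO.comp_tendsto
        (tendsto_atTop_add_const_right atTop t tendsto_id)
      refine this.trans ?_
      refine Asymptotics.IsBigO.of_bound (Real.exp (1 / 4 * t)) (Eventually.of_forall fun x => ?_)
      simp only [Function.comp, id, Real.norm_eq_abs, Real.abs_exp, mul_add, Real.exp_add]
      rw [mul_comm, abs_of_pos (by positivity)]
    have h2 : (fun x : ℝ => P.eval x) =O[atTop] fun x => Real.exp ((1 / 2) * x) := by
      refine (Polynomial.isBigO_atTop_of_degree_le P (X ^ P.natDegree) ?_).trans ?_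
      · rw [degree_X_pow]; exact degree_le_natDegree
      · simpa using (isLittleO_pow_exp_pos_mul_atTop P.natDegree (b := 1 / 2) (by norm_num)).isBigO
    refine ((h1.mul h2).mul (Asymptotics.isBigO_refl (fun x : ℝ => Real.exp (-x)) atTop)).congr
      (fun x => by ring) (fun x => ?_)
    rw [← Real.exp_add, ← Real.exp_add]; congr 1; ring

/-- The moment functional `f ↦ ∫₀^∞ x (x+t)^(a-1) e^{-x} f(x) dx`. -/
def moment (a t : ℝ) (ht : 0 < t) : ℝ[X] →ₗ[ℝ] ℝ where
  toFun f := ∫ x in Set.Ioi (0 : ℝ), (x + t) ^ (a - 1) * Real.exp (-x) * (X * f).eval x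
  map_add' f g := by
    rw [← integral_add (integrableOn_rpow_exp_poly _ t ht _) (integrableOn_rpow_exp_poly _ t ht _)]
    congr 1; ext x; simp; ring
  map_smul' c f := by
    rw [RingHom.id_apply, smul_eq_mul, ← integral_const_mul]
    congr 1; ext x; simp; ring

lemma moment_apply (a t : ℝ) (ht : 0 < t) (f : ℝ[X]) : moment a t ht f =
    ∫ x in Set.Ioi (0 : ℝ), (x + t) ^ (a - 1) * Real.exp (-x) * (X * f).eval x := rfl

lemma moment_C_mul (a t : ℝ) (ht : 0 < t) (c : ℝ) (f : ℝ[X]) :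
    moment a t ht (C c * f) = c * moment a t ht f := by
  rw [← smul_eq_C_mul, map_smul, smul_eq_mul]

/-- The functional integrates against `w / (x (x + t))`, so integrals against `w`, `w / x` and `w /
(x + t)` all become moments of polynomials, with factors `X (X + t)`, `X + t` and `X`. -/
lemma ip_eq_moment (a t : ℝ) (ht : 0 < t) (P Q : ℝ[X]) :
    ip a t P Q = moment a t ht (X * (X + C t) * (P * Q)) := by
  rw [moment_apply, ip]
  refine setIntegral_congr_fun measurableSet_Ioi fun x hx => ?_
  have hx' : (0:ℝ) < x := hx
  have h : x + t ≠ 0 := by positivity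
  simp only [weight, eval_mul, eval_X, eval_add, eval_C]
  rw [Real.rpow_sub_one h]
  field_simp

lemma ip_sub_one_eq_moment (a t : ℝ) (ht : 0 < t) (P Q : ℝ[X]) :
    ip (a - 1) t P Q = moment a t ht (X * (P * Q)) := by
  rw [moment_apply, ip]
  refine setIntegral_congr_fun measurableSet_Ioi fun x hx => ?_
  simp only [weight, eval_mul, eval_X]
  ring

lemma moment_nonneg (a t : ℝ) (ht : 0 < t) (f : ℝ[X]) (hf : ∀ x, 0 < x → 0 ≤ f.eval x) :
    0 ≤ moment a t ht f := by
  rw [moment_apply]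
  refine setIntegral_nonneg measurableSet_Ioi fun x hx => ?_
  have hx' : (0:ℝ) < x := hx
  have := hf x hx'
  simp only [eval_mul, eval_X]
  positivity

/-- The integrand is the exact derivative of `x² (x + t)^a e^{-x} f`. The boundary term at `0`
vanishes because of `x²`; the one at `∞` vanishes because the function and its derivative are both
integrable. The structural identities below come from special choices of `f`. -/
lemma moment_pearson (a t : ℝ) (ht : 0 < t) (f : ℝ[X]) :
    moment a t ht (X * (X + C t) * derivative f
      + (2 * (X + C t) + C a * X - X * (X + C t)) * f) = 0 := by
  have hc : ∀ x ∈ Set.Ici (0:ℝ), HasDerivAt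
      (fun x : ℝ => (x + t) ^ a * Real.exp (-x) * (X ^ 2 * f).eval x)
      ((x + t) ^ (a - 1) * Real.exp (-x) * (X * (X * (X + C t) * derivative f
      + (2 * (X + C t) + C a * X - X * (X + C t)) * f)).eval x) x := by
    intro x hx
    have hx' : (0:ℝ) ≤ x := hx
    have h : x + t ≠ 0 := by positivity
    have h1 := ((hasDerivAt_id x).add_const t).rpow_const (p := a) (Or.inl h)
    have h2 := (hasDerivAt_id x).neg.exp
    have h3 := (X ^ 2 * f).hasDerivAt x
    refine ((h1.mul h2).mul h3).congr_deriv ?_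
    simp only [id, Pi.mul_apply, Pi.neg_apply, eval_mul, eval_add, eval_sub, eval_X, eval_C,
      eval_pow, eval_ofNat, derivative_mul, derivative_X_pow]
    rw [show (x + t) ^ a = (x + t) ^ (a - 1) * (x + t) by
      rw [Real.rpow_sub_one h]; field_simp]
    simp
    ring
  have hint := integrableOn_rpow_exp_poly (a - 1) t ht (X * (X * (X + C t) * derivative f
      + (2 * (X + C t) + C a * X - X * (X + C t)) * f))
  have hF := integrableOn_rpow_exp_poly a t ht (X ^ 2 * f)
  have hinf := tendsto_zero_of_hasDerivAt_of_integrableOn_Ioi (fun x hx => hc x (Set.Ioi_subset_Ici_self hx)) hint hF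
  rw [moment_apply, integral_Ioi_of_hasDerivAt_of_tendsto' hc hint hinf]
  simp

lemma hasDerivAt_ip (a t : ℝ) (ht : 0 < t) (P Q : ℝ[X]) :
    HasDerivAt (fun τ => ip a τ P Q) (a * ip (a - 1) t P Q) t := by
  -- The power is monotone in `τ`, in a direction depending on the sign of `b`, so the sum of its
  -- values at the two endpoints dominates in either case.
  have hnn : ∀ x ∈ Set.Ioi (0:ℝ), ∀ τ ∈ Set.Ioo (t / 2) (2 * t), ∀ b : ℝ,
      (x + τ) ^ b ≤ (x + t / 2) ^ b + (x + 2 * t) ^ b := by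
    intro x hx τ hτ b
    have hx' : (0:ℝ) < x := hx
    obtain ⟨h1, h2⟩ := hτ
    have p1 : 0 < (x + t / 2) ^ b := by positivity
    have p2 : 0 < (x + 2 * t) ^ b := by positivity
    rcases le_total 0 b with hb | hb
    · have := Real.rpow_le_rpow (by linarith) (by linarith : x + τ ≤ x + 2 * t) hb
      linarith
    · have := Real.rpow_le_rpow_of_nonpos (by linarith) (by linarith : x + t / 2 ≤ x + τ) hb
      linarith
  have key := hasDerivAt_integral_of_dominated_loc_of_deriv_le
    (μ := volume.restrict (Set.Ioi (0:ℝ)))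
    (F := fun τ x => weight a τ x * (P.eval x * Q.eval x))
    (F' := fun τ x => a * (weight (a - 1) τ x * (P.eval x * Q.eval x)))
    (s := Set.Ioo (t / 2) (2 * t)) (x₀ := t)
    (bound := fun x => |a| * |(x + t / 2) ^ (a - 1) * Real.exp (-x) * (X ^ 2 * (P * Q)).eval x|
      + |a| * |(x + 2 * t) ^ (a - 1) * Real.exp (-x) * (X ^ 2 * (P * Q)).eval x|)
    (Ioo_mem_nhds (by linarith) (by linarith)) ?_ ?_ ?_ ?_ ?_ ?_
  · have h := key.2
    rw [integral_const_mul] at h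
    exact h
  · filter_upwards [Ioi_mem_nhds ht] with τ hτ
    have := ip_integrable a τ hτ (P * Q)
    simp only [eval_mul] at this
    exact this.aestronglyMeasurable
  · have := ip_integrable a t ht (P * Q)
    simp only [eval_mul] at this
    exact this
  · have := ip_integrable (a - 1) t ht (P * Q)
    simp only [eval_mul] at this
    exact (this.const_mul a).aestronglyMeasurable
  · filter_upwards [ae_restrict_mem measurableSet_Ioi] with x hx τ hτ
    have hx' : (0:ℝ) < x := hx
    have hτ0 : 0 < τ := by have := hτ.1; linarith
    have h := hnn x hx τ hτ (a - 1)
    have q1 : 0 < (x + t / 2) ^ (a - 1) := by positivity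
    have q2 : 0 < (x + 2 * t) ^ (a - 1) := by positivity
    have q3 : 0 < (x + τ) ^ (a - 1) := by positivity
    simp only [weight, eval_mul, eval_pow, eval_X, norm_mul, Real.norm_eq_abs, abs_mul, abs_pow,
      Real.abs_exp, abs_of_pos q1, abs_of_pos q2, abs_of_pos q3]
    have hp : 0 ≤ |a| * (|x| ^ 2 * Real.exp (-x) * (|P.eval x| * |Q.eval x|)) := by positivity
    nlinarith [mul_le_mul_of_nonneg_left h hp]
  · exact ((integrableOn_rpow_exp_poly _ _ (by linarith) _).abs.const_mul _).add
      ((integrableOn_rpow_exp_poly _ _ (by linarith) _).abs.const_mul _)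
  · filter_upwards [ae_restrict_mem measurableSet_Ioi] with x hx τ hτ
    have hx' : (0:ℝ) < x := hx
    have hτ0 : 0 < τ := by have := hτ.1; linarith
    have h : x + τ ≠ 0 := by positivity
    have h1 := ((hasDerivAt_id τ).const_add x).rpow_const (p := a) (Or.inl h)
    refine (((h1.const_mul (x ^ 2)).mul_const (Real.exp (-x))).mul_const
      (P.eval x * Q.eval x)).congr_deriv ?_
    simp only [weight, id]
    ring

/-! ### Monic orthogonal polynomials and the three-term recurrence. -/

lemma ip_add_left (a t : ℝ) (ht : 0 < t) (P Q R : ℝ[X]) :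
    ip a t (P + Q) R = ip a t P R + ip a t Q R := by
  have := ip_sub_left a t ht (P + Q) Q R
  rw [add_sub_cancel_right] at this
  linarith

lemma ip_add_right (a t : ℝ) (ht : 0 < t) (P Q R : ℝ[X]) :
    ip a t P (Q + R) = ip a t P Q + ip a t P R := by
  rw [ip_comm, ip_add_left a t ht, ip_comm a t Q, ip_comm a t R]

lemma ip_sub_right (a t : ℝ) (ht : 0 < t) (P Q R : ℝ[X]) :
    ip a t P (Q - R) = ip a t P Q - ip a t P R := by
  rw [ip_comm, ip_sub_left a t ht, ip_comm a t Q, ip_comm a t R]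

lemma ip_C_mul_right (a t c : ℝ) (P R : ℝ[X]) : ip a t P (C c * R) = c * ip a t P R := by
  rw [ip_comm, ip_C_mul_left, ip_comm]

lemma ip_X_mul_left (a t : ℝ) (P Q : ℝ[X]) : ip a t (X * P) Q = ip a t P (X * Q) := by
  unfold ip
  congr 1; ext x; simp only [eval_mul, eval_X]; ring

/-- The squared norm of the `n`-th monic orthogonal polynomial. -/
def normSq (a t : ℝ) (n : ℕ) : ℝ := ip a t (monicPoly a t n) (monicPoly a t n)

lemma normSq_pos (a t : ℝ) (ht : 0 < t) (n : ℕ) : 0 < normSq a t n :=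
  ip_self_pos a t ht _ (monicPoly_monic a t n).1.ne_zero

lemma monicPoly_coeff_self (a t : ℝ) (n : ℕ) : (monicPoly a t n).coeff n = 1 := by
  have h := (monicPoly_monic a t n).1.coeff_natDegree
  rwa [(monicPoly_monic a t n).2] at h

lemma monicPoly_coeff_of_lt (a t : ℝ) {n m : ℕ} (h : n < m) : (monicPoly a t n).coeff m = 0 :=
  coeff_eq_zero_of_natDegree_lt (by rwa [(monicPoly_monic a t n).2])

lemma monicPoly_degree_lt (a t : ℝ) {n m : ℕ} (h : n < m) : (monicPoly a t n).degree < m := by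
  rw [degree_eq_natDegree (monicPoly_monic a t n).1.ne_zero, (monicPoly_monic a t n).2]
  exact_mod_cast h

lemma monicPoly_zero (a t : ℝ) : monicPoly a t 0 = 1 := by
  rw [monicPoly]; simp

lemma degree_sub_coeff_mul_monicPoly_lt (a t : ℝ) (n : ℕ) (f : ℝ[X]) (hf : f.degree < (n + 1 : ℕ)) :
    (f - C (f.coeff n) * monicPoly a t n).degree < n := by
  rw [degree_lt_iff_coeff_zero] at hf ⊢
  intro m hm
  rw [coeff_sub, coeff_C_mul]
  rcases hm.eq_or_lt with rfl | h
  · rw [monicPoly_coeff_self]; ring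
  · rw [monicPoly_coeff_of_lt a t h, hf m h]; ring

lemma ip_eq_zero_of_degree_lt (a t : ℝ) (ht : 0 < t) (f : ℝ[X]) (n : ℕ)
    (hf : ∀ k < n, ip a t f (monicPoly a t k) = 0) (g : ℝ[X]) (hg : g.degree < n) :
    ip a t f g = 0 := by
  induction n generalizing g with
  | zero =>
    have : g = 0 := by simpa using hg
    subst this; simp [ip]
  | succ n ih =>
    have h := ih (fun k hk => hf k (by omega)) _ (degree_sub_coeff_mul_monicPoly_lt a t n g hg)
    rwa [ip_sub_right a t ht, ip_C_mul_right, hf n (by omega), mul_zero, sub_zero] at h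

lemma ip_monicPoly_eq_zero (a t : ℝ) (ht : 0 < t) (n : ℕ) (g : ℝ[X]) (hg : g.degree < n) :
    ip a t (monicPoly a t n) g = 0 :=
  ip_eq_zero_of_degree_lt a t ht _ n (monicPoly_orth a t ht n) g hg

lemma ip_monicPoly_monic (a t : ℝ) (ht : 0 < t) (n : ℕ) (g : ℝ[X]) (hg : g.degree < (n + 1 : ℕ)) :
    ip a t (monicPoly a t n) g = g.coeff n * normSq a t n := by
  have h := ip_monicPoly_eq_zero a t ht n _ (degree_sub_coeff_mul_monicPoly_lt a t n g hg)
  rw [ip_sub_right a t ht, ip_C_mul_right] at h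
  unfold normSq; linarith

lemma eq_zero_of_orth (a t : ℝ) (ht : 0 < t) (f : ℝ[X]) (n : ℕ) (hd : f.degree < n)
    (hf : ∀ k < n, ip a t f (monicPoly a t k) = 0) : f = 0 := by
  by_contra h
  exact (ip_self_pos a t ht f h).ne' (ip_eq_zero_of_degree_lt a t ht f n hf f hd)

/-- The diagonal recurrence coefficient. -/
def recDiag (a t : ℝ) (n : ℕ) : ℝ :=
  ip a t (X * monicPoly a t n) (monicPoly a t n) / normSq a t n

/-- The squared off-diagonal recurrence coefficient, `h_n / h_{n-1}`. -/
def recSq (a t : ℝ) : ℕ → ℝ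
  | 0 => 0
  | n + 1 => normSq a t (n + 1) / normSq a t n

lemma degree_X_mul_lt (f : ℝ[X]) (n : ℕ) (h : f.degree < (n : WithBot ℕ)) : (X * f).degree < ((n + 1 : ℕ) : WithBot ℕ) := by
  rw [degree_lt_iff_coeff_zero] at h ⊢
  intro m hm
  obtain ⟨k, rfl⟩ : ∃ k, m = k + 1 := ⟨m - 1, by omega⟩
  rw [coeff_X_mul]
  exact h k (by omega)

lemma degree_sub_lt_of_lt (f g : ℝ[X]) (n : ℕ) (hf : f.degree < n) (hg : g.degree < n) :
    (f - g).degree < n := by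
  rw [degree_lt_iff_coeff_zero] at hf hg ⊢
  intro m hm
  rw [coeff_sub, hf m hm, hg m hm, sub_zero]

lemma degree_C_mul_lt (c : ℝ) (g : ℝ[X]) (n : ℕ) (hg : g.degree < n) : (C c * g).degree < n := by
  rw [degree_lt_iff_coeff_zero] at hg ⊢
  intro m hm
  rw [coeff_C_mul, hg m hm, mul_zero]

/-- The difference of the two sides has degree at most `n` and is orthogonal to `π_0, …, π_n`, hence
vanishes. -/
lemma three_term (a t : ℝ) (ht : 0 < t) (n : ℕ) :
    X * monicPoly a t n = monicPoly a t (n + 1) + C (recDiag a t n) * monicPoly a t n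
      + C (recSq a t n) * monicPoly a t (n - 1) := by
  rw [← sub_eq_zero]
  have hdn := monicPoly_degree_lt a t (Nat.lt_succ_self n)
  refine eq_zero_of_orth a t ht _ (n + 1) ?_ ?_
  · rw [← sub_sub, ← sub_sub]
    refine degree_sub_lt_of_lt _ _ _ (degree_sub_lt_of_lt _ _ _ ?_ (degree_C_mul_lt _ _ _ hdn)) 
      (degree_C_mul_lt _ _ _ (monicPoly_degree_lt a t (by omega)))
    rw [degree_lt_iff_coeff_zero]
    intro m hm
    obtain ⟨k, rfl⟩ : ∃ k, m = k + 1 := ⟨m - 1, by omega⟩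
    rw [coeff_sub, coeff_X_mul]
    rcases (show n ≤ k by omega).eq_or_lt with rfl | h
    · rw [monicPoly_coeff_self, monicPoly_coeff_self, sub_self]
    · rw [monicPoly_coeff_of_lt a t h, monicPoly_coeff_of_lt a t (by omega), sub_self]
  · intro k hk
    rw [ip_sub_left a t ht, ip_add_left a t ht, ip_add_left a t ht, ip_C_mul_left, ip_C_mul_left,
      monicPoly_orth a t ht (n + 1) k hk]
    have hn := (normSq_pos a t ht n).ne'
    rcases (show k ≤ n by omega).eq_or_lt with rfl | hkn
    -- At `k = 0` the truncated index `k - 1` is again `0`; there the term vanishes only because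
    -- `recSq a t 0 = 0`.
    · have : recSq a t k * ip a t (monicPoly a t (k - 1)) (monicPoly a t k) = 0 := by
        cases k with
        | zero => simp [recSq]
        | succ k => rw [ip_comm, monicPoly_orth a t ht (k + 1) _ (by simp), mul_zero]
      rw [this, recDiag]
      change _ - (0 + _ / normSq a t k * normSq a t k + 0) = 0
      field_simp; ring
    · rw [monicPoly_orth a t ht n k hkn, ip_X_mul_left, ip_monicPoly_monic a t ht n _
        ((degree_X_mul_lt _ _ (monicPoly_degree_lt a t hkn)))]
      obtain ⟨j, rfl⟩ : ∃ j, n = j + 1 := ⟨n - 1, by omega⟩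
      rw [coeff_X_mul, Nat.add_sub_cancel]
      have hj := (normSq_pos a t ht j).ne'
      rcases (show k ≤ j by omega).eq_or_lt with rfl | hkj
      · rw [monicPoly_coeff_self, recSq]
        change _ - (0 + _ * 0 + _ / _ * normSq a t k) = 0
        field_simp; ring
      · rw [monicPoly_coeff_of_lt a t hkj, monicPoly_orth a t ht j k hkj]; ring

/-! ### The Christoffel-Darboux kernel and its behaviour at the endpoint `0`. -/

/-- The Christoffel-Darboux kernel `∑_{k<n} π_k(x) π_k / h_k`. -/
def cdKernel (a t : ℝ) (n : ℕ) (x : ℝ) : ℝ[X] :=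
  ∑ k ∈ Finset.range n, C ((monicPoly a t k).eval x / normSq a t k) * monicPoly a t k

lemma cdKernel_succ (a t : ℝ) (n : ℕ) (x : ℝ) : cdKernel a t (n + 1) x = cdKernel a t n x
    + C ((monicPoly a t n).eval x / normSq a t n) * monicPoly a t n :=
  Finset.sum_range_succ _ _

lemma cdKernel_degree_lt (a t : ℝ) (n : ℕ) (x : ℝ) : (cdKernel a t n x).degree < n := by
  rw [cdKernel, ← mem_degreeLT]
  refine Submodule.sum_mem _ fun k hk => mem_degreeLT.2 ?_
  exact degree_C_mul_lt _ _ _ (monicPoly_degree_lt a t (Finset.mem_range.1 hk))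

/-- The reproducing property, by peeling off the leading multiple of `π_n` from `f`. -/
lemma ip_cdKernel (a t : ℝ) (ht : 0 < t) (n : ℕ) (x : ℝ) (f : ℝ[X]) (hf : f.degree < n) :
    ip a t f (cdKernel a t n x) = f.eval x := by
  induction n generalizing f with
  | zero =>
    have : f = 0 := by simpa using hf
    subst this; simp [ip]
  | succ n ih =>
    have hd := degree_sub_coeff_mul_monicPoly_lt a t n f hf
    have h := ih _ hd
    have hn := (normSq_pos a t ht n).ne'
    rw [ip_sub_left a t ht, ip_C_mul_left, ip_monicPoly_eq_zero a t ht n _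
      (cdKernel_degree_lt a t n x), eval_sub, eval_mul, eval_C] at h
    rw [cdKernel_succ, ip_add_right a t ht, ip_C_mul_right, ip_comm a t f (monicPoly a t n),
      ip_monicPoly_monic a t ht n f hf]
    field_simp
    linarith

lemma ip_monicPoly_cdKernel (a t : ℝ) (ht : 0 < t) (n : ℕ) (x : ℝ) :
    ip a t (monicPoly a t n) (cdKernel a t n x) = 0 :=
  ip_monicPoly_eq_zero a t ht n _ (cdKernel_degree_lt a t n x)

lemma christoffel_darboux (a t : ℝ) (ht : 0 < t) (n : ℕ) (x : ℝ) :
    (C x - X) * cdKernel a t (n + 1) x = C (1 / normSq a t n) *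
      (C ((monicPoly a t (n + 1)).eval x) * monicPoly a t n
        - C ((monicPoly a t n).eval x) * monicPoly a t (n + 1)) := by
  refine Polynomial.funext fun y => ?_
  have h3 (n : ℕ) (y : ℝ) := congrArg (eval y) (three_term a t ht n)
  simp only [eval_mul, eval_add, eval_X, eval_C, eval_sub] at h3 ⊢
  have hn (n) := (normSq_pos a t ht n).ne'
  induction n with
  | zero =>
    have hx := h3 0 x
    have hy := h3 0 y
    simp only [recSq, monicPoly_zero, eval_one] at hx hy
    simp only [cdKernel, zero_add, Finset.sum_range_one, monicPoly_zero, eval_mul, eval_C, eval_one]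
      at hx hy ⊢
    rw [show x - y = (monicPoly a t 1).eval x - (monicPoly a t 1).eval y by linarith]
    ring
  | succ n ih =>
    have hx := h3 (n + 1) x
    have hy := h3 (n + 1) y
    have e1 : (monicPoly a t (n + 1 + 1)).eval x = (x - recDiag a t (n + 1)) *
      (monicPoly a t (n + 1)).eval x - recSq a t (n + 1) * (monicPoly a t n).eval x := by
      simp only [Nat.add_sub_cancel] at hx; linarith
    have e2 : (monicPoly a t (n + 1 + 1)).eval y = (y - recDiag a t (n + 1)) *
      (monicPoly a t (n + 1)).eval y - recSq a t (n + 1) * (monicPoly a t n).eval y := by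
      simp only [Nat.add_sub_cancel] at hy; linarith
    rw [cdKernel_succ, eval_add, mul_add, ih, e1, e2, recSq, eval_mul, eval_C]
    have := hn n; have := hn (n + 1)
    field_simp
    ring

/-- `∑_{k≤n} π_k(0)² / h_k`. -/
def kernelZero (a t : ℝ) (n : ℕ) : ℝ :=
  ∑ k ∈ Finset.range (n + 1), (monicPoly a t k).eval 0 ^ 2 / normSq a t k

/-- `-π_{n+1}(0) π_n(0) / h_n`. -/
def endpointProd (a t : ℝ) (n : ℕ) : ℝ :=
  -((monicPoly a t (n + 1)).eval 0 * (monicPoly a t n).eval 0) / normSq a t n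

lemma cdKernel_zero_eval_zero (a t : ℝ) (n : ℕ) :
    (cdKernel a t (n + 1) 0).eval 0 = kernelZero a t n := by
  rw [cdKernel, kernelZero, eval_finsetSum]
  refine Finset.sum_congr rfl fun k _ => ?_
  rw [eval_mul, eval_C]; ring

lemma kernelZero_pos (a t : ℝ) (ht : 0 < t) (n : ℕ) : 0 < kernelZero a t n := by
  refine Finset.sum_pos' (fun k _ => ?_) ⟨0, by simp, ?_⟩
  · have := normSq_pos a t ht k; positivity
  · have := normSq_pos a t ht 0
    rw [monicPoly_zero, eval_one]; positivity

lemma degree_derivative_lt_pred (f : ℝ[X]) (n : ℕ) (hf : f.degree < ((n + 1 : ℕ) : WithBot ℕ)) :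
    (derivative f).degree < n := by
  rw [degree_lt_iff_coeff_zero] at hf ⊢
  intro m hm
  rw [coeff_derivative, hf (m + 1) (by omega), zero_mul]

/-- Pearson's identity for `f = x K²` with `K` the kernel at `0`. The norm `⟨K, K⟩ = K(0)` occurs `1
+ 2` times, `⟨x K', K⟩` is the value of `x K'` at `0` and drops out, and `⟨-x K, K⟩` is turned by
Christoffel-Darboux into the product of endpoint values. -/
lemma endpointProd_eq (a t : ℝ) (ht : 0 < t) (n : ℕ) : endpointProd a t n = 3 * kernelZero a t n
    + a * moment a t ht (X ^ 2 * cdKernel a t (n + 1) 0 ^ 2) := by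
  set K := cdKernel a t (n + 1) 0 with hK
  have hd : K.degree < ((n + 1 : ℕ) : WithBot ℕ) := cdKernel_degree_lt a t (n + 1) 0
  have hcd := christoffel_darboux a t ht n 0
  rw [← hK] at hcd
  have hp := moment_pearson a t ht (X * K ^ 2)
  have e : X * (X + C t) * derivative (X * K ^ 2)
      + (2 * (X + C t) + C a * X - X * (X + C t)) * (X * K ^ 2)
      = X * (X + C t) * (K * K) + C 2 * (X * (X + C t) * ((X * derivative K) * K))
        + C 2 * (X * (X + C t) * (K * K)) + C a * (X ^ 2 * K ^ 2)
        + X * (X + C t) * ((C 0 - X) * K * K) := by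
    simp only [derivative_mul, derivative_X, derivative_pow, map_ofNat, map_zero]
    push_cast
    simp only [map_ofNat]
    ring
  rw [e, map_add, map_add, map_add, map_add, moment_C_mul, moment_C_mul, moment_C_mul,
    ← ip_eq_moment, ← ip_eq_moment, ← ip_eq_moment, hcd, ip_C_mul_left,
    ip_sub_left a t ht, ip_C_mul_left, ip_C_mul_left, hK, ip_monicPoly_cdKernel a t ht,
    ip_cdKernel a t ht _ _ _ (monicPoly_degree_lt a t (Nat.lt_succ_self n)), ← hK,
    ip_cdKernel a t ht _ _ _ hd, ip_cdKernel a t ht _ _ _ (degree_X_mul_lt _ _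
      (degree_derivative_lt_pred _ _ hd)), cdKernel_zero_eval_zero, eval_mul, eval_X] at hp
  have hn := (normSq_pos a t ht n).ne'
  rw [endpointProd]
  field_simp at hp ⊢
  linarith

lemma moment_sq_bounds (a t : ℝ) (ht : 0 < t) (n : ℕ) :
    0 ≤ moment a t ht (X ^ 2 * cdKernel a t (n + 1) 0 ^ 2) ∧
    moment a t ht (X ^ 2 * cdKernel a t (n + 1) 0 ^ 2) ≤ kernelZero a t n := by
  constructor
  · refine moment_nonneg a t ht _ fun x _ => ?_
    simp only [eval_mul, eval_pow]; positivity
  · rw [← cdKernel_zero_eval_zero, ← ip_cdKernel a t ht _ 0 _ (cdKernel_degree_lt a t (n + 1) 0),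
      ip_eq_moment a t ht, ← sub_nonneg, ← map_sub]
    refine moment_nonneg a t ht _ fun x hx => ?_
    simp only [eval_mul, eval_pow, eval_sub, eval_add, eval_X, eval_C]
    have : 0 ≤ x * t * (cdKernel a t (n + 1) 0).eval x ^ 2 := by positivity
    nlinarith

/-- The moment lies between `0` and `kernelZero`, so `a > -1` leaves at least `3 - 1 = 2` copies of
the kernel. This yields `π_n(0) ≠ 0` without locating zeros, and it is the source of the factor
`1/2` in the growth bounds below. -/
lemma two_mul_kernelZero_le (a t : ℝ) (ha : -1 < a) (ht : 0 < t) (n : ℕ) :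
    2 * kernelZero a t n ≤ endpointProd a t n := by
  rw [endpointProd_eq a t ht]
  obtain ⟨h1, h2⟩ := moment_sq_bounds a t ht n
  nlinarith

lemma endpointProd_le (a t : ℝ) (ht : 0 < t) (n : ℕ) :
    endpointProd a t n ≤ (3 + |a|) * kernelZero a t n := by
  rw [endpointProd_eq a t ht]
  obtain ⟨h1, h2⟩ := moment_sq_bounds a t ht n
  nlinarith [le_abs_self a, abs_nonneg a]

lemma endpointProd_pos (a t : ℝ) (ha : -1 < a) (ht : 0 < t) (n : ℕ) : 0 < endpointProd a t n := by
  have := kernelZero_pos a t ht n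
  have := two_mul_kernelZero_le a t ha ht n
  linarith

lemma monicPoly_eval_zero_ne (a t : ℝ) (ha : -1 < a) (ht : 0 < t) (n : ℕ) :
    (monicPoly a t n).eval 0 ≠ 0 := by
  intro h
  have := endpointProd_pos a t ha ht n
  rw [endpointProd, h] at this
  simp at this

/-! ### Growth of the ratios `Q_n` on the negative axis. -/

/-- The ratio `π_n / π_n(0) = p_n / p_n(0)` as a polynomial. -/
def qPoly (a t : ℝ) (n : ℕ) : ℝ[X] := C ((monicPoly a t n).eval 0)⁻¹ * monicPoly a t n

lemma qPoly_zero (a t : ℝ) : qPoly a t 0 = 1 := by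
  rw [qPoly, monicPoly_zero]; simp

lemma qPoly_eval_zero (a t : ℝ) (ha : -1 < a) (ht : 0 < t) (n : ℕ) : (qPoly a t n).eval 0 = 1 := by
  rw [qPoly, eval_mul, eval_C, inv_mul_cancel₀ (monicPoly_eval_zero_ne a t ha ht n)]

/-- Christoffel-Darboux at `0`, divided by `π_n(0) π_{n+1}(0)`. At a negative argument the increment
is a combination of the earlier `Q_k` with nonnegative weights of total mass at most `1/2`, times
`|x|`. -/
lemma qPoly_succ (a t : ℝ) (ha : -1 < a) (ht : 0 < t) (n : ℕ) : qPoly a t (n + 1) = qPoly a t n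
    - C (1 / endpointProd a t n) * (X * ∑ k ∈ Finset.range (n + 1),
      C ((monicPoly a t k).eval 0 ^ 2 / normSq a t k) * qPoly a t k) := by
  have hcd := christoffel_darboux a t ht n 0
  have hs : ∑ k ∈ Finset.range (n + 1), C ((monicPoly a t k).eval 0 ^ 2 / normSq a t k)
      * qPoly a t k = cdKernel a t (n + 1) 0 := by
    refine Finset.sum_congr rfl fun k _ => ?_
    have := monicPoly_eval_zero_ne a t ha ht k
    rw [qPoly, ← mul_assoc, ← C_mul]
    congr 2
    field_simp
  have hX : X * cdKernel a t (n + 1) 0 = -((C 0 - X) * cdKernel a t (n + 1) 0) := by simp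
  have h1 := monicPoly_eval_zero_ne a t ha ht n
  have h2 := monicPoly_eval_zero_ne a t ha ht (n + 1)
  have h3 := (normSq_pos a t ht n).ne'
  rw [hs, hX, hcd]
  refine Polynomial.funext fun y => ?_
  simp only [qPoly, endpointProd, eval_mul, eval_C, eval_sub, eval_neg]
  field_simp
  ring

/-- The coefficients of `Q_n(-τ)`. -/
def qCoeff (a t : ℝ) (n k : ℕ) : ℝ := (-1) ^ k * (qPoly a t n).coeff k

lemma qCoeff_zero_right (a t : ℝ) (ha : -1 < a) (ht : 0 < t) (n : ℕ) : qCoeff a t n 0 = 1 := by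
  rw [qCoeff, pow_zero, one_mul, coeff_zero_eq_eval_zero, qPoly_eval_zero a t ha ht]

lemma qCoeff_succ_succ (a t : ℝ) (ha : -1 < a) (ht : 0 < t) (n k : ℕ) :
    qCoeff a t (n + 1) (k + 1) = qCoeff a t n (k + 1) + 1 / endpointProd a t n *
      ∑ j ∈ Finset.range (n + 1), (monicPoly a t j).eval 0 ^ 2 / normSq a t j * qCoeff a t j k := by
  rw [qCoeff, qPoly_succ a t ha ht, coeff_sub, coeff_C_mul, coeff_X_mul, finsetSum_coeff]
  simp only [coeff_C_mul, qCoeff]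
  rw [mul_sub, sub_eq_add_neg]
  congr 1
  rw [pow_succ, Finset.mul_sum, Finset.mul_sum, Finset.mul_sum, ← Finset.sum_neg_distrib]
  refine Finset.sum_congr rfl fun j _ => ?_
  ring

/-- A weighted summation recursion: the increments are controlled by the preceding values. -/
lemma sum_recursion_bounds (a t : ℝ) (ha : -1 < a) (ht : 0 < t) (n : ℕ) (u : ℕ → ℝ)
    (h0 : ∀ j ≤ n, 0 ≤ u j) (hm : ∀ j ≤ n, u j ≤ u n) :
    0 ≤ 1 / endpointProd a t n * ∑ j ∈ Finset.range (n + 1),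
      (monicPoly a t j).eval 0 ^ 2 / normSq a t j * u j ∧
    1 / endpointProd a t n * ∑ j ∈ Finset.range (n + 1),
      (monicPoly a t j).eval 0 ^ 2 / normSq a t j * u j ≤ u n / 2 := by
  have hp := endpointProd_pos a t ha ht n
  have hw (j) : 0 ≤ (monicPoly a t j).eval 0 ^ 2 / normSq a t j := by
    have := normSq_pos a t ht j; positivity
  have hs : ∑ j ∈ Finset.range (n + 1), (monicPoly a t j).eval 0 ^ 2 / normSq a t j * u j
      ≤ kernelZero a t n * u n := by
    rw [kernelZero, Finset.sum_mul]
    refine Finset.sum_le_sum fun j hj => ?_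
    exact mul_le_mul_of_nonneg_left (hm j (by simpa [Nat.lt_succ_iff] using hj)) (hw j)
  constructor
  · refine mul_nonneg (by positivity) (Finset.sum_nonneg fun j hj => mul_nonneg (hw j) ?_)
    exact h0 j (by simpa [Nat.lt_succ_iff] using hj)
  · rw [one_div, inv_mul_le_iff₀ hp]
    have := two_mul_kernelZero_le a t ha ht n
    nlinarith [h0 n le_rfl]

/-- Each increment in `n` is at most half the coefficient one degree lower, so the upper bound
propagates by Pascal's rule. -/
lemma qCoeff_bounds (a t : ℝ) (ha : -1 < a) (ht : 0 < t) (k : ℕ) :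
    (∀ n, 0 ≤ qCoeff a t n k) ∧ Monotone (fun n => qCoeff a t n k) ∧
    ∀ n, qCoeff a t n k ≤ n.choose k / 2 ^ k := by
  induction k with
  | zero => simp [qCoeff_zero_right a t ha ht, monotone_const]
  | succ k ih =>
    obtain ⟨i0, im, ib⟩ := ih
    have hb (n) := sum_recursion_bounds a t ha ht n (fun j => qCoeff a t j k)
      (fun j _ => i0 j) (fun j hj => im hj)
    have hz : qCoeff a t 0 (k + 1) = 0 := by
      rw [qCoeff, qPoly_zero, coeff_one]; simp
    have hmono : Monotone (fun n => qCoeff a t n (k + 1)) := monotone_nat_of_le_succ fun n => by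
      rw [qCoeff_succ_succ a t ha ht]
      linarith [(hb n).1]
    refine ⟨fun n => ?_, hmono, fun n => ?_⟩
    · rw [← hz]; exact hmono (Nat.zero_le n)
    · induction n with
      | zero => simp [hz]
      | succ n ihn =>
        rw [qCoeff_succ_succ a t ha ht, Nat.choose_succ_succ]
        push_cast
        have h1 := (hb n).2
        have h2 := ib n
        have e : ((n.choose k : ℝ) + n.choose (k + 1)) / 2 ^ (k + 1)
          = n.choose (k + 1) / 2 ^ (k + 1) + (n.choose k / 2 ^ k) / 2 := by
          rw [pow_succ]; field_simp; ring
        rw [e]; linarith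

/-- The coefficients of `Q_{n+1}(-τ) - Q_n(-τ)`. -/
lemma qCoeff_sub_bounds (a t : ℝ) (ha : -1 < a) (ht : 0 < t) (n k : ℕ) :
    0 ≤ qCoeff a t (n + 1) (k + 1) - qCoeff a t n (k + 1) ∧
    qCoeff a t (n + 1) (k + 1) - qCoeff a t n (k + 1) ≤ n.choose k / 2 ^ (k + 1) := by
  obtain ⟨i0, im, ib⟩ := qCoeff_bounds a t ha ht k
  have hb := sum_recursion_bounds a t ha ht n (fun j => qCoeff a t j k)
      (fun j _ => i0 j) (fun j hj => im hj)
  rw [qCoeff_succ_succ a t ha ht, add_sub_cancel_left]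
  refine ⟨hb.1, hb.2.trans ?_⟩
  rw [pow_succ, ← div_div]
  linarith [ib n]

lemma qPoly_eval_neg_succ (a t : ℝ) (ha : -1 < a) (ht : 0 < t) (n : ℕ) (τ : ℝ) :
    (qPoly a t (n + 1)).eval (-τ) = (qPoly a t n).eval (-τ) + τ * (1 / endpointProd a t n *
      ∑ j ∈ Finset.range (n + 1), (monicPoly a t j).eval 0 ^ 2 / normSq a t j
        * (qPoly a t j).eval (-τ)) := by
  rw [qPoly_succ a t ha ht, eval_sub, eval_mul, eval_mul, eval_finsetSum]
  simp only [eval_mul, eval_C, eval_X]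
  ring

lemma qPoly_eval_neg_bounds (a t : ℝ) (ha : -1 < a) (ht : 0 < t) (τ : ℝ) (hτ : 0 ≤ τ) (n : ℕ) :
    ∀ j ≤ n, 1 ≤ (qPoly a t j).eval (-τ) ∧ (qPoly a t j).eval (-τ) ≤ (qPoly a t n).eval (-τ) ∧
      (qPoly a t j).eval (-τ) ≤ (1 + τ / 2) ^ j := by
  induction n with
  | zero =>
    intro j hj
    obtain rfl : j = 0 := by omega
    simp [qPoly_zero]
  | succ n ih =>
    have hb := sum_recursion_bounds a t ha ht n (fun j => (qPoly a t j).eval (-τ))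
      (fun j hj => by linarith [(ih j hj).1]) (fun j hj => (ih j hj).2.1)
    have hs := qPoly_eval_neg_succ a t ha ht n τ
    have h1 : (qPoly a t n).eval (-τ) ≤ (qPoly a t (n + 1)).eval (-τ) := by
      rw [hs]; linarith [mul_nonneg hτ hb.1]
    intro j hj
    rcases hj.eq_or_lt with rfl | hj
    · obtain ⟨i1, -, i3⟩ := ih n le_rfl
      refine ⟨i1.trans h1, le_rfl, ?_⟩
      have h2 := mul_le_mul_of_nonneg_left hb.2 hτ
      calc (qPoly a t (n + 1)).eval (-τ) ≤ (qPoly a t n).eval (-τ) * (1 + τ / 2) := by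
            rw [hs]; linarith
        _ ≤ (1 + τ / 2) ^ n * (1 + τ / 2) := mul_le_mul_of_nonneg_right i3 (by positivity)
        _ = (1 + τ / 2) ^ (n + 1) := (pow_succ _ _).symm
    · obtain ⟨i1, i2, i3⟩ := ih j (by omega)
      exact ⟨i1, i2.trans h1, i3⟩

/-- The ratio `Q_{n-1}(-t) / Q_n(-t)`. -/
def diagRatio (a t : ℝ) (n : ℕ) : ℝ := (qPoly a t (n - 1)).eval (-t) / (qPoly a t n).eval (-t)

/-- The defect `1 - y` equals `t` times a weighted sum of the `Q_j(-t)`, divided by `endpointProd`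
and by `Q_{n+1}(-t)`. The upper bound is the mass bound `1/2`; the lower one uses `Q_j(-t) ≥ 1`,
`endpointProd_le` and `Q_{n+1}(-t) ≤ (1 + t/2)^(n+1)`. At `t = s/4(n+1)` both bounds are of exact
order `1/n`. -/
lemma diagRatio_bounds (a t : ℝ) (ha : -1 < a) (ht : 0 < t) (n : ℕ) :
    t * Real.exp (-((n + 1) * t / 2)) / (3 + |a|) ≤ 1 - diagRatio a t (n + 1) ∧
    1 - diagRatio a t (n + 1) ≤ t / 2 ∧ 0 < diagRatio a t (n + 1) ∧
    diagRatio a t (n + 1) < 1 := by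
  have hq := qPoly_eval_neg_bounds a t ha ht t ht.le (n + 1)
  have hq' := qPoly_eval_neg_bounds a t ha ht t ht.le n
  obtain ⟨q1, -, q3⟩ := hq (n + 1) le_rfl
  obtain ⟨p1, p2, -⟩ := hq n (by omega)
  have hp : 0 < (qPoly a t (n + 1)).eval (-t) := by linarith
  have hb := sum_recursion_bounds a t ha ht n (fun j => (qPoly a t j).eval (-t))
      (fun j hj => by linarith [(hq' j hj).1]) (fun j hj => (hq' j hj).2.1)
  have hs := qPoly_eval_neg_succ a t ha ht n t
  have hw (j) : 0 ≤ (monicPoly a t j).eval 0 ^ 2 / normSq a t j := by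
    have := normSq_pos a t ht j; positivity
  have hlow : kernelZero a t n ≤ ∑ j ∈ Finset.range (n + 1),
      (monicPoly a t j).eval 0 ^ 2 / normSq a t j * (qPoly a t j).eval (-t) := by
    refine Finset.sum_le_sum fun j hj => ?_
    exact le_mul_of_one_le_right (hw j) (hq' j (by simpa [Nat.lt_succ_iff] using hj)).1
  have hP := endpointProd_pos a t ha ht n
  have hK := kernelZero_pos a t ht n
  have hPK := endpointProd_le a t ht n
  set S := ∑ j ∈ Finset.range (n + 1),
      (monicPoly a t j).eval 0 ^ 2 / normSq a t j * (qPoly a t j).eval (-t) with hS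
  have e : 1 - diagRatio a t (n + 1) = t * (1 / endpointProd a t n * S)
      / (qPoly a t (n + 1)).eval (-t) := by
    rw [diagRatio, Nat.add_sub_cancel, eq_div_iff hp.ne', sub_mul, div_mul_cancel₀ _ hp.ne', one_mul]
    linarith
  have hl : 1 / (3 + |a|) ≤ 1 / endpointProd a t n * S := by
    rw [one_div_mul_eq_div, div_le_div_iff₀ (by positivity) hP]
    nlinarith [abs_nonneg a]
  have hexp : (qPoly a t (n + 1)).eval (-t) ≤ Real.exp ((n + 1) * t / 2) := by
    refine q3.trans ?_
    have : 1 + t / 2 ≤ Real.exp (t / 2) := by linarith [Real.add_one_le_exp (t / 2)]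
    calc (1 + t / 2) ^ (n + 1) ≤ Real.exp (t / 2) ^ (n + 1) := by gcongr
      _ = _ := by rw [← Real.exp_nat_mul]; congr 1; push_cast; ring
  have hlow2 : t * Real.exp (-((n + 1) * t / 2)) / (3 + |a|) ≤ 1 - diagRatio a t (n + 1) := by
    rw [e, Real.exp_neg, le_div_iff₀ hp]
    calc t * (Real.exp ((n + 1) * t / 2))⁻¹ / (3 + |a|) * (qPoly a t (n + 1)).eval (-t)
        ≤ t * (Real.exp ((n + 1) * t / 2))⁻¹ / (3 + |a|) * Real.exp ((n + 1) * t / 2) := by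
          gcongr
      _ = t * (1 / (3 + |a|)) := by
          have := (Real.exp_pos ((n + 1) * t / 2)).ne'
          field_simp
      _ ≤ _ := by gcongr
  refine ⟨hlow2, ?_, ?_, ?_⟩
  · rw [e, div_le_iff₀ hp]
    have := hb.2
    nlinarith
  · exact div_pos (by rw [Nat.add_sub_cancel]; linarith) hp
  · have : 0 < t * Real.exp (-((n + 1) * t / 2)) / (3 + |a|) := by positivity
    linarith

/-! ### Ladder relations in `x` and algebraic relations between `N`, `M`, `y`, `Y`. -/

/-- `-a_n p_{n-1}(0) / p_n(0)`. -/
def ratN (a t : ℝ) (n : ℕ) : ℝ :=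
  -(recSq a t n * (monicPoly a t (n - 1)).eval 0 / (monicPoly a t n).eval 0)

/-- `-π_n(0) / π_{n-1}(0)`. -/
def ratM (a t : ℝ) (n : ℕ) : ℝ := -((monicPoly a t n).eval 0 / (monicPoly a t (n - 1)).eval 0)

/-- `a ∫ p_n(x)² w(x) / (x + t) dx`. -/
def capY (a t : ℝ) (n : ℕ) : ℝ :=
  a * ip (a - 1) t (monicPoly a t n) (monicPoly a t n) / normSq a t n

lemma moment_smul_add (a t : ℝ) (ht : 0 < t) (c d : ℝ) (f g : ℝ[X]) :
    moment a t ht (C c * f + C d * g) = c * moment a t ht f + d * moment a t ht g := by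
  rw [map_add, moment_C_mul, moment_C_mul]

lemma christoffel_darboux_moment (a t : ℝ) (ht : 0 < t) (n : ℕ) (x : ℝ) (f : ℝ[X]) :
    moment a t ht (f * ((C x - X) * cdKernel a t (n + 1) x)) * normSq a t n =
      (monicPoly a t (n + 1)).eval x * moment a t ht (f * monicPoly a t n)
      - (monicPoly a t n).eval x * moment a t ht (f * monicPoly a t (n + 1)) := by
  have h := (normSq_pos a t ht n).ne'
  rw [christoffel_darboux a t ht, show ∀ p q : ℝ[X], ∀ u v w : ℝ, f * (C u * (C v * p - C w * q))
    = C (u * v) * (f * p) + C (-(u * w)) * (f * q) by intros; simp only [C_mul, C_neg]; ring,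
    moment_smul_add]
  field_simp
  ring

/-- Pearson's identity for `f = π_n²`, where `⟨π_n, π_n'⟩ = 0`. It ties the integral of `π_n² w / x`
to that of `π_n² w / (x + t)`, so `capY` alone determines both. -/
lemma moment_sq_relation (a t : ℝ) (ht : 0 < t) (n : ℕ) : 2 * moment a t ht ((X + C t) * (monicPoly a t n * monicPoly a t n))
    + a * moment a t ht (X * (monicPoly a t n * monicPoly a t n)) = normSq a t n := by
  have hp := moment_pearson a t ht (monicPoly a t n * monicPoly a t n)
  set p := monicPoly a t n with hpd
  have e : X * (X + C t) * derivative (p * p) + (2 * (X + C t) + C a * X - X * (X + C t)) * (p * p)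
      = C 2 * (X * (X + C t) * (p * derivative p)) + C 2 * ((X + C t) * (p * p))
        + C a * (X * (p * p)) - X * (X + C t) * (p * p) := by
    simp only [derivative_mul, map_ofNat]; ring
  rw [e, map_sub, map_add, map_add, moment_C_mul, moment_C_mul, moment_C_mul, ← ip_eq_moment,
    ← ip_eq_moment, hpd, ip_monicPoly_eq_zero a t ht _ (derivative (monicPoly a t n)) ?_, ← hpd] at hp
  · change _ = ip a t p p
    linarith
  · exact degree_derivative_lt_pred _ _ (monicPoly_degree_lt a t (Nat.lt_succ_self n))

lemma ip_derivative_succ (a t : ℝ) (ht : 0 < t) (n : ℕ) :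
    ip a t (derivative (monicPoly a t (n + 1))) (monicPoly a t n)
    = (n + 1) * normSq a t n := by
  rw [ip_comm, ip_monicPoly_monic a t ht, coeff_derivative, monicPoly_coeff_self]
  · ring
  · exact degree_derivative_lt_pred _ _ (monicPoly_degree_lt a t (Nat.lt_succ_self _))

lemma moment_mixed_relation (a t : ℝ) (ht : 0 < t) (n : ℕ) :
    2 * moment a t ht ((X + C t) * (monicPoly a t (n + 1) * monicPoly a t n))
    + a * moment a t ht (X * (monicPoly a t (n + 1) * monicPoly a t n))
      = -((n + 1) * normSq a t n) := by
  have hp := moment_pearson a t ht (monicPoly a t (n + 1) * monicPoly a t n)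
  have hd := ip_derivative_succ a t ht n
  set p := monicPoly a t (n + 1) with hpd
  set q := monicPoly a t n with hqd
  have e : X * (X + C t) * derivative (p * q) + (2 * (X + C t) + C a * X - X * (X + C t)) * (p * q)
      = X * (X + C t) * (derivative p * q) + X * (X + C t) * (p * derivative q)
        + C 2 * ((X + C t) * (p * q))
        + C a * (X * (p * q)) - X * (X + C t) * (p * q) := by
    simp only [derivative_mul, map_ofNat]; ring
  rw [e, map_sub, map_add, map_add, map_add, moment_C_mul, moment_C_mul, ← ip_eq_moment,
    ← ip_eq_moment, ← ip_eq_moment, hd, hpd,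
    ip_monicPoly_eq_zero a t ht _ (derivative q) (lt_of_le_of_lt degree_derivative_le
      (monicPoly_degree_lt a t (Nat.lt_succ_self n))), hqd,
    monicPoly_orth a t ht _ _ (Nat.lt_succ_self n)] at hp
  linarith

/-- Multiplying the kernel at `0` or at `-t` by its Christoffel-Darboux factor restores the full
weight: `(X + t)(0 - X)` and `X (-t - X)` both equal `-X (X + t)`. The pairing with the kernel is
then `0` for `π_{n+1}` and a point value for `π_n`. -/
lemma moment_endpoint_relations (a t : ℝ) (ht : 0 < t) (n : ℕ) :
    (monicPoly a t (n + 1)).eval 0 *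
        moment a t ht ((X + C t) * (monicPoly a t (n + 1) * monicPoly a t n)) =
      (monicPoly a t n).eval 0 *
        moment a t ht ((X + C t) * (monicPoly a t (n + 1) * monicPoly a t (n + 1))) ∧
    (monicPoly a t (n + 1)).eval (-t) *
        moment a t ht (X * (monicPoly a t (n + 1) * monicPoly a t n)) =
      (monicPoly a t n).eval (-t) *
        moment a t ht (X * (monicPoly a t (n + 1) * monicPoly a t (n + 1))) ∧
    (monicPoly a t (n + 1)).eval 0 *
        moment a t ht ((X + C t) * (monicPoly a t n * monicPoly a t n)) =
      (monicPoly a t n).eval 0 *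
        (moment a t ht ((X + C t) * (monicPoly a t (n + 1) * monicPoly a t n)) - normSq a t n) ∧
    (monicPoly a t (n + 1)).eval (-t) *
        moment a t ht (X * (monicPoly a t n * monicPoly a t n)) =
      (monicPoly a t n).eval (-t) *
        (moment a t ht (X * (monicPoly a t (n + 1) * monicPoly a t n)) - normSq a t n) := by
  have hK (x) := ip_monicPoly_cdKernel a t ht (n + 1) x
  have hK' (x) := ip_cdKernel a t ht (n + 1) x _ (monicPoly_degree_lt a t (Nat.lt_succ_self n))
  have h := (normSq_pos a t ht n).ne'
  have c := christoffel_darboux_moment a t ht n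
  set p := monicPoly a t (n + 1) with hpd
  set q := monicPoly a t n with hqd
  have c1 := c 0 ((X + C t) * p)
  have c2 := c (-t) (X * p)
  have c3 := c 0 ((X + C t) * q)
  have c4 := c (-t) (X * q)
  have e0 (f : ℝ[X]) : (X + C t) * f * ((C 0 - X) * cdKernel a t (n + 1) 0)
      = C (-1) * (X * (X + C t) * (f * cdKernel a t (n + 1) 0)) := by simp; ring
  have e1 (f : ℝ[X]) : X * f * ((C (-t) - X) * cdKernel a t (n + 1) (-t))
      = C (-1) * (X * (X + C t) * (f * cdKernel a t (n + 1) (-t))) := by simp; ring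
  rw [e0, moment_C_mul, ← ip_eq_moment, hK] at c1
  rw [e1, moment_C_mul, ← ip_eq_moment, hK] at c2
  rw [e0, moment_C_mul, ← ip_eq_moment, hK'] at c3
  rw [e1, moment_C_mul, ← ip_eq_moment, hK'] at c4
  simp only [mul_assoc, mul_comm q p] at c1 c2 c3 c4
  refine ⟨?_, ?_, ?_, ?_⟩ <;> linarith

/-- The value `π_{n+1}'(x)` is the pairing of `π_{n+1}'` with the kernel at `x`. Integration by
parts transfers the derivative to the weight, leaving the poles `2/x` and `a/(x + t)`;
Christoffel-Darboux evaluates each contribution. -/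
lemma spectral_fst_moment (a t : ℝ) (ht : 0 < t) (n : ℕ) (x : ℝ) :
    x * (x + t) * (derivative (monicPoly a t (n + 1))).eval x * normSq a t n =
      -2 * (x + t) * ((monicPoly a t (n + 1)).eval x *
        moment a t ht ((X + C t) * (monicPoly a t (n + 1) * monicPoly a t n))
        - (monicPoly a t n).eval x *
        moment a t ht ((X + C t) * (monicPoly a t (n + 1) * monicPoly a t (n + 1))))
      - a * x * ((monicPoly a t (n + 1)).eval x *
        moment a t ht (X * (monicPoly a t (n + 1) * monicPoly a t n))
        - (monicPoly a t n).eval x *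
        moment a t ht (X * (monicPoly a t (n + 1) * monicPoly a t (n + 1)))) := by
  have hK := ip_monicPoly_cdKernel a t ht (n + 1) x
  have hdK := cdKernel_degree_lt a t (n + 1) x
  have hKd := ip_monicPoly_eq_zero a t ht (n + 1) (derivative (cdKernel a t (n + 1) x))
    (lt_of_le_of_lt degree_derivative_le hdK)
  have hr := ip_cdKernel a t ht (n + 1) x (derivative (monicPoly a t (n + 1)))
    (degree_derivative_lt_pred _ _ (monicPoly_degree_lt a t (Nat.lt_succ_self _)))
  have c := christoffel_darboux_moment a t ht n x
  have hp := moment_pearson a t ht (monicPoly a t (n + 1) * cdKernel a t (n + 1) x)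
  set p := monicPoly a t (n + 1) with hpd
  set q := monicPoly a t n with hqd
  set K := cdKernel a t (n + 1) x with hKdef
  have e : X * (X + C t) * derivative (p * K) + (2 * (X + C t) + C a * X - X * (X + C t)) * (p * K)
      = X * (X + C t) * (derivative p * K) + X * (X + C t) * (p * derivative K)
        + C 2 * ((X + C t) * (p * K))
        + C a * (X * (p * K)) - X * (X + C t) * (p * K) := by
    simp only [derivative_mul, map_ofNat]; ring
  rw [e, map_sub, map_add, map_add, map_add, moment_C_mul, moment_C_mul, ← ip_eq_moment,
    ← ip_eq_moment, ← ip_eq_moment, hr, hK, hKd] at hp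
  have c1 := c ((X + C t) * p)
  have c2 := c (X * p)
  have e1 : (X + C t) * p * ((C x - X) * K) = C x * ((X + C t) * (p * K))
    + C (-1) * (X * (X + C t) * (p * K)) := by simp; ring
  have e2 : X * p * ((C x - X) * K) = C (x + t) * (X * (p * K))
    + C (-1) * (X * (X + C t) * (p * K)) := by simp; ring
  rw [e1, moment_smul_add, ← ip_eq_moment, hK] at c1
  rw [e2, moment_smul_add, ← ip_eq_moment, hK] at c2
  simp only [mul_assoc] at c1 c2
  linear_combination x * (x + t) * normSq a t n * hp - 2 * (x + t) * c1 - a * x * c2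

/-- As for `π_{n+1}`, but `π_n` is no longer orthogonal to the kernel, so the regular part of the
logarithmic derivative of `w` also survives. -/
lemma spectral_snd_moment (a t : ℝ) (ht : 0 < t) (n : ℕ) (x : ℝ) :
    x * (x + t) * (derivative (monicPoly a t n)).eval x * normSq a t n =
      normSq a t n * (x * (x + t) - 2 * (x + t) - a * x) * (monicPoly a t n).eval x
      - 2 * (x + t) * ((monicPoly a t (n + 1)).eval x *
        moment a t ht ((X + C t) * (monicPoly a t n * monicPoly a t n))
        - (monicPoly a t n).eval x *
        moment a t ht ((X + C t) * (monicPoly a t (n + 1) * monicPoly a t n)))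
      - a * x * ((monicPoly a t (n + 1)).eval x *
        moment a t ht (X * (monicPoly a t n * monicPoly a t n))
        - (monicPoly a t n).eval x *
        moment a t ht (X * (monicPoly a t (n + 1) * monicPoly a t n))) := by
  have hdn := monicPoly_degree_lt a t (Nat.lt_succ_self n)
  have hK := ip_cdKernel a t ht (n + 1) x _ hdn
  have hdK := cdKernel_degree_lt a t (n + 1) x
  have hKd := ip_monicPoly_eq_zero a t ht n (derivative (cdKernel a t (n + 1) x))
    (degree_derivative_lt_pred _ _ hdK)
  have hr := ip_cdKernel a t ht (n + 1) x (derivative (monicPoly a t n))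
    (lt_of_le_of_lt degree_derivative_le hdn)
  have c := christoffel_darboux_moment a t ht n x
  have hp := moment_pearson a t ht (monicPoly a t n * cdKernel a t (n + 1) x)
  set p := monicPoly a t (n + 1) with hpd
  set q := monicPoly a t n with hqd
  set K := cdKernel a t (n + 1) x with hKdef
  have e : X * (X + C t) * derivative (q * K) + (2 * (X + C t) + C a * X - X * (X + C t)) * (q * K)
      = X * (X + C t) * (derivative q * K) + X * (X + C t) * (q * derivative K)
        + C 2 * ((X + C t) * (q * K))
        + C a * (X * (q * K)) - X * (X + C t) * (q * K) := by
    simp only [derivative_mul, map_ofNat]; ring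
  rw [e, map_sub, map_add, map_add, map_add, moment_C_mul, moment_C_mul, ← ip_eq_moment,
    ← ip_eq_moment, ← ip_eq_moment, hr, hK, hKd] at hp
  have c1 := c ((X + C t) * q)
  have c2 := c (X * q)
  have e1 : (X + C t) * q * ((C x - X) * K) = C x * ((X + C t) * (q * K))
    + C (-1) * (X * (X + C t) * (q * K)) := by simp; ring
  have e2 : X * q * ((C x - X) * K) = C (x + t) * (X * (q * K))
    + C (-1) * (X * (X + C t) * (q * K)) := by simp; ring
  rw [e1, moment_smul_add, ← ip_eq_moment, hK] at c1
  rw [e2, moment_smul_add, ← ip_eq_moment, hK] at c2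
  simp only [mul_assoc] at c1 c2
  simp only [mul_comm p q]
  linear_combination x * (x + t) * normSq a t n * hp - 2 * (x + t) * c1 - a * x * c2

lemma monicPoly_eval (a t : ℝ) (ha : -1 < a) (ht : 0 < t) (n : ℕ) (x : ℝ) :
    (monicPoly a t n).eval x = (monicPoly a t n).eval 0 * (qPoly a t n).eval x := by
  have := monicPoly_eval_zero_ne a t ha ht n
  rw [qPoly, eval_mul, eval_C]; field_simp

lemma monicPoly_derivative_eval (a t : ℝ) (ha : -1 < a) (ht : 0 < t) (n : ℕ) (x : ℝ) :
    (derivative (monicPoly a t n)).eval x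
      = (monicPoly a t n).eval 0 * (derivative (qPoly a t n)).eval x := by
  have := monicPoly_eval_zero_ne a t ha ht n
  rw [qPoly, derivative_C_mul, eval_mul, eval_C]; field_simp

lemma ratN_pos (a t : ℝ) (ha : -1 < a) (ht : 0 < t) (n : ℕ) : 0 < ratN a t (n + 1) := by
  have h := endpointProd_pos a t ha ht n
  have h1 := normSq_pos a t ht n
  have h2 := normSq_pos a t ht (n + 1)
  have h3 := monicPoly_eval_zero_ne a t ha ht (n + 1)
  have e : ratN a t (n + 1) = endpointProd a t n * normSq a t (n + 1)
      / (monicPoly a t (n + 1)).eval 0 ^ 2 := by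
    rw [ratN, endpointProd, recSq, Nat.add_sub_cancel]; field_simp
  rw [e]; positivity

lemma ratN_mul_ratM (a t : ℝ) (ha : -1 < a) (ht : 0 < t) (n : ℕ) :
    ratN a t (n + 1) * ratM a t (n + 1) = recSq a t (n + 1) := by
  have h3 := monicPoly_eval_zero_ne a t ha ht (n + 1)
  have h4 := monicPoly_eval_zero_ne a t ha ht n
  rw [ratN, ratM, Nat.add_sub_cancel]; field_simp

lemma qPoly_eval_neg_pos (a t : ℝ) (ha : -1 < a) (ht : 0 < t) (n : ℕ) :
    0 < (qPoly a t n).eval (-t) := by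
  have := (qPoly_eval_neg_bounds a t ha ht t ht.le n n le_rfl).1
  linarith

/-- The diagonal moments at level `n + 1` are fixed by `Y`; the endpoint relations carry them to the
mixed moments (factor `N`, or `N y` at `-t`) and then to those at level `n`. This is how all six
reduce to `N`, `M`, `y`, `Y`. -/
lemma moment_normalized (a t : ℝ) (ha : -1 < a) (ht : 0 < t) (n : ℕ) :
    2 * moment a t ht ((X + C t) * (monicPoly a t (n + 1) * monicPoly a t (n + 1)))
      = (1 - capY a t (n + 1)) * normSq a t (n + 1) ∧
    a * moment a t ht (X * (monicPoly a t (n + 1) * monicPoly a t (n + 1)))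
      = capY a t (n + 1) * normSq a t (n + 1) ∧
    2 * moment a t ht ((X + C t) * (monicPoly a t (n + 1) * monicPoly a t n))
      = -(ratN a t (n + 1) * (1 - capY a t (n + 1)) * normSq a t n) ∧
    a * moment a t ht (X * (monicPoly a t (n + 1) * monicPoly a t n))
      = -(ratN a t (n + 1) * diagRatio a t (n + 1) * capY a t (n + 1) * normSq a t n) ∧
    2 * moment a t ht ((X + C t) * (monicPoly a t n * monicPoly a t n)) * ratM a t (n + 1)
      = (ratN a t (n + 1) * (1 - capY a t (n + 1)) + 2) * normSq a t n ∧
    a * moment a t ht (X * (monicPoly a t n * monicPoly a t n)) * ratM a t (n + 1)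
      = diagRatio a t (n + 1) * (ratN a t (n + 1) * diagRatio a t (n + 1) * capY a t (n + 1) + a)
        * normSq a t n := by
  have hh := normSq_pos a t ht (n + 1)
  have hh' := normSq_pos a t ht n
  have hp := monicPoly_eval_zero_ne a t ha ht (n + 1)
  have hq := monicPoly_eval_zero_ne a t ha ht n
  have hpt := qPoly_eval_neg_pos a t ha ht (n + 1)
  have hqt := qPoly_eval_neg_pos a t ha ht n
  have r1 := moment_sq_relation a t ht (n + 1)
  obtain ⟨s1, s2, s3, s4⟩ := moment_endpoint_relations a t ht n
  rw [monicPoly_eval a t ha ht (n + 1) (-t), monicPoly_eval a t ha ht n (-t)] at s2 s4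
  have hY : a * moment a t ht (X * (monicPoly a t (n + 1) * monicPoly a t (n + 1)))
      = capY a t (n + 1) * normSq a t (n + 1) := by
    rw [capY, ip_sub_one_eq_moment a t ht]; field_simp
  have hN : ratN a t (n + 1) * normSq a t n * (monicPoly a t (n + 1)).eval 0
      = -((monicPoly a t n).eval 0 * normSq a t (n + 1)) := by
    rw [ratN, recSq, Nat.add_sub_cancel]; field_simp
  have hM : ratM a t (n + 1) * (monicPoly a t n).eval 0 = -(monicPoly a t (n + 1)).eval 0 := by
    rw [ratM, Nat.add_sub_cancel]; field_simp
  have hy : diagRatio a t (n + 1) * (qPoly a t (n + 1)).eval (-t) = (qPoly a t n).eval (-t) := by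
    rw [diagRatio, Nat.add_sub_cancel]; field_simp
  set p0 := (monicPoly a t (n + 1)).eval 0
  set q0 := (monicPoly a t n).eval 0
  set I0 := moment a t ht ((X + C t) * (monicPoly a t (n + 1) * monicPoly a t (n + 1)))
  set I1 := moment a t ht (X * (monicPoly a t (n + 1) * monicPoly a t (n + 1)))
  set J0 := moment a t ht ((X + C t) * (monicPoly a t (n + 1) * monicPoly a t n))
  set J1 := moment a t ht (X * (monicPoly a t (n + 1) * monicPoly a t n))
  set K0 := moment a t ht ((X + C t) * (monicPoly a t n * monicPoly a t n))
  set K1 := moment a t ht (X * (monicPoly a t n * monicPoly a t n))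
  set N := ratN a t (n + 1)
  set M := ratM a t (n + 1)
  set Y := capY a t (n + 1)
  set y := diagRatio a t (n + 1)
  set u := (qPoly a t (n + 1)).eval (-t)
  set v := (qPoly a t n).eval (-t)
  have h1 : 2 * I0 = (1 - Y) * normSq a t (n + 1) := by linarith
  have h3 : 2 * J0 = -(N * (1 - Y) * normSq a t n) := by
    apply mul_left_cancel₀ hp
    linear_combination 2 * s1 + q0 * h1 + (1 - Y) * hN
  have h4 : a * J1 = -(N * y * Y * normSq a t n) := by
    apply mul_left_cancel₀ (mul_ne_zero hp hpt.ne')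
    linear_combination a * s2 + q0 * v * hY + v * Y * hN + p0 * N * Y * normSq a t n * hy
  refine ⟨h1, hY, h3, h4, ?_, ?_⟩
  · apply mul_left_cancel₀ hq
    linear_combination 2 * K0 * hM - 2 * s3 - q0 * h3
  · apply mul_left_cancel₀ (mul_ne_zero hq hpt.ne')
    linear_combination a * K1 * u * hM - a * s4 - q0 * v * h4
      - q0 * normSq a t n * (N * y * Y + a) * hy

/-- Pearson's identity for `π_{n+1} π_n`. With `ratM_relation`, which is the one for `π_n²`, it
eliminates `N` and `M` in favour of `y` and `Y`. -/
lemma ratN_relation (a t : ℝ) (ha : -1 < a) (ht : 0 < t) (n : ℕ) :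
    ratN a t (n + 1) * (1 - capY a t (n + 1) + diagRatio a t (n + 1) * capY a t (n + 1))
      = n + 1 := by
  obtain ⟨-, -, h3, h4, -, -⟩ := moment_normalized a t ha ht n
  have h := moment_mixed_relation a t ht n
  apply mul_right_cancel₀ (normSq_pos a t ht n).ne'
  linear_combination -h + h3 + h4

lemma ratM_relation (a t : ℝ) (ha : -1 < a) (ht : 0 < t) (n : ℕ) :
    ratM a t (n + 1) = ratN a t (n + 1) * (1 - capY a t (n + 1)
      + diagRatio a t (n + 1) ^ 2 * capY a t (n + 1)) + 2 + a * diagRatio a t (n + 1) := by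
  obtain ⟨-, -, -, -, h5, h6⟩ := moment_normalized a t ha ht n
  have h := moment_sq_relation a t ht n
  apply mul_right_cancel₀ (normSq_pos a t ht n).ne'
  linear_combination -ratM a t (n + 1) * h + h5 + h6

lemma spectral_fst (a t : ℝ) (ha : -1 < a) (ht : 0 < t) (n : ℕ) (x : ℝ) :
    x * (x + t) * (derivative (qPoly a t (n + 1))).eval x
      = ((n + 1) * x + ratN a t (n + 1) * (1 - capY a t (n + 1)) * t) * (qPoly a t (n + 1)).eval x
        - ratN a t (n + 1) * (x + (1 - capY a t (n + 1)) * t) * (qPoly a t n).eval x := by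
  have h := spectral_fst_moment a t ht n x
  obtain ⟨h1, h2, h3, h4, -, -⟩ := moment_normalized a t ha ht n
  have hr := ratN_relation a t ha ht n
  have hp := monicPoly_eval_zero_ne a t ha ht (n + 1)
  have hh' := normSq_pos a t ht n
  have hN : ratN a t (n + 1) * normSq a t n * (monicPoly a t (n + 1)).eval 0
      = -((monicPoly a t n).eval 0 * normSq a t (n + 1)) := by
    rw [ratN, recSq, Nat.add_sub_cancel]; field_simp
  rw [monicPoly_derivative_eval a t ha ht, monicPoly_eval a t ha ht n x,
    monicPoly_eval a t ha ht (n + 1) x] at h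
  set p0 := (monicPoly a t (n + 1)).eval 0
  set q0 := (monicPoly a t n).eval 0
  set u := (qPoly a t (n + 1)).eval x
  set v := (qPoly a t n).eval x
  apply mul_left_cancel₀ (mul_ne_zero hp hh'.ne')
  linear_combination h - (x + t) * p0 * u * h3 + (x + t) * q0 * v * h1 - x * p0 * u * h4
    + x * q0 * v * h2 + p0 * normSq a t n * x * u * hr
    + v * (x + (1 - capY a t (n + 1)) * t) * hN

lemma spectral_snd (a t : ℝ) (ha : -1 < a) (ht : 0 < t) (n : ℕ) (x : ℝ) :
    x * (x + t) * (derivative (qPoly a t n)).eval x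
      = (x * (x + t) - 2 * (x + t) - a * x - (n + 1) * x
          - ratN a t (n + 1) * (1 - capY a t (n + 1)) * t) * (qPoly a t n).eval x
        + (ratM a t (n + 1) * x + (ratN a t (n + 1) * (1 - capY a t (n + 1)) + 2) * t)
          * (qPoly a t (n + 1)).eval x := by
  have h := spectral_snd_moment a t ht n x
  obtain ⟨-, -, h3, h4, h5, h6⟩ := moment_normalized a t ha ht n
  have hr := ratN_relation a t ha ht n
  have hr' := ratM_relation a t ha ht n
  have hq := monicPoly_eval_zero_ne a t ha ht n
  have hh' := normSq_pos a t ht n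
  have hM : ratM a t (n + 1) * (monicPoly a t n).eval 0 = -(monicPoly a t (n + 1)).eval 0 := by
    rw [ratM, Nat.add_sub_cancel]; field_simp
  rw [monicPoly_derivative_eval a t ha ht, monicPoly_eval a t ha ht n x,
    monicPoly_eval a t ha ht (n + 1) x] at h
  set p0 := (monicPoly a t (n + 1)).eval 0
  set q0 := (monicPoly a t n).eval 0
  set u := (qPoly a t (n + 1)).eval x
  set v := (qPoly a t n).eval x
  set K0 := moment a t ht ((X + C t) * (monicPoly a t n * monicPoly a t n))
  set K1 := moment a t ht (X * (monicPoly a t n * monicPoly a t n))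
  apply mul_left_cancel₀ (mul_ne_zero hq hh'.ne')
  linear_combination h + (x + t) * q0 * v * h3 + x * q0 * v * h4
    - (2 * (x + t) * K0 + a * x * K1) * u * hM + (x + t) * q0 * u * h5 + x * q0 * u * h6
    - q0 * normSq a t n * x * v * hr - q0 * normSq a t n * x * u * hr'

/-- The coefficient of `x^{n-1}` in `π_n`. -/
def subCoeff (a t : ℝ) : ℕ → ℝ
  | 0 => 0
  | n + 1 => (monicPoly a t (n + 1)).coeff n

lemma recDiag_eq_sub (a t : ℝ) (ht : 0 < t) (n : ℕ) :
    recDiag a t n = subCoeff a t n - subCoeff a t (n + 1) := by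
  have h := congrArg (fun p => p.coeff n) (three_term a t ht n)
  simp only [coeff_add, coeff_C_mul, monicPoly_coeff_self] at h
  have e1 : (X * monicPoly a t n).coeff n = subCoeff a t n := by
    cases n with
    | zero => simp [subCoeff]
    | succ n => rw [coeff_X_mul]; rfl
  have e2 : recSq a t n * (monicPoly a t (n - 1)).coeff n = 0 := by
    cases n with
    | zero => simp [recSq]
    | succ n => rw [monicPoly_coeff_of_lt a t (by simp), mul_zero]
  rw [e1, e2] at h
  change _ = subCoeff a t (n + 1) + _ + _ at h
  linarith

lemma coeff_X_mul_derivative (f : ℝ[X]) (n : ℕ) : (X * derivative f).coeff n = n * f.coeff n := by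
  cases n with
  | zero => simp
  | succ n => rw [coeff_X_mul, coeff_derivative]; push_cast; ring

/-- Pearson's identity for `f = x π_n²`, with `x π_n' = n π_n +` lower order. -/
lemma recDiag_eq (a t : ℝ) (ht : 0 < t) (n : ℕ) :
    recDiag a t n = 2 * n + a + 3 - t * capY a t n := by
  have hp := moment_pearson a t ht (X * (monicPoly a t n * monicPoly a t n))
  have hh := normSq_pos a t ht n
  have hd : ip a t (monicPoly a t n) (X * derivative (monicPoly a t n)) = n * normSq a t n := by
    rw [ip_monicPoly_monic a t ht, coeff_X_mul_derivative, monicPoly_coeff_self, mul_one]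
    exact degree_X_mul_lt _ _ (degree_derivative_lt_pred _ _
      (monicPoly_degree_lt a t (Nat.lt_succ_self n)))
  have hb : ip a t (monicPoly a t n) (X * monicPoly a t n) = recDiag a t n * normSq a t n := by
    rw [recDiag, ip_X_mul_left]; field_simp
  have hY : a * moment a t ht (X * (monicPoly a t n * monicPoly a t n))
      = capY a t n * normSq a t n := by
    rw [capY, ip_sub_one_eq_moment a t ht]; field_simp
  set p := monicPoly a t n with hpd
  have e : X * (X + C t) * derivative (X * (p * p))
      + (2 * (X + C t) + C a * X - X * (X + C t)) * (X * (p * p))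
      = C (3 + a) * (X * (X + C t) * (p * p)) + C 2 * (X * (X + C t) * (p * (X * derivative p)))
        - C (a * t) * (X * (p * p)) - X * (X + C t) * (p * (X * p)) := by
    simp only [derivative_mul, derivative_X, map_ofNat, C_add, C_mul]; ring
  rw [e, map_sub, map_sub, map_add, moment_C_mul, moment_C_mul, moment_C_mul, ← ip_eq_moment,
    ← ip_eq_moment, ← ip_eq_moment, hd, hb] at hp
  change (3 + a) * normSq a t n + _ - _ - _ = 0 at hp
  apply mul_right_cancel₀ hh.ne'
  linear_combination -hp - t * hY

lemma spectral_fst_monic (a t : ℝ) (ha : -1 < a) (ht : 0 < t) (n : ℕ) :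
    X * (X * derivative (monicPoly a t (n + 1))) + C t * (X * derivative (monicPoly a t (n + 1)))
      = C ((n : ℝ) + 1) * (X * monicPoly a t (n + 1))
        + C (ratN a t (n + 1) * (1 - capY a t (n + 1)) * t) * monicPoly a t (n + 1)
        + C (recSq a t (n + 1)) * (X * monicPoly a t n)
        + C (recSq a t (n + 1) * (1 - capY a t (n + 1)) * t) * monicPoly a t n := by
  refine Polynomial.funext fun x => ?_
  have h := spectral_fst a t ha ht n x
  have hp := monicPoly_eval_zero_ne a t ha ht (n + 1)
  have hN : ratN a t (n + 1) * (monicPoly a t (n + 1)).eval 0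
      = -(recSq a t (n + 1) * (monicPoly a t n).eval 0) := by
    rw [ratN, Nat.add_sub_cancel]; field_simp
  simp only [eval_add, eval_mul, eval_X, eval_C]
  rw [monicPoly_derivative_eval a t ha ht, monicPoly_eval a t ha ht n x,
    monicPoly_eval a t ha ht (n + 1) x]
  linear_combination (monicPoly a t (n + 1)).eval 0 * h
    - (x + (1 - capY a t (n + 1)) * t) * (qPoly a t n).eval x * hN

/-- The coefficient of `x^(n+1)` in the ladder relation for `π_{n+1}`. -/
lemma subCoeff_succ (a t : ℝ) (ha : -1 < a) (ht : 0 < t) (n : ℕ) :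
    subCoeff a t (n + 1) = (n + 1) * t - recSq a t (n + 1)
      - ratN a t (n + 1) * (1 - capY a t (n + 1)) * t := by
  have h := congrArg (fun p => p.coeff (n + 1)) (spectral_fst_monic a t ha ht n)
  simp only [coeff_add, coeff_C_mul, coeff_X_mul, coeff_X_mul_derivative, coeff_derivative,
    monicPoly_coeff_self, monicPoly_coeff_of_lt a t (Nat.lt_succ_self n)] at h
  have e : (monicPoly a t (n + 1)).coeff n = subCoeff a t (n + 1) := rfl
  rw [e] at h
  linarith

/-! ### Dependence on `t`: Toda equations and the planar system. -/

/-- A fixed summation range separates the two sources of `t`-dependence, the coefficients and the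
monomial moments, so that inner products of polynomial families can be differentiated termwise. -/
lemma ip_expand (a t : ℝ) (ht : 0 < t) (m : ℕ) (P Q : ℝ[X]) (hP : P.natDegree < m)
    (hQ : Q.natDegree < m) : ip a t P Q = ∑ i ∈ Finset.range m, ∑ j ∈ Finset.range m,
      P.coeff i * Q.coeff j * ip a t (X ^ i) (X ^ j) := by
  conv_lhs => rw [as_sum_range_C_mul_X_pow' P hP]
  rw [ip_sum_left a t ht]
  refine Finset.sum_congr rfl fun i _ => ?_
  rw [ip_C_mul_left, ip_comm]
  conv_lhs => rw [as_sum_range_C_mul_X_pow' Q hQ]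
  rw [ip_sum_left a t ht, Finset.mul_sum]
  refine Finset.sum_congr rfl fun j _ => ?_
  rw [ip_C_mul_left, ip_comm, mul_assoc]

lemma hasDerivAt_ip_family (a t : ℝ) (ht : 0 < t) (m : ℕ) (P Q : ℝ → ℝ[X]) (P' Q' : ℝ[X])
    (hP : ∀ τ, (P τ).natDegree < m) (hQ : ∀ τ, (Q τ).natDegree < m)
    (hP' : P'.natDegree < m) (hQ' : Q'.natDegree < m)
    (dP : ∀ i, HasDerivAt (fun τ => (P τ).coeff i) (P'.coeff i) t)
    (dQ : ∀ i, HasDerivAt (fun τ => (Q τ).coeff i) (Q'.coeff i) t) :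
    HasDerivAt (fun τ => ip a τ (P τ) (Q τ))
      (ip a t P' (Q t) + ip a t (P t) Q' + a * ip (a - 1) t (P t) (Q t)) t := by
  have h : HasDerivAt (fun τ => ∑ i ∈ Finset.range m, ∑ j ∈ Finset.range m,
      (P τ).coeff i * (Q τ).coeff j * ip a τ (X ^ i) (X ^ j))
      (∑ i ∈ Finset.range m, ∑ j ∈ Finset.range m,
        ((P'.coeff i * (Q t).coeff j + (P t).coeff i * Q'.coeff j) * ip a t (X ^ i) (X ^ j)
          + (P t).coeff i * (Q t).coeff j * (a * ip (a - 1) t (X ^ i) (X ^ j)))) t :=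
    HasDerivAt.fun_sum fun i _ => HasDerivAt.fun_sum fun j _ =>
      ((dP i).mul (dQ j)).mul (hasDerivAt_ip a t ht _ _)
  refine (h.congr_of_eventuallyEq ?_).congr_deriv ?_
  · filter_upwards [Ioi_mem_nhds ht] with τ hτ
    exact ip_expand a τ hτ m _ _ (hP τ) (hQ τ)
  · rw [ip_expand a t ht m _ _ hP' (hQ t), ip_expand a t ht m _ _ (hP t) hQ',
      ip_expand (a - 1) t ht m _ _ (hP t) (hQ t), Finset.mul_sum, ← Finset.sum_add_distrib,
      ← Finset.sum_add_distrib]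
    refine Finset.sum_congr rfl fun i _ => ?_
    rw [Finset.mul_sum, ← Finset.sum_add_distrib, ← Finset.sum_add_distrib]
    refine Finset.sum_congr rfl fun j _ => ?_
    ring

lemma differentiableAt_monicPoly_coeff (a t : ℝ) (ht : 0 < t) (n : ℕ) :
    ∀ k, DifferentiableAt ℝ (fun τ => (monicPoly a τ n).coeff k) t := by
  induction n using Nat.strong_induction_on with
  | _ n ih =>
    intro k
    have hd (j : ℕ) (hj : j < n) (R : ℝ → ℝ[X]) (hR : ∀ τ, (R τ).natDegree < n + 1)
        (dR : ∀ i, DifferentiableAt ℝ (fun τ => (R τ).coeff i) t) :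
        DifferentiableAt ℝ (fun τ => ip a τ (R τ) (monicPoly a τ j)) t := by
      have h : DifferentiableAt ℝ (fun τ => ∑ i ∈ Finset.range (n + 1), ∑ l ∈ Finset.range (n + 1),
          (R τ).coeff i * (monicPoly a τ j).coeff l * ip a τ (X ^ i) (X ^ l)) t :=
        DifferentiableAt.fun_sum fun i _ => DifferentiableAt.fun_sum fun l _ =>
          ((dR i).mul (ih j hj l)).mul (hasDerivAt_ip a t ht _ _).differentiableAt
      refine h.congr_of_eventuallyEq ?_
      filter_upwards [Ioi_mem_nhds ht] with τ hτ
      exact ip_expand a τ hτ (n + 1) _ _ (hR τ) (by rw [(monicPoly_monic a τ j).2]; omega)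
    have e : (fun τ => (monicPoly a τ n).coeff k) = fun τ => ((X ^ n : ℝ[X]).coeff k
        - ∑ j : Fin n, ip a τ (X ^ n) (monicPoly a τ j) /
          ip a τ (monicPoly a τ j) (monicPoly a τ j) * (monicPoly a τ j).coeff k) := by
      ext τ
      rw [monicPoly, coeff_sub, finsetSum_coeff]
      simp only [coeff_C_mul]
    rw [e]
    refine (differentiableAt_const _).sub (DifferentiableAt.fun_sum fun j _ => ?_)
    refine DifferentiableAt.mul (DifferentiableAt.div ?_ ?_ ?_) (ih j j.2 k)
    · exact hd j j.2 (fun _ => X ^ n) (fun τ => by simp) (fun i => differentiableAt_const _)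
    · exact hd j j.2 (fun τ => monicPoly a τ j)
        (fun τ => by rw [(monicPoly_monic a τ j).2]; omega) (ih j j.2)
    · exact (normSq_pos a t ht j).ne'

/-- The derivative of `π_n` with respect to the parameter `t`. -/
def monicPolyDeriv (a t : ℝ) (n : ℕ) : ℝ[X] :=
  ∑ k ∈ Finset.range n, C (deriv (fun τ => (monicPoly a τ n).coeff k) t) * X ^ k

lemma monicPolyDeriv_degree_lt (a t : ℝ) (n : ℕ) : (monicPolyDeriv a t n).degree < n := by
  rw [monicPolyDeriv, ← mem_degreeLT]
  refine Submodule.sum_mem _ fun k hk => mem_degreeLT.2 (degree_C_mul_lt _ _ _ ?_)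
  rw [degree_X_pow]
  exact_mod_cast Finset.mem_range.1 hk

lemma hasDerivAt_monicPoly_coeff (a t : ℝ) (ht : 0 < t) (n k : ℕ) :
    HasDerivAt (fun τ => (monicPoly a τ n).coeff k) ((monicPolyDeriv a t n).coeff k) t := by
  rcases lt_trichotomy k n with h | rfl | h
  · have e : (monicPolyDeriv a t n).coeff k = deriv (fun τ => (monicPoly a τ n).coeff k) t := by
      rw [monicPolyDeriv, finsetSum_coeff]
      simp only [coeff_C_mul, coeff_X_pow, mul_ite, mul_one, mul_zero]
      rw [Finset.sum_ite_eq, if_pos (Finset.mem_range.2 h)]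
    rw [e]
    exact (differentiableAt_monicPoly_coeff a t ht n k).hasDerivAt
  · simp only [monicPoly_coeff_self]
    rw [degree_lt_iff_coeff_zero _ _ |>.1 (monicPolyDeriv_degree_lt a t k) k le_rfl]
    exact hasDerivAt_const _ _
  · simp only [monicPoly_coeff_of_lt _ _ h]
    rw [degree_lt_iff_coeff_zero _ _ |>.1 (monicPolyDeriv_degree_lt a t n) k h.le]
    exact hasDerivAt_const _ _

lemma natDegree_lt_of_degree_lt_succ (f : ℝ[X]) (n : ℕ) (h : f.degree < n) :
    f.natDegree < n + 1 := by
  rcases eq_or_ne f 0 with rfl | hf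
  · simp
  · have := (natDegree_lt_iff_degree_lt hf).2 h; omega

/-- Differentiate `⟨π_n, π_k⟩ = 0` in `t`; the term with `∂_t π_k` vanishes because its degree is
below `n`. -/
lemma ip_monicPolyDeriv (a t : ℝ) (ht : 0 < t) (n k : ℕ) (hk : k < n) :
    ip a t (monicPolyDeriv a t n) (monicPoly a t k)
      = -(a * ip (a - 1) t (monicPoly a t n) (monicPoly a t k)) := by
  have h := hasDerivAt_ip_family a t ht (n + 1) (fun τ => monicPoly a τ n)
    (fun τ => monicPoly a τ k) (monicPolyDeriv a t n) (monicPolyDeriv a t k)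
    (fun τ => by rw [(monicPoly_monic a τ n).2]; omega)
    (fun τ => by rw [(monicPoly_monic a τ k).2]; omega)
    (natDegree_lt_of_degree_lt_succ _ _ (monicPolyDeriv_degree_lt a t n))
    ((natDegree_lt_of_degree_lt_succ _ _ (monicPolyDeriv_degree_lt a t k)).trans (by omega))
    (hasDerivAt_monicPoly_coeff a t ht n) (hasDerivAt_monicPoly_coeff a t ht k)
  have h0 : HasDerivAt (fun τ => ip a τ (monicPoly a τ n) (monicPoly a τ k)) 0 t := by
    refine (hasDerivAt_const t (0:ℝ)).congr_of_eventuallyEq ?_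
    filter_upwards [Ioi_mem_nhds ht] with τ hτ
    exact monicPoly_orth a τ hτ n k hk
  have := h.unique h0
  rw [ip_monicPoly_eq_zero a t ht n _ ((monicPolyDeriv_degree_lt a t k).trans
    (by exact_mod_cast hk))] at this
  linarith

/-- The operator `t ∂_t` acts on the weight as multiplication by `a t / (x + t)`, which Pearson's
identity for `f = x π_n π_k` trades for the Euler operator `x ∂_x` and a multiplication by `x`. The
difference of the two sides has degree below `n` and is orthogonal to every `π_k` with `k < n`. -/
lemma toda (a t : ℝ) (ht : 0 < t) (n : ℕ) :
    C t * monicPolyDeriv a t n = C (n : ℝ) * monicPoly a t n - X * derivative (monicPoly a t n)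
      + C (recSq a t n) * monicPoly a t (n - 1) := by
  have hdn := monicPoly_degree_lt a t (Nat.lt_succ_self n)
  have hE : C t * monicPolyDeriv a t n - (C (n : ℝ) * monicPoly a t n
      - X * derivative (monicPoly a t n)) = C (recSq a t n) * monicPoly a t (n - 1) := by
    cases n with
    | zero => simp [recSq, monicPolyDeriv, monicPoly_zero]
    | succ n =>
    rw [← sub_eq_zero]
    refine eq_zero_of_orth a t ht _ (n + 1) ?_ fun k hk => ?_
    · refine degree_sub_lt_of_lt _ _ _ (degree_sub_lt_of_lt _ _ _ (degree_C_mul_lt _ _ _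
        (monicPolyDeriv_degree_lt a t _)) ?_) (degree_C_mul_lt _ _ _ (monicPoly_degree_lt a t
          (by simp)))
      rw [degree_lt_iff_coeff_zero]
      intro m hm
      rw [coeff_sub, coeff_C_mul, coeff_X_mul_derivative]
      rcases hm.eq_or_lt with rfl | h
      · ring
      · rw [monicPoly_coeff_of_lt a t h]; ring
    · have hp := moment_pearson a t ht (X * (monicPoly a t (n + 1) * monicPoly a t k))
      have hdd := ip_monicPolyDeriv a t ht (n + 1) k hk
      rw [ip_sub_one_eq_moment a t ht] at hdd
      have ho := monicPoly_orth a t ht (n + 1) k hk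
      have hkd : ip a t (monicPoly a t (n + 1)) (X * derivative (monicPoly a t k)) = 0 := by
        refine ip_monicPoly_eq_zero a t ht _ _ (lt_of_lt_of_le (degree_X_mul_lt _ _
          (degree_derivative_lt_pred _ _ (monicPoly_degree_lt a t (Nat.lt_succ_self k)))) ?_)
        exact_mod_cast hk
      have hX : ip a t (monicPoly a t (n + 1)) (X * monicPoly a t k)
          = recSq a t (n + 1) * ip a t (monicPoly a t n) (monicPoly a t k) := by
        have h1 := (normSq_pos a t ht n).ne'
        rw [ip_monicPoly_monic a t ht _ _ (degree_X_mul_lt _ _ (monicPoly_degree_lt a t hk)),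
          coeff_X_mul]
        rcases (show k ≤ n by omega).eq_or_lt with rfl | hkn
        · rw [monicPoly_coeff_self, recSq]
          change _ = _ / normSq a t k * normSq a t k
          field_simp
        · rw [monicPoly_coeff_of_lt a t hkn, monicPoly_orth a t ht n k hkn]; ring
      rw [ip_sub_left a t ht, ip_sub_left a t ht, ip_sub_left a t ht, ip_C_mul_left, ip_C_mul_left,
        ip_C_mul_left, hdd, ho, Nat.add_sub_cancel, ← hX]
      set p := monicPoly a t (n + 1) with hpd
      set q := monicPoly a t k with hqd
      have e : X * (X + C t) * derivative (X * (p * q))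
          + (2 * (X + C t) + C a * X - X * (X + C t)) * (X * (p * q))
          = C (3 + a) * (X * (X + C t) * (p * q)) + X * (X + C t) * (p * (X * derivative q))
            + X * (X + C t) * ((X * derivative p) * q)
            - C (a * t) * (X * (p * q)) - X * (X + C t) * (p * (X * q)) := by
        simp only [derivative_mul, derivative_X, map_ofNat, C_add, C_mul]; ring
      rw [e, map_sub, map_sub, map_add, map_add, moment_C_mul, moment_C_mul, ← ip_eq_moment,
        ← ip_eq_moment, ← ip_eq_moment, ← ip_eq_moment, ho, hkd] at hp
      linarith
  rw [← hE]; ring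

lemma hasDerivAt_subCoeff (a t : ℝ) (ht : 0 < t) (n : ℕ) :
    HasDerivAt (fun τ => subCoeff a τ n) ((subCoeff a t n + recSq a t n) / t) t := by
  cases n with
  | zero =>
    simp only [subCoeff, recSq, add_zero, zero_div]
    exact hasDerivAt_const _ _
  | succ n =>
    refine (hasDerivAt_monicPoly_coeff a t ht (n + 1) n).congr_deriv ?_
    have h := congrArg (fun p => p.coeff n) (toda a t ht (n + 1))
    simp only [coeff_add, coeff_sub, coeff_C_mul, coeff_X_mul_derivative, Nat.add_sub_cancel,
      monicPoly_coeff_self] at h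
    rw [eq_div_iff ht.ne']
    change _ = (monicPoly a t (n + 1)).coeff n + _
    push_cast at h
    linarith

lemma hasDerivAt_recDiag (a t : ℝ) (ht : 0 < t) (n : ℕ) :
    HasDerivAt (fun τ => recDiag a τ n)
      ((recDiag a t n + recSq a t n - recSq a t (n + 1)) / t) t := by
  have h := (hasDerivAt_subCoeff a t ht n).sub (hasDerivAt_subCoeff a t ht (n + 1))
  refine (h.congr_of_eventuallyEq ?_).congr_deriv ?_
  · filter_upwards [Ioi_mem_nhds ht] with τ hτ
    exact recDiag_eq_sub a τ hτ n
  · rw [recDiag_eq_sub a t ht]; ring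

/-- The mixed moment at level `n + 2` is reduced to level `n + 1` by the three-term recurrence,
which makes the difference of consecutive squared coefficients a function of data at level `n + 1`
alone. This closes the equation for `Y`. -/
lemma recSq_sub (a t : ℝ) (ha : -1 < a) (ht : 0 < t) (n : ℕ) :
    recSq a t (n + 2) - recSq a t (n + 1) = recDiag a t (n + 1) + 3 * t
      + 2 * ratN a t (n + 1) * (1 - capY a t (n + 1)) * t
      - recDiag a t (n + 1) * (1 - capY a t (n + 1)) * t := by
  have s1 := subCoeff_succ a t ha ht n
  have s2 := subCoeff_succ a t ha ht (n + 1)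
  have s3 := recDiag_eq_sub a t ht (n + 1)
  obtain ⟨h1, -, h3, -, -, -⟩ := moment_normalized a t ha ht n
  obtain ⟨-, -, k3, -, -, -⟩ := moment_normalized a t ha ht (n + 1)
  have hh := normSq_pos a t ht (n + 1)
  have hh' := normSq_pos a t ht n
  have e : (X + C t) * (monicPoly a t (n + 1 + 1) * monicPoly a t (n + 1))
      = X * (X + C t) * (monicPoly a t (n + 1) * monicPoly a t (n + 1))
        - C (recDiag a t (n + 1)) * ((X + C t) * (monicPoly a t (n + 1) * monicPoly a t (n + 1)))
        - C (recSq a t (n + 1)) * ((X + C t) * (monicPoly a t (n + 1) * monicPoly a t n)) := by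
    have h3t := three_term a t ht (n + 1)
    rw [Nat.add_sub_cancel] at h3t
    rw [show monicPoly a t (n + 1 + 1) = X * monicPoly a t (n + 1)
      - C (recDiag a t (n + 1)) * monicPoly a t (n + 1) - C (recSq a t (n + 1)) * monicPoly a t n by
        rw [h3t]; ring]
    ring
  rw [e, map_sub, map_sub, moment_C_mul, moment_C_mul, ← ip_eq_moment] at k3
  change 2 * (normSq a t (n + 1) - _ - _) = _ at k3
  have hA : recSq a t (n + 1) * normSq a t n = normSq a t (n + 1) := by
    rw [recSq]; field_simp
  have key : ratN a t (n + 1 + 1) * (1 - capY a t (n + 1 + 1)) = -2 + recDiag a t (n + 1) *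
      (1 - capY a t (n + 1)) - ratN a t (n + 1) * (1 - capY a t (n + 1)) := by
    apply mul_right_cancel₀ hh.ne'
    linear_combination k3 + recDiag a t (n + 1) * h1 + recSq a t (n + 1) * h3
      - ratN a t (n + 1) * (1 - capY a t (n + 1)) * hA
  push_cast at s2
  linear_combination -s3 - s1 + s2 - t * key

/-- By `recDiag_eq`, `Y` is an affine function of the diagonal recurrence coefficient divided by
`t`, and the Toda equation for that coefficient applies. -/
lemma hasDerivAt_capY (a t : ℝ) (ha : -1 < a) (ht : 0 < t) (n : ℕ) :
    HasDerivAt (fun τ => capY a τ (n + 1)) ((-a + (a + 2) * capY a t (n + 1)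
      + 2 * (n + 1 - ratN a t (n + 1) * diagRatio a t (n + 1)) * capY a t (n + 1)
      + t * capY a t (n + 1) - t * capY a t (n + 1) ^ 2) / t) t := by
  have h := ((hasDerivAt_recDiag a t ht (n + 1)).const_sub (2 * ((n + 1 : ℕ) : ℝ) + a + 3)).div
    (hasDerivAt_id t) ht.ne'
  refine (h.congr_of_eventuallyEq ?_).congr_deriv ?_
  · filter_upwards [Ioi_mem_nhds ht] with τ hτ
    have hτ' : (0:ℝ) < τ := hτ
    simp only [Pi.div_apply, id]
    rw [recDiag_eq a τ hτ]; field_simp; ring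
  · have h1 := recSq_sub a t ha ht n
    have h2 := recDiag_eq a t ht (n + 1)
    have h3 := ratN_relation a t ha ht n
    simp only [id]
    rw [show recSq a t (n + 1 + 1) = recSq a t (n + 1) + (recDiag a t (n + 1) + 3 * t
      + 2 * ratN a t (n + 1) * (1 - capY a t (n + 1)) * t
      - recDiag a t (n + 1) * (1 - capY a t (n + 1)) * t) by linarith, h2]
    push_cast
    field_simp
    linear_combination 2 * t * h3

lemma toda_eval_fst (a t : ℝ) (ha : -1 < a) (ht : 0 < t) (n : ℕ) :
    C t * monicPolyDeriv a t (n + 1) = C ((monicPoly a t (n + 1)).eval 0) *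
      (C ((n : ℝ) + 1) * qPoly a t (n + 1) - X * derivative (qPoly a t (n + 1))
        - C (ratN a t (n + 1)) * qPoly a t n) := by
  have hp := monicPoly_eval_zero_ne a t ha ht (n + 1)
  have hN : recSq a t (n + 1) * (monicPoly a t n).eval 0
      = -(ratN a t (n + 1) * (monicPoly a t (n + 1)).eval 0) := by
    rw [ratN, Nat.add_sub_cancel]; field_simp
  rw [toda a t ht, Nat.add_sub_cancel]
  refine Polynomial.funext fun x => ?_
  simp only [eval_add, eval_sub, eval_mul, eval_X, eval_C]
  rw [monicPoly_derivative_eval a t ha ht, monicPoly_eval a t ha ht n x,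
    monicPoly_eval a t ha ht (n + 1) x]
  push_cast
  linear_combination (qPoly a t n).eval x * hN

lemma toda_eval_snd (a t : ℝ) (ha : -1 < a) (ht : 0 < t) (n : ℕ) :
    C t * monicPolyDeriv a t n = C ((monicPoly a t n).eval 0) *
      (C ((n : ℝ) - recDiag a t n) * qPoly a t n - X * derivative (qPoly a t n)
        + X * qPoly a t n + C (ratM a t (n + 1)) * qPoly a t (n + 1)) := by
  have hq := monicPoly_eval_zero_ne a t ha ht n
  have hM : ratM a t (n + 1) * (monicPoly a t n).eval 0 = -(monicPoly a t (n + 1)).eval 0 := by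
    rw [ratM, Nat.add_sub_cancel]; field_simp
  rw [toda a t ht]
  refine Polynomial.funext fun x => ?_
  have h3 := congrArg (eval x) (three_term a t ht n)
  simp only [eval_add, eval_sub, eval_mul, eval_X, eval_C] at h3 ⊢
  rw [monicPoly_derivative_eval a t ha ht]
  rw [monicPoly_eval a t ha ht n x, monicPoly_eval a t ha ht (n + 1) x] at h3
  rw [monicPoly_eval a t ha ht n x]
  linear_combination -h3 - (qPoly a t (n + 1)).eval x * hM

/-- Quotient rule for `π_n / π_n(0)`: the normalisation subtracts the value of `D` at `0` times
`Q_n`. -/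
lemma hasDerivAt_qPoly_coeff (a t : ℝ) (ha : -1 < a) (ht : 0 < t) (n k : ℕ) (D : ℝ[X])
    (hD : C t * monicPolyDeriv a t n = C ((monicPoly a t n).eval 0) * D) :
    HasDerivAt (fun τ => (qPoly a τ n).coeff k)
      ((C (1 / t) * (D - C (D.eval 0) * qPoly a t n)).coeff k) t := by
  have hq := monicPoly_eval_zero_ne a t ha ht n
  have h1 (k) : (monicPolyDeriv a t n).coeff k = (monicPoly a t n).eval 0 * D.coeff k / t := by
    have := congrArg (fun p => p.coeff k) hD
    simp only [coeff_C_mul] at this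
    rw [← this]; field_simp
  have h2 := hasDerivAt_monicPoly_coeff a t ht n
  rw [← coeff_zero_eq_eval_zero] at hq
  refine (((h2 k).div (h2 0) hq).congr_of_eventuallyEq ?_).congr_deriv ?_
  · filter_upwards with τ
    simp only [Pi.div_apply]
    rw [qPoly, coeff_C_mul, coeff_zero_eq_eval_zero]; ring
  · rw [h1, h1, coeff_C_mul, coeff_sub, coeff_C_mul, qPoly, coeff_C_mul, ← coeff_zero_eq_eval_zero,
      ← coeff_zero_eq_eval_zero]
    field_simp

lemma hasDerivAt_qPoly_coeff_fst (a t : ℝ) (ha : -1 < a) (ht : 0 < t) (n k : ℕ) :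
    HasDerivAt (fun τ => (qPoly a τ (n + 1)).coeff k)
      ((C (1 / t) * (C (ratN a t (n + 1)) * (qPoly a t (n + 1) - qPoly a t n)
        - X * derivative (qPoly a t (n + 1)))).coeff k) t := by
  refine (hasDerivAt_qPoly_coeff a t ha ht (n + 1) k _ (toda_eval_fst a t ha ht n)).congr_deriv ?_
  congr 2
  simp only [eval_add, eval_sub, eval_mul, eval_X, eval_C, qPoly_eval_zero a t ha ht, C_sub, C_add,
    zero_mul, mul_one, C_0]
  ring

/-- Here `Q_n` is differentiated through the pair `Q_n`, `Q_{n+1}` instead of `Q_{n-1}`, `Q_n`, so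
that two consecutive ratios obey a closed system. -/
lemma hasDerivAt_qPoly_coeff_snd (a t : ℝ) (ha : -1 < a) (ht : 0 < t) (n k : ℕ) :
    HasDerivAt (fun τ => (qPoly a τ n).coeff k)
      ((C (1 / t) * (C (ratM a t (n + 1)) * (qPoly a t (n + 1) - qPoly a t n)
        - X * derivative (qPoly a t n) + X * qPoly a t n)).coeff k) t := by
  refine (hasDerivAt_qPoly_coeff a t ha ht n k _ (toda_eval_snd a t ha ht n)).congr_deriv ?_
  congr 2
  simp only [eval_add, eval_sub, eval_mul, eval_X, eval_C, qPoly_eval_zero a t ha ht, C_sub, C_add,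
    zero_mul, mul_one, C_0]
  ring

lemma qPoly_natDegree_lt (a t : ℝ) (n : ℕ) : (qPoly a t n).natDegree < n + 2 := by
  refine natDegree_lt_of_degree_lt_succ _ _ (degree_C_mul_lt _ _ _ ?_)
  exact monicPoly_degree_lt a t (Nat.lt_succ_self n)

/-- Differentiation of a polynomial family, evaluated at a moving point. -/
lemma hasDerivAt_aeval_family {𝕜 : Type*} [NontriviallyNormedField 𝕜] [NormedAlgebra ℝ 𝕜]
    (m : ℕ) (t : ℝ) (P : ℝ → ℝ[X])
    (P' : ℝ[X]) (hP : ∀ τ, (P τ).natDegree < m)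
    (dP : ∀ i, HasDerivAt (fun τ => (P τ).coeff i) (P'.coeff i) t) (g : ℝ → 𝕜) (g' : 𝕜)
    (hg : HasDerivAt g g' t) :
    HasDerivAt (fun τ => aeval (g τ) (P τ))
      (aeval (g t) P' + aeval (g t) (derivative (P t)) * g') t := by
  have hP' : P'.natDegree < m := by
    by_contra hc
    have h0 : P' ≠ 0 := by
      rintro rfl
      have := hP t
      simp at hc; omega
    have : P'.coeff P'.natDegree = 0 := by
      refine (dP _).unique ?_
      have : (fun τ => (P τ).coeff P'.natDegree) = fun _ => 0 := by
        ext τ; exact coeff_eq_zero_of_natDegree_lt ((hP τ).trans_le (not_lt.1 hc))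
      rw [this]; exact hasDerivAt_const _ _
    exact h0 (leadingCoeff_eq_zero.1 this)
  have h : HasDerivAt (fun τ => ∑ i ∈ Finset.range m, (P τ).coeff i • g τ ^ i)
      (∑ i ∈ Finset.range m, ((P t).coeff i • ((i : 𝕜) * g t ^ (i - 1) * g')
        + P'.coeff i • g t ^ i)) t :=
    HasDerivAt.fun_sum fun i _ => (dP i).smul (hg.pow i)
  have e (f : ℝ[X]) (hf : f.natDegree < m) (x : 𝕜) :
      aeval x f = ∑ i ∈ Finset.range m, f.coeff i • x ^ i := by
    rw [aeval_eq_sum_range' hf]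
  refine (h.congr_of_eventuallyEq ?_).congr_deriv ?_
  · filter_upwards with τ
    exact e _ (hP τ) _
  · rw [Finset.sum_add_distrib, add_comm, e P' hP']
    congr 1
    conv_rhs => rw [as_sum_range_C_mul_X_pow' (P t) (hP t)]
    rw [derivative_sum, map_sum, Finset.sum_mul]
    refine Finset.sum_congr rfl fun i _ => ?_
    simp only [derivative_C_mul_X_pow, map_mul, aeval_C, map_pow, aeval_X, map_natCast]
    rw [Algebra.smul_def]
    ring

/-- At the moving point `x = -t` the Euler term `-x ∂_x / t` of the parameter derivative cancels the
transport term exactly, so no `x`-derivative of `Q` remains. -/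
lemma hasDerivAt_diagRatio (a t : ℝ) (ha : -1 < a) (ht : 0 < t) (n : ℕ) :
    HasDerivAt (fun τ => diagRatio a τ (n + 1)) ((-t * diagRatio a t (n + 1)
      + (1 - diagRatio a t (n + 1)) * (ratM a t (n + 1)
        - ratN a t (n + 1) * diagRatio a t (n + 1))) / t) t := by
  have hu := qPoly_eval_neg_pos a t ha ht (n + 1)
  have h1 := hasDerivAt_aeval_family (n + 2) t (fun τ => qPoly a τ n) _
    (fun τ => qPoly_natDegree_lt a τ n) (hasDerivAt_qPoly_coeff_snd a t ha ht n)
    (fun τ => -τ) (-1) (hasDerivAt_neg t)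
  have h2 := hasDerivAt_aeval_family (n + 3) t (fun τ => qPoly a τ (n + 1)) _
    (fun τ => qPoly_natDegree_lt a τ (n + 1)) (hasDerivAt_qPoly_coeff_fst a t ha ht n)
    (fun τ => -τ) (-1) (hasDerivAt_neg t)
  simp only [coe_aeval_eq_eval] at h1 h2
  refine (h1.div h2 hu.ne').congr_deriv ?_
  simp only [eval_add, eval_sub, eval_mul, eval_X, eval_C, diagRatio, Nat.add_sub_cancel]
  field_simp
  ring

/-- Let `I` and `J` be the normalised integrals of `π_n² w / (x + t)` and `π_n² w / x`. Then `0 ≤ I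
≤ J` and `2 J + a I = 1`, so `(a + 2) I ≤ 1`. -/
lemma capY_eq (a t : ℝ) (ha : -1 < a) (ht : 0 < t) (n : ℕ) :
    ∃ θ : ℝ, capY a t n = a * θ ∧ 0 ≤ θ ∧ θ ≤ 1 / (a + 2) := by
  have hh := normSq_pos a t ht n
  have h := moment_sq_relation a t ht n
  set p := monicPoly a t n
  have h0 : 0 ≤ moment a t ht (X * (p * p)) := moment_nonneg a t ht _ fun x hx => by
    simp only [eval_mul, eval_X]
    exact mul_nonneg hx.le (mul_self_nonneg _)
  have h1 : moment a t ht (X * (p * p)) ≤ moment a t ht ((X + C t) * (p * p)) := by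
    rw [← sub_nonneg, ← map_sub]
    refine moment_nonneg a t ht _ fun x hx => ?_
    simp only [eval_sub, eval_mul, eval_X, eval_add, eval_C]
    nlinarith [mul_nonneg ht.le (mul_self_nonneg (p.eval x))]
  refine ⟨moment a t ht (X * (p * p)) / normSq a t n, ?_, by positivity, ?_⟩
  · rw [capY, ip_sub_one_eq_moment a t ht, mul_div_assoc]
  · rw [div_le_div_iff₀ hh (by linarith)]
    linarith

/-- The combination in which the leading order of `N` and `M` cancels: the factor `1 - y` exhibits
it as `O(1/n)` in the scaling. -/
lemma spectral_coefficient (a t : ℝ) (ha : -1 < a) (ht : 0 < t) (n : ℕ) :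
    2 * ((n : ℝ) + 1) - ratN a t (n + 1) - ratM a t (n + 1) + 2 + a
      = (1 - diagRatio a t (n + 1)) * (a - ratN a t (n + 1) * (1 - diagRatio a t (n + 1))
        * capY a t (n + 1)) := by
  have h1 := ratN_relation a t ha ht n
  have h2 := ratM_relation a t ha ht n
  linear_combination -2 * h1 - h2

/-- The `x`-derivative of `Q_{n+1} - Q_n`, as a polynomial identity. -/
lemma spectral_sub (a t : ℝ) (ha : -1 < a) (ht : 0 < t) (n : ℕ) :
    X * (X * derivative (qPoly a t (n + 1) - qPoly a t n))
      + C t * (X * derivative (qPoly a t (n + 1) - qPoly a t n))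
      = X * (C ((1 - diagRatio a t (n + 1)) * (a - ratN a t (n + 1) * (1 - diagRatio a t (n + 1))
        * capY a t (n + 1)) - t) * qPoly a t (n + 1))
        - X * (X * qPoly a t (n + 1))
        + X * (C (ratN a t (n + 1) - (n + 1) + t - 2 - a) * (qPoly a t (n + 1) - qPoly a t n))
        + X * (X * (qPoly a t (n + 1) - qPoly a t n))
        - C (2 * t) * (qPoly a t (n + 1) - qPoly a t n) := by
  refine Polynomial.funext fun x => ?_
  have h1 := spectral_fst a t ha ht n x
  have h2 := spectral_snd a t ha ht n x
  have h3 := spectral_coefficient a t ha ht n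
  simp only [eval_add, eval_sub, eval_mul, eval_X, eval_C, derivative_sub]
  linear_combination h1 - h2 + x * (qPoly a t (n + 1)).eval x * h3

/-- Write `X` for `N (1 - y) Y`, which becomes `r Y` in the limit. The coefficient of `x` in
`spectral_sub`, combined with `endpointProd_eq`, gives `(1 - y) (a - X) · endpointProd = t a ·
(nonnegative moment)`, so `a ≤ 0` forces `a ≤ X`. The upper bound is the sign of `Y = a θ`. -/
lemma capX_bound (a t : ℝ) (ha : -1 < a) (ha0 : a ≤ 0) (ht : 0 < t) (n : ℕ) :
    a ≤ ratN a t (n + 1) * (1 - diagRatio a t (n + 1)) * capY a t (n + 1) ∧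
    ratN a t (n + 1) * (1 - diagRatio a t (n + 1)) * capY a t (n + 1) ≤ 0 := by
  obtain ⟨θ, hY, hθ, -⟩ := capY_eq a t ha ht (n + 1)
  obtain ⟨-, -, -, hy⟩ := diagRatio_bounds a t ha ht n
  have hy' : 0 < 1 - diagRatio a t (n + 1) := by linarith
  have hN := ratN_pos a t ha ht n
  constructor
  · have h := congrArg (fun p => p.coeff 1) (spectral_sub a t ha ht n)
    have hs := qCoeff_succ_succ a t ha ht n 0
    simp only [qCoeff_zero_right a t ha ht, mul_one] at hs
    change _ = _ + 1 / endpointProd a t n * kernelZero a t n at hs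
    have hE := endpointProd_eq a t ht n
    have hEp := endpointProd_pos a t ha ht n
    have hm := (moment_sq_bounds a t ht n).1
    have c0 (m) : (qPoly a t m).coeff 0 = 1 := by
      rw [coeff_zero_eq_eval_zero, qPoly_eval_zero a t ha ht]
    have cX (f : ℝ[X]) : (X * f).coeff 1 = f.coeff 0 := coeff_X_mul f 0
    have cX0 (f : ℝ[X]) : (X * f).coeff 0 = 0 := by simp
    simp only [coeff_add, coeff_sub, cX, coeff_C_mul, cX0, c0, derivative_sub,
      coeff_derivative] at h
    simp only [qCoeff, zero_add, pow_one] at hs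
    norm_num at h
    set D := (qPoly a t (n + 1)).coeff 1 - (qPoly a t n).coeff 1 with hD
    have hD' : D * endpointProd a t n = -kernelZero a t n := by
      have : D = -(1 / endpointProd a t n * kernelZero a t n) := by rw [hD]; linarith
      rw [this]; field_simp
    set W := a - ratN a t (n + 1) * (1 - diagRatio a t (n + 1)) * capY a t (n + 1) with hW
    have key : (1 - diagRatio a t (n + 1)) * W * endpointProd a t n
        = t * (a * moment a t ht (X ^ 2 * cdKernel a t (n + 1) 0 ^ 2)) := by
      linear_combination t * hE + 3 * t * hD' - endpointProd a t n * h
    by_contra hc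
    have hWpos : 0 < W := by rw [hW]; linarith
    have h1 : 0 < (1 - diagRatio a t (n + 1)) * W * endpointProd a t n := by positivity
    have h2 : a * moment a t ht (X ^ 2 * cdKernel a t (n + 1) 0 ^ 2) ≤ 0 :=
      mul_nonpos_of_nonpos_of_nonneg ha0 hm
    nlinarith
  · rw [hY]
    have : 0 ≤ ratN a t (n + 1) * (1 - diagRatio a t (n + 1)) * θ := by positivity
    nlinarith

/-! ### The scaled planar system and passage to the limit in differential equations. -/

/-- The scaled quantity `n (1 - Q_{n-1}(-t) / Q_n(-t))` at `t = s / 4n`. -/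
def scaledR (a : ℝ) (n : ℕ) (s : ℝ) : ℝ := n * (1 - diagRatio a (s / (4 * n)) n)

/-- The scaled quantity `Y_n(s / 4n)`. -/
def scaledY (a : ℝ) (n : ℕ) (s : ℝ) : ℝ := capY a (s / (4 * n)) n

/-- The vector field of the scaled system at level `n = 1 / ε`, multiplied by `s`. -/
def fieldR (a ε s r Y : ℝ) : ℝ :=
  s / 4 * (1 - ε * r) - r * (r * (1 - Y * (2 - ε * r)) / (1 - ε * r * Y) + 2 + a - a * ε * r)

/-- The vector field of the scaled system at level `n = 1 / ε`, multiplied by `s`. -/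
def fieldY (a ε s r Y : ℝ) : ℝ :=
  -a + (a + 2) * Y + 2 * (r * Y * (1 - Y) / (1 - ε * r * Y)) + s / 4 * ε * Y * (1 - Y)

lemma scaled_param_pos (n : ℕ) (s : ℝ) (hs : 0 < s) : 0 < s / (4 * ((n + 1 : ℕ) : ℝ)) := by
  positivity

/-- The denominator is `1 - Y + y Y`, whose product with `N > 0` is `n + 1` by `ratN_relation`;
positivity comes for free. -/
lemma ratN_eq (a : ℝ) (ha : -1 < a) (n : ℕ) (s : ℝ) (hs : 0 < s) :
    0 < 1 - 1 / ((n + 1 : ℕ) : ℝ) * scaledR a (n + 1) s * scaledY a (n + 1) s ∧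
    ratN a (s / (4 * ((n + 1 : ℕ) : ℝ))) (n + 1) = ((n + 1 : ℕ) : ℝ) /
      (1 - 1 / ((n + 1 : ℕ) : ℝ) * scaledR a (n + 1) s * scaledY a (n + 1) s) := by
  have ht := scaled_param_pos n s hs
  have h := ratN_relation a _ ha ht n
  have hN := ratN_pos a _ ha ht n
  have hn : (0:ℝ) < ((n + 1 : ℕ) : ℝ) := by positivity
  have e : 1 - 1 / ((n + 1 : ℕ) : ℝ) * scaledR a (n + 1) s * scaledY a (n + 1) s
      = 1 - capY a (s / (4 * ((n + 1 : ℕ) : ℝ))) (n + 1) +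
        diagRatio a (s / (4 * ((n + 1 : ℕ) : ℝ))) (n + 1)
          * capY a (s / (4 * ((n + 1 : ℕ) : ℝ))) (n + 1) := by
    rw [scaledR, scaledY]; field_simp; ring
  have hn' : (n : ℝ) + 1 = ((n + 1 : ℕ) : ℝ) := by push_cast; ring
  rw [hn', ← e] at h
  have hpos := (pos_iff_pos_of_mul_pos (by rw [h]; exact hn)).1 hN
  exact ⟨hpos, by rw [eq_div_iff hpos.ne']; exact h⟩

lemma scaledR_bounds (a : ℝ) (ha : -1 < a) (n : ℕ) (s : ℝ) (hs : 0 < s) :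
    s * Real.exp (-(s / 8)) / (4 * (3 + |a|)) ≤ scaledR a (n + 1) s ∧
    scaledR a (n + 1) s ≤ s / 8 := by
  obtain ⟨h1, h2, -, -⟩ := diagRatio_bounds a _ ha (scaled_param_pos n s hs) n
  have hn : (0:ℝ) < ((n + 1 : ℕ) : ℝ) := by positivity
  have hn' : (n : ℝ) + 1 = ((n + 1 : ℕ) : ℝ) := by push_cast; ring
  rw [hn'] at h1
  rw [scaledR]
  set y := diagRatio a (s / (4 * ((n + 1 : ℕ) : ℝ))) (n + 1)
  constructor
  · have := mul_le_mul_of_nonneg_left h1 hn.le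
    refine le_trans (le_of_eq ?_) this
    have e : ((n + 1 : ℕ) : ℝ) * (s / (4 * ((n + 1 : ℕ) : ℝ))) / 2 = s / 8 := by field_simp; ring
    rw [e]
    field_simp
  · have := mul_le_mul_of_nonneg_left h2 hn.le
    refine this.trans (le_of_eq ?_)
    field_simp; ring

lemma scaledY_eq (a : ℝ) (ha : -1 < a) (n : ℕ) (s : ℝ) (hs : 0 < s) :
    ∃ θ : ℝ, scaledY a (n + 1) s = a * θ ∧ 0 ≤ θ ∧ θ ≤ 1 / (a + 2) :=
  capY_eq a _ ha (scaled_param_pos n s hs) (n + 1)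

lemma hasDerivAt_scaled (a : ℝ) (ha : -1 < a) (n : ℕ) (s : ℝ) (hs : 0 < s) :
    HasDerivAt (scaledR a (n + 1)) (fieldR a (1 / ((n + 1 : ℕ) : ℝ)) s (scaledR a (n + 1) s)
      (scaledY a (n + 1) s) / s) s ∧
    HasDerivAt (scaledY a (n + 1)) (fieldY a (1 / ((n + 1 : ℕ) : ℝ)) s (scaledR a (n + 1) s)
      (scaledY a (n + 1) s) / s) s := by
  have ht := scaled_param_pos n s hs
  have hn : (0:ℝ) < ((n + 1 : ℕ) : ℝ) := by positivity
  obtain ⟨hk, hN⟩ := ratN_eq a ha n s hs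
  have hM := ratM_relation a _ ha ht n
  have hr := ratN_relation a _ ha ht n
  have d0 : HasDerivAt (fun u : ℝ => u / (4 * ((n + 1 : ℕ) : ℝ))) (1 / (4 * ((n + 1 : ℕ) : ℝ))) s :=
    (hasDerivAt_id s).div_const _
  have d1 := (hasDerivAt_diagRatio a _ ha ht n).comp s d0
  have d2 := (hasDerivAt_capY a _ ha ht n).comp s d0
  have hn' : (n : ℝ) + 1 = ((n + 1 : ℕ) : ℝ) := by push_cast; ring
  rw [hn'] at hr d2
  have ey : diagRatio a (s / (4 * ((n + 1 : ℕ) : ℝ))) (n + 1)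
      = 1 - 1 / ((n + 1 : ℕ) : ℝ) * scaledR a (n + 1) s := by
    rw [scaledR]; field_simp; ring
  have eY : capY a (s / (4 * ((n + 1 : ℕ) : ℝ))) (n + 1) = scaledY a (n + 1) s := rfl
  rw [hM, hN, ey, eY] at d1
  rw [hN, ey, eY] at d2
  constructor
  · refine ((d1.const_sub 1).const_mul ((n + 1 : ℕ) : ℝ)).congr_deriv ?_
    rw [fieldR]
    set r := scaledR a (n + 1) s
    set Y := scaledY a (n + 1) s
    generalize ((n + 1 : ℕ) : ℝ) = m at *
    have hm := hn.ne'
    set κ := 1 - 1 / m * r * Y with hκ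
    have hY : 1 / m * r * Y = 1 - κ := by rw [hκ]; ring
    clear_value κ
    have hs' := hs.ne'
    have hk' := hk.ne'
    field_simp
    ring
  · refine d2.congr_deriv ?_
    rw [fieldY]
    set r := scaledR a (n + 1) s
    set Y := scaledY a (n + 1) s
    generalize ((n + 1 : ℕ) : ℝ) = m at *
    have hm := hn.ne'
    set κ := 1 - 1 / m * r * Y with hκ
    have hY : 1 / m * r * Y = 1 - κ := by rw [hκ]; ring
    clear_value κ
    have hs' := hs.ne'
    have hk' := hk.ne'
    field_simp
    field_simp at hY
    linear_combination (8 * m * Y) * hY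

/-- Pointwise limits of solutions of differential equations with converging right-hand sides
solve the limiting equation. -/
lemma hasDerivAt_of_tendsto_ode {ι E : Type*} [NormedAddCommGroup E] [NormedSpace ℝ E]
    {l : Filter ι} [l.NeBot] {Φ : ℝ × ℝ × E → E} {K : Set (ℝ × ℝ × E)} (hK : IsCompact K)
    (hΦ : ContinuousOn Φ K) {ε : ι → ℝ} (hε : Tendsto ε l (𝓝 0)) {F : ι → ℝ → E} {f : ℝ → E}
    {s δ : ℝ} (hδ : 0 < δ)
    (h : ∀ᶠ n in l, ∀ u ∈ Metric.ball s δ, (ε n, u, F n u) ∈ K ∧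
      HasDerivAt (F n) (Φ (ε n, u, F n u)) u)
    (hF : ∀ u ∈ Metric.ball s δ, Tendsto (fun n => F n u) l (𝓝 (f u))) :
    HasDerivAt f (Φ (0, s, f s)) s := by
  obtain ⟨B, hB⟩ := hK.exists_bound_of_continuousOn hΦ
  have hss : s ∈ Metric.ball s δ := Metric.mem_ball_self hδ
  have hlim : Tendsto (fun n => ((ε n, s, F n s) : ℝ × ℝ × E)) l (𝓝 (0, s, f s)) :=
    hε.prodMk_nhds (tendsto_const_nhds.prodMk_nhds (hF s hss))
  have hmem : ∀ᶠ n in l, ((ε n, s, F n s) : ℝ × ℝ × E) ∈ K := h.mono fun n hn => (hn s hss).1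
  have hfK : ((0, s, f s) : ℝ × ℝ × E) ∈ K := hK.isClosed.mem_of_tendsto hlim hmem
  have hΦlim : Tendsto (fun n => Φ (ε n, s, F n s)) l (𝓝 (Φ (0, s, f s))) :=
    (hΦ _ hfK).tendsto.comp (tendsto_nhdsWithin_iff.2 ⟨hlim, hmem⟩)
  have hB0 : 0 ≤ B := (norm_nonneg _).trans (hB _ hfK)
  rw [hasDerivAt_iff_isLittleO, Asymptotics.isLittleO_iff]
  intro e he
  obtain ⟨η, hη, huc⟩ := Metric.uniformContinuousOn_iff.1
    (hK.uniformContinuousOn_of_continuous hΦ) e he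
  -- The uniform Lipschitz constant `B` of the `F n` then keeps `(v, F n v)` within the continuity
  -- modulus `η` of `(s, F n s)`, simultaneously for all large `n`.
  set δ' := min δ (η / (B + 1)) with hδ'
  have hδ'0 : 0 < δ' := lt_min hδ (by positivity)
  filter_upwards [Metric.ball_mem_nhds s hδ'0] with u hu
  have hconv := convex_ball s δ'
  have hs' : s ∈ Metric.ball s δ' := Metric.mem_ball_self hδ'0
  have hsub : Metric.ball s δ' ⊆ Metric.ball s δ := Metric.ball_subset_ball (min_le_left _ _)
  refine le_of_tendsto (((((hF u (hsub hu)).sub (hF s hss)).sub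
    (hΦlim.const_smul (u - s))).norm)) ?_
  filter_upwards [h] with n hn
  have hlip : ∀ v ∈ Metric.ball s δ', ‖F n v - F n s‖ ≤ B * ‖v - s‖ := fun v hv =>
    hconv.norm_image_sub_le_of_norm_hasDerivWithin_le
      (fun w hw => (hn w (hsub hw)).2.hasDerivWithinAt)
      (fun w hw => hB _ (hn w (hsub hw)).1) hs' hv
  have hder : ∀ v ∈ Metric.ball s δ', ‖Φ (ε n, v, F n v) - Φ (ε n, s, F n s)‖ ≤ e := by
    intro v hv
    rw [← dist_eq_norm]
    refine (huc _ (hn v (hsub hv)).1 _ (hn s hss).1 ?_).le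
    have hvs : dist v s < η / (B + 1) := lt_of_lt_of_le hv (min_le_right _ _)
    rw [lt_div_iff₀ (by positivity)] at hvs
    have h2 := hlip v hv
    rw [← dist_eq_norm, ← dist_eq_norm] at h2
    have h3 : 0 ≤ dist v s := dist_nonneg
    rw [Prod.dist_eq, Prod.dist_eq]
    simp only [dist_self]
    refine max_lt hη (max_lt ?_ ?_) <;> nlinarith
  -- Mean value inequality for `F n` minus its linearisation at `s`: the estimate is uniform in `n`,
  -- so it survives the pointwise limit.
  have hfin := hconv.norm_image_sub_le_of_norm_hasDerivWithin_le
    (f := fun v => F n v - v • Φ (ε n, s, F n s))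
    (f' := fun v => Φ (ε n, v, F n v) - Φ (ε n, s, F n s))
    (fun w hw => ((hn w (hsub hw)).2.sub (by
      simpa using (hasDerivAt_id w).smul_const (Φ (ε n, s, F n s)))).hasDerivWithinAt) hder hs' hu
  refine le_trans (le_of_eq ?_) hfin
  congr 1
  rw [sub_smul]
  abel

/-! ### Comparison arguments for linear systems on `(0, ∞)`. -/

/-- Sign persistence for differential inequalities `P' ≥ k P` on `(0, ∞)`. -/
lemma sign_persistence {P P' k : ℝ → ℝ} (hk : ContinuousOn k (Set.Ioi 0))
    (hP : ∀ s, 0 < s → HasDerivAt P (P' s) s) (hPk : ∀ s, 0 < s → k s * P s ≤ P' s)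
    {s₁ s₂ : ℝ} (h0 : 0 < s₁) (h12 : s₁ ≤ s₂) : (0 < P s₁ → 0 < P s₂) ∧ (P s₂ < 0 → P s₁ < 0) := by
  have hint : ∀ s, 0 < s → HasDerivAt (fun u => ∫ x in (1:ℝ)..u, k x) (k s) s := by
    intro s hs
    refine intervalIntegral.integral_hasDerivAt_right ?_ ?_ (hk.continuousAt (Ioi_mem_nhds hs))
    · refine (hk.mono ?_).intervalIntegrable
      intro x hx
      exact lt_of_lt_of_le (lt_min one_pos hs) hx.1
    · exact hk.stronglyMeasurableAtFilter isOpen_Ioi s hs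
  set E : ℝ → ℝ := fun u => Real.exp (-∫ x in (1:ℝ)..u, k x) with hE
  have hEpos : ∀ u, 0 < E u := fun u => Real.exp_pos _
  have hd : ∀ s, 0 < s → HasDerivAt (fun u => P u * E u) (P' s * E s + P s * (E s * -k s)) s :=
    fun s hs => (hP s hs).mul (hint s hs).neg.exp
  have hmono : MonotoneOn (fun u => P u * E u) (Set.Ioi 0) := by
    refine monotoneOn_of_hasDerivWithinAt_nonneg (convex_Ioi 0)
      (fun s hs => (hd s hs).continuousAt.continuousWithinAt)
      (f' := fun s => P' s * E s + P s * (E s * -k s)) ?_ ?_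
    · intro s hs
      rw [interior_Ioi] at hs
      exact (hd s hs).hasDerivWithinAt
    · intro s hs
      rw [interior_Ioi] at hs
      nlinarith [hPk s hs, hEpos s]
  have h := hmono (show s₁ ∈ Set.Ioi 0 from h0) (show s₂ ∈ Set.Ioi 0 from h0.trans_le h12) h12
  simp only at h
  constructor
  · intro hp
    have := mul_pos hp (hEpos s₁)
    exact (pos_iff_pos_of_mul_pos (this.trans_le h)).2 (hEpos s₂)
  · intro hp
    by_contra hc
    nlinarith [hEpos s₁, hEpos s₂, mul_nonneg (not_lt.1 hc) (hEpos s₁).le]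

lemma pos_of_preconnected {S : Set ℝ} (hS : IsPreconnected S) {f : ℝ → ℝ} (hf : ContinuousOn f S)
    (h0 : ∀ x ∈ S, f x ≠ 0) {x y : ℝ} (hx : x ∈ S) (hy : y ∈ S) (hfx : 0 < f x) : 0 < f y := by
  by_contra hc
  obtain ⟨z, hz, hz0⟩ := hS.intermediate_value hy hx hf ⟨not_lt.1 hc, hfx.le⟩
  exact h0 z hz hz0

/-- The quotient `g s / s` is nondecreasing, so `g` grows at least linearly. -/
lemma no_bounded_growth {g g' : ℝ → ℝ} {s₀ M : ℝ} (h0 : 0 < s₀)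
    (hg : ∀ s, s₀ ≤ s → HasDerivAt g (g' s) s) (hge : ∀ s, s₀ ≤ s → g s ≤ s * g' s)
    (hM : ∀ s, s₀ ≤ s → g s ≤ M) (hpos : 0 < g s₀) : False := by
  have hmono : MonotoneOn (fun s => g s / s) (Set.Ici s₀) := by
    have hd : ∀ s, s₀ ≤ s → HasDerivAt (fun s => g s / s) ((g' s * s - g s * 1) / s ^ 2) s :=
      fun s hs => (hg s hs).div (hasDerivAt_id s) (h0.trans_le hs).ne'
    refine monotoneOn_of_hasDerivWithinAt_nonneg (convex_Ici s₀)
      (fun s hs => (hd s hs).continuousAt.continuousWithinAt)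
      (f' := fun s => (g' s * s - g s * 1) / s ^ 2) ?_ ?_
    · intro s hs
      exact (hd s (interior_subset hs)).hasDerivWithinAt
    · intro s hs
      have := hge s (interior_subset hs)
      exact div_nonneg (by linarith) (by positivity)
  have hM' : 0 < M := hpos.trans_le (hM s₀ le_rfl)
  -- Linear growth from `s₀` forces `g s ≥ M + g s₀` at this point.
  set s := s₀ * (M / g s₀ + 1) with hs
  have hss : s₀ ≤ s := le_mul_of_one_le_right h0.le (by linarith [div_pos hM' hpos])
  have h := hmono (Set.self_mem_Ici) (show s ∈ Set.Ici s₀ from hss) hss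
  simp only at h
  rw [div_le_div_iff₀ h0 (h0.trans_le hss), hs] at h
  have h2 := hM s hss
  have e : g s₀ * (s₀ * (M / g s₀ + 1)) = (M + g s₀) * s₀ := by field_simp
  rw [e, ← hs] at h
  nlinarith

/-- The product `s * g s` is nonincreasing, so `g` blows up at least like `1/s` at `0`. -/
lemma no_bounded_decay {g g' : ℝ → ℝ} {s₀ M : ℝ} (h0 : 0 < s₀)
    (hg : ∀ s ∈ Set.Ioc 0 s₀, HasDerivAt g (g' s) s)
    (hge : ∀ s ∈ Set.Ioc 0 s₀, s * g' s ≤ -g s)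
    (hM : ∀ s ∈ Set.Ioc 0 s₀, g s ≤ M) (hpos : 0 < g s₀) : False := by
  have hmono : AntitoneOn (fun s => s * g s) (Set.Ioc 0 s₀) := by
    have hd : ∀ s ∈ Set.Ioc 0 s₀, HasDerivAt (fun s => s * g s) (1 * g s + s * g' s) s :=
      fun s hs => (hasDerivAt_id s).mul (hg s hs)
    refine antitoneOn_of_hasDerivWithinAt_nonpos (convex_Ioc 0 s₀)
      (fun s hs => (hd s hs).continuousAt.continuousWithinAt)
      (f' := fun s => 1 * g s + s * g' s) ?_ ?_
    · intro s hs
      exact (hd s (interior_subset hs)).hasDerivWithinAt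
    · intro s hs
      have := hge s (interior_subset hs)
      linarith
  have hs0 : s₀ ∈ Set.Ioc 0 s₀ := ⟨h0, le_rfl⟩
  have hM' : 0 < M := hpos.trans_le (hM s₀ hs0)
  -- Chosen so that `s₀ * g s₀ / s = M + g s₀`.
  set s := s₀ * g s₀ / (M + g s₀) with hs
  have hspos : 0 < s := by positivity
  have hss : s ≤ s₀ := by
    rw [hs, div_le_iff₀ (by positivity)]; nlinarith
  have h := hmono (show s ∈ Set.Ioc 0 s₀ from ⟨hspos, hss⟩) hs0 hss
  simp only at h
  have h2 := mul_le_mul_of_nonneg_left (hM s ⟨hspos, hss⟩) hspos.le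
  have e : s * (M + g s₀) = s₀ * g s₀ := by rw [hs]; field_simp
  nlinarith [mul_pos hspos hpos]

/-- A planar linear cooperative system on `(0, ∞)`: a solution that can neither stay in the
first or third quadrant up to `∞` nor in the second or fourth down to `0` is trivial. -/
lemma saddle_trivial {A B A' B' α β γ δ : ℝ → ℝ}
    (hα : ContinuousOn α (Set.Ioi 0)) (hδ : ContinuousOn δ (Set.Ioi 0))
    (hβ : ∀ s, 0 < s → 0 < β s) (hγ : ∀ s, 0 < s → 0 < γ s)
    (hA : ∀ s, 0 < s → HasDerivAt A (A' s) s) (hB : ∀ s, 0 < s → HasDerivAt B (B' s) s)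
    (eA : ∀ s, 0 < s → s * A' s = -α s * A s + β s * B s)
    (eB : ∀ s, 0 < s → s * B' s = γ s * A s + δ s * B s)
    (h1 : ∀ s₀, 0 < s₀ → ¬ ∀ s, s₀ ≤ s → 0 < A s ∧ 0 < B s)
    (h2 : ∀ s₀, 0 < s₀ → ¬ ∀ s, s₀ ≤ s → A s < 0 ∧ B s < 0)
    (h3 : ∀ s₀, 0 < s₀ → ¬ ∀ s ∈ Set.Ioc 0 s₀, 0 < A s ∧ B s < 0)
    (h4 : ∀ s₀, 0 < s₀ → ¬ ∀ s ∈ Set.Ioc 0 s₀, A s < 0 ∧ 0 < B s) :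
    ∀ s, 0 < s → A s = 0 ∧ B s = 0 := by
  have hP : ∀ s, 0 < s → HasDerivAt (fun u => A u * B u) (A' s * B s + A s * B' s) s :=
    fun s hs => (hA s hs).mul (hB s hs)
  have hk : ContinuousOn (fun s => (δ s - α s) / s) (Set.Ioi 0) :=
    (hδ.sub hα).div continuousOn_id fun s hs => (ne_of_gt hs)
  -- Both off-diagonal coefficients feed nonnegative squares into the equation for `A B`. Hence `A B
  -- > 0` persists to the right and `A B < 0` persists to the left, and each case is excluded by the
  -- hypotheses on quadrants.
  have expand : ∀ s, 0 < s → A' s * B s + A s * B' s = (δ s - α s) / s * (A s * B s)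
      + (β s * B s ^ 2 + γ s * A s ^ 2) / s := by
    intro s hs
    have e1 := eA s hs
    have e2 := eB s hs
    field_simp
    linear_combination B s * e1 + A s * e2
  have hPk : ∀ s, 0 < s → (δ s - α s) / s * (A s * B s) ≤ A' s * B s + A s * B' s := by
    intro s hs
    rw [expand s hs]
    have := hβ s hs
    have := hγ s hs
    have : 0 ≤ (β s * B s ^ 2 + γ s * A s ^ 2) / s := by positivity
    linarith
  have hsign {s₁ s₂ : ℝ} (h0 : 0 < s₁) (h12 : s₁ ≤ s₂) := sign_persistence hk hP hPk h0 h12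
  have cA : ContinuousOn A (Set.Ioi 0) := fun s hs => (hA s hs).continuousAt.continuousWithinAt
  have npos : ∀ s₀, 0 < s₀ → ¬ 0 < A s₀ * B s₀ := by
    intro s₀ h0 hp
    have hall : ∀ s, s₀ ≤ s → 0 < A s * B s := fun s hs => (hsign h0 hs).1 hp
    have cA' : ContinuousOn A (Set.Ici s₀) := cA.mono fun s hs => h0.trans_le hs
    have hne : ∀ s ∈ Set.Ici s₀, A s ≠ 0 := fun s hs hc => by
      have := hall s hs; rw [hc, zero_mul] at this; exact this.false
    rcases lt_or_gt_of_ne (hne s₀ (Set.self_mem_Ici)) with h | h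
    · refine h2 s₀ h0 fun s hs => ?_
      have : 0 < -A s := pos_of_preconnected isPreconnected_Ici cA'.neg
        (fun x hx => neg_ne_zero.2 (hne x hx)) (Set.self_mem_Ici) hs (by simpa using h)
      have hp' := hall s hs
      exact ⟨by linarith, by nlinarith⟩
    · refine h1 s₀ h0 fun s hs => ?_
      have : 0 < A s := pos_of_preconnected isPreconnected_Ici cA' hne (Set.self_mem_Ici) hs h
      exact ⟨this, (pos_iff_pos_of_mul_pos (hall s hs)).1 this⟩
  have nneg : ∀ s₀, 0 < s₀ → ¬ A s₀ * B s₀ < 0 := by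
    intro s₀ h0 hp
    have hall : ∀ s ∈ Set.Ioc 0 s₀, A s * B s < 0 := fun s hs => (hsign hs.1 hs.2).2 hp
    have cA' : ContinuousOn A (Set.Ioc 0 s₀) := cA.mono fun s hs => hs.1
    have hne : ∀ s ∈ Set.Ioc 0 s₀, A s ≠ 0 := fun s hs hc => by
      have := hall s hs; rw [hc, zero_mul] at this; exact this.false
    have hs0 : s₀ ∈ Set.Ioc 0 s₀ := ⟨h0, le_rfl⟩
    rcases lt_or_gt_of_ne (hne s₀ hs0) with h | h
    · refine h4 s₀ h0 fun s hs => ?_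
      have : 0 < -A s := pos_of_preconnected isPreconnected_Ioc cA'.neg
        (fun x hx => neg_ne_zero.2 (hne x hx)) hs0 hs (by simpa using h)
      have hp' := hall s hs
      exact ⟨by linarith, by nlinarith⟩
    · refine h3 s₀ h0 fun s hs => ?_
      have : 0 < A s := pos_of_preconnected isPreconnected_Ioc cA' hne hs0 hs h
      have hp' := hall s hs
      exact ⟨this, by nlinarith⟩
  have hzero : ∀ s, 0 < s → A s * B s = 0 := fun s hs =>
    le_antisymm (not_lt.1 (npos s hs)) (not_lt.1 (nneg s hs))
  intro s hs
  -- Since `A B` vanishes identically, so does its derivative, and the two nonnegative square terms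
  -- must vanish separately.
  have hd : A' s * B s + A s * B' s = 0 := by
    refine (hP s hs).unique ((hasDerivAt_const s (0:ℝ)).congr_of_eventuallyEq ?_)
    filter_upwards [Ioi_mem_nhds hs] with u hu
    exact hzero u hu
  rw [expand s hs, hzero s hs, mul_zero, zero_add, div_eq_zero_iff] at hd
  have hb := hβ s hs
  have hg := hγ s hs
  have hd' := hd.resolve_right hs.ne'
  have n1 : 0 ≤ β s * B s ^ 2 := by positivity
  have n2 : 0 ≤ γ s * A s ^ 2 := by positivity
  have z1 : β s * B s ^ 2 = 0 := by linarith
  have z2 : γ s * A s ^ 2 = 0 := by linarith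
  exact ⟨by simpa [hg.ne'] using z2, by simpa [hb.ne'] using z1⟩

/-! ### Uniqueness for the limiting system. -/

/-- The global solutions of the limiting system that obey the a priori bounds. -/
structure IsLimitSolution (a : ℝ) (r Y : ℝ → ℝ) : Prop where
  deriv_r : ∀ s, 0 < s →
    HasDerivAt r ((s / 4 - (a + 2) * r s - r s ^ 2 + 2 * r s ^ 2 * Y s) / s) s
  deriv_Y : ∀ s, 0 < s →
    HasDerivAt Y ((-a + (a + 2) * Y s + 2 * r s * Y s - 2 * r s * Y s ^ 2) / s) s
  r_pos : ∀ s, 0 < s → 0 < r s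
  r_le : ∀ s, 0 < s → r s ≤ s / 8
  Y_eq : ∀ s, 0 < s → ∃ θ : ℝ, Y s = a * θ ∧ 0 ≤ θ ∧ θ ≤ 1 / (a + 2)
  X_bound : a ≤ 0 → ∀ s, 0 < s → a ≤ r s * Y s ∧ r s * Y s ≤ 0

namespace IsLimitSolution
variable {a : ℝ} {r₁ Y₁ r₂ Y₂ r Y : ℝ → ℝ}

lemma continuousOn_r (h : IsLimitSolution a r Y) : ContinuousOn r (Set.Ioi 0) :=
  fun s hs => (h.deriv_r s hs).continuousAt.continuousWithinAt

lemma continuousOn_Y (h : IsLimitSolution a r Y) : ContinuousOn Y (Set.Ioi 0) :=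
  fun s hs => (h.deriv_Y s hs).continuousAt.continuousWithinAt

/-- This turns the bound `r ≤ s/8` into a growth rate exceeding the threshold `1` needed in the
growth and decay comparisons. -/
lemma two_le (h : IsLimitSolution a r Y) {s : ℝ} (hs : 0 < s) : 2 ≤ s / (4 * r s) := by
  have h1 := h.r_pos s hs
  have h2 := h.r_le s hs
  rw [le_div_iff₀ (by positivity)]; linarith

/-- The ratio `1 - r₁ / r₂` cannot stay positive down to `0` if it decays. -/
lemma ratio_contradiction (h₁ : IsLimitSolution a r₁ Y₁) (h₂ : IsLimitSolution a r₂ Y₂)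
    {s₀ : ℝ} (h0 : 0 < s₀) (hlt : ∀ s ∈ Set.Ioc 0 s₀, r₁ s < r₂ s)
    (hle : ∀ s ∈ Set.Ioc 0 s₀, 2 * (r₂ s * Y₂ s - r₁ s * Y₁ s) - (r₂ s - r₁ s)
      ≤ (s / (4 * r₂ s) - 1) * (r₂ s - r₁ s) / r₁ s) : False := by
  refine no_bounded_decay (g := fun s => 1 - r₁ s / r₂ s) (M := 1) (s₀ := s₀)
    (g' := fun s => -(((s / 4 - (a + 2) * r₁ s - r₁ s ^ 2 + 2 * r₁ s ^ 2 * Y₁ s) / s * r₂ s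
      - r₁ s * ((s / 4 - (a + 2) * r₂ s - r₂ s ^ 2 + 2 * r₂ s ^ 2 * Y₂ s) / s)) / r₂ s ^ 2))
    h0 ?_ ?_ ?_ ?_
  · intro s hs
    exact ((h₁.deriv_r s hs.1).div (h₂.deriv_r s hs.1) (h₂.r_pos s hs.1).ne').const_sub 1
  · intro s hs
    have hl := hle s hs
    have p1 := h₁.r_pos s hs.1
    have p2 := h₂.r_pos s hs.1
    have hs0 := hs.1
    have e : s * -(((s / 4 - (a + 2) * r₁ s - r₁ s ^ 2 + 2 * r₁ s ^ 2 * Y₁ s) / s * r₂ s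
      - r₁ s * ((s / 4 - (a + 2) * r₂ s - r₂ s ^ 2 + 2 * r₂ s ^ 2 * Y₂ s) / s)) / r₂ s ^ 2)
      = r₁ s / r₂ s * ((2 * (r₂ s * Y₂ s - r₁ s * Y₁ s) - (r₂ s - r₁ s))
        - s / 4 * (r₂ s - r₁ s) / (r₁ s * r₂ s)) := by
      field_simp; ring
    rw [e]
    have e2 : -(1 - r₁ s / r₂ s) = r₁ s / r₂ s * ((s / (4 * r₂ s) - 1) * (r₂ s - r₁ s) / r₁ s
        - s / 4 * (r₂ s - r₁ s) / (r₁ s * r₂ s)) := by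
      field_simp; ring
    rw [e2]
    gcongr
  · intro s hs
    have := div_pos (h₁.r_pos s hs.1) (h₂.r_pos s hs.1)
    linarith
  · have := (div_lt_one (h₂.r_pos s₀ h0)).2 (hlt s₀ ⟨h0, le_rfl⟩)
    linarith

lemma inv_sub_inv_pos_iff (h₁ : IsLimitSolution a r₁ Y₁) (h₂ : IsLimitSolution a r₂ Y₂)
    {s : ℝ} (hs : 0 < s) : 0 < 1 / r₁ s - 1 / r₂ s ↔ r₁ s < r₂ s := by
  rw [sub_pos, one_div_lt_one_div (h₂.r_pos s hs) (h₁.r_pos s hs)]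

lemma inv_sub_inv_neg_iff (h₁ : IsLimitSolution a r₁ Y₁) (h₂ : IsLimitSolution a r₂ Y₂)
    {s : ℝ} (hs : 0 < s) : 1 / r₁ s - 1 / r₂ s < 0 ↔ r₂ s < r₁ s := by
  rw [sub_neg, one_div_lt_one_div (h₁.r_pos s hs) (h₂.r_pos s hs)]

lemma hasDerivAt_inv_sub_inv (h₁ : IsLimitSolution a r₁ Y₁) (h₂ : IsLimitSolution a r₂ Y₂)
    {s : ℝ} (hs : 0 < s) : HasDerivAt (fun u => 1 / r₁ u - 1 / r₂ u)
      ((-(1 / r₁ s - 1 / r₂ s) * (s / (4 * r₁ s) + s / (4 * r₂ s) - (a + 2))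
        + 2 * (Y₂ s - Y₁ s)) / s) s := by
  have p1 := h₁.r_pos s hs
  have p2 := h₂.r_pos s hs
  have d1 := (hasDerivAt_const s (1:ℝ)).div (h₁.deriv_r s hs) p1.ne'
  have d2 := (hasDerivAt_const s (1:ℝ)).div (h₂.deriv_r s hs) p2.ne'
  refine (d1.sub d2).congr_deriv ?_
  field_simp
  ring

/-- For `a < 0` the cooperative variables are `A = 1/r₁ - 1/r₂` and `B = r₂ Y₂ - r₁ Y₁`; the bound
`a ≤ r Y ≤ 0` makes the coupling of `A` into `B` positive. To the right, `B` would grow at rate at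
least `1` although it is bounded by `-a`. To the left, `1 - r₁/r₂` would blow up although it is less
than `1`. -/
lemma eq_of_neg (ha : -1 < a) (ha0 : a < 0) (h₁ : IsLimitSolution a r₁ Y₁)
    (h₂ : IsLimitSolution a r₂ Y₂) : ∀ s, 0 < s → r₁ s = r₂ s ∧ Y₁ s = Y₂ s := by
  have growth : ∀ {r₁ Y₁ r₂ Y₂ : ℝ → ℝ} (h₁ : IsLimitSolution a r₁ Y₁)
      (h₂ : IsLimitSolution a r₂ Y₂), ∀ s, 0 < s →
      HasDerivAt (fun u => r₂ u * Y₂ u - r₁ u * Y₁ u)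
        (((s / 4 * -(r₂ s * Y₂ s) + (r₂ s * Y₂ s - a) * (r₁ s * r₂ s)) * (1 / r₁ s - 1 / r₂ s)
          + (s / (4 * r₁ s) + r₁ s) * (r₂ s * Y₂ s - r₁ s * Y₁ s)) / s) s := by
    intro r₁ Y₁ r₂ Y₂ h₁ h₂ s hs
    have p1 := h₁.r_pos s hs
    have p2 := h₂.r_pos s hs
    refine (((h₂.deriv_r s hs).mul (h₂.deriv_Y s hs)).sub
      ((h₁.deriv_r s hs).mul (h₁.deriv_Y s hs))).congr_deriv ?_
    field_simp
    ring
  have fwd : ∀ {r₁ Y₁ r₂ Y₂ : ℝ → ℝ} (h₁ : IsLimitSolution a r₁ Y₁)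
      (h₂ : IsLimitSolution a r₂ Y₂), ∀ s₀, 0 < s₀ →
      ¬ ∀ s, s₀ ≤ s → r₁ s < r₂ s ∧ 0 < r₂ s * Y₂ s - r₁ s * Y₁ s := by
    intro r₁ Y₁ r₂ Y₂ h₁ h₂ s₀ h0 hall
    refine no_bounded_growth (M := -a) h0 (fun s hs => growth h₁ h₂ s (h0.trans_le hs)) ?_ ?_
      (hall s₀ le_rfl).2
    · intro s hs
      have hs0 := h0.trans_le hs
      obtain ⟨hA, hB⟩ := hall s hs
      have hA' := (inv_sub_inv_pos_iff h₁ h₂ hs0).2 hA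
      have p1 := h₁.r_pos s hs0
      have p2 := h₂.r_pos s hs0
      obtain ⟨x1, x2⟩ := h₂.X_bound ha0.le s hs0
      have hρ := h₁.two_le hs0
      rw [mul_div_cancel₀ _ hs0.ne']
      have n1 : 0 ≤ (s / 4 * -(r₂ s * Y₂ s) + (r₂ s * Y₂ s - a) * (r₁ s * r₂ s))
          * (1 / r₁ s - 1 / r₂ s) := by
        refine mul_nonneg (add_nonneg (mul_nonneg (by positivity) (by linarith))
          (mul_nonneg (by linarith) (by positivity))) hA'.le
      nlinarith
    · intro s hs
      have hs0 := h0.trans_le hs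
      have := (h₁.X_bound ha0.le s hs0).1
      have := (h₂.X_bound ha0.le s hs0).2
      linarith
  have bwd : ∀ {r₁ Y₁ r₂ Y₂ : ℝ → ℝ} (h₁ : IsLimitSolution a r₁ Y₁)
      (h₂ : IsLimitSolution a r₂ Y₂), ∀ s₀, 0 < s₀ →
      ¬ ∀ s ∈ Set.Ioc 0 s₀, r₁ s < r₂ s ∧ r₂ s * Y₂ s - r₁ s * Y₁ s < 0 := by
    intro r₁ Y₁ r₂ Y₂ h₁ h₂ s₀ h0 hall
    refine ratio_contradiction h₁ h₂ h0 (fun s hs => (hall s hs).1) fun s hs => ?_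
    obtain ⟨hA, hB⟩ := hall s hs
    have hρ := h₂.two_le hs.1
    have p1 := h₁.r_pos s hs.1
    have : 0 ≤ (s / (4 * r₂ s) - 1) * (r₂ s - r₁ s) / r₁ s :=
      div_nonneg (mul_nonneg (by linarith) (by linarith)) p1.le
    linarith
  have key := saddle_trivial (A := fun u => 1 / r₁ u - 1 / r₂ u)
    (B := fun u => r₂ u * Y₂ u - r₁ u * Y₁ u)
    -- The extra term comes from `Y₂ - Y₁ = B / r₂ - r₁ Y₁ A`.
    (α := fun s => s / (4 * r₁ s) + s / (4 * r₂ s) - (a + 2) + 2 * (r₁ s * Y₁ s))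
    (β := fun s => 2 / r₂ s)
    (γ := fun s => s / 4 * -(r₂ s * Y₂ s) + (r₂ s * Y₂ s - a) * (r₁ s * r₂ s))
    (δ := fun s => s / (4 * r₁ s) + r₁ s) ?_ ?_ ?_ ?_
    (fun s hs => hasDerivAt_inv_sub_inv h₁ h₂ hs) (growth h₁ h₂) ?_ ?_ ?_ ?_ ?_ ?_
  · intro s hs
    obtain ⟨hA, hB⟩ := key s hs
    have p1 := h₁.r_pos s hs
    have p2 := h₂.r_pos s hs
    have er : r₁ s = r₂ s := by
      have : 1 / r₁ s = 1 / r₂ s := by linarith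
      simpa using this
    refine ⟨er, ?_⟩
    rw [er] at hB
    have : r₂ s * (Y₂ s - Y₁ s) = 0 := by linarith
    have := (mul_eq_zero.1 this).resolve_left p2.ne'
    linarith
  · have c1 := h₁.continuousOn_r
    have c2 := h₂.continuousOn_r
    have c3 := h₁.continuousOn_Y
    refine ContinuousOn.add (ContinuousOn.sub (ContinuousOn.add ?_ ?_) (by fun_prop)) (by fun_prop)
    · exact ContinuousOn.div (by fun_prop) (by fun_prop) fun s hs => by
        have := h₁.r_pos s hs; positivity
    · exact ContinuousOn.div (by fun_prop) (by fun_prop) fun s hs => by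
        have := h₂.r_pos s hs; positivity
  · have c1 := h₁.continuousOn_r
    refine ContinuousOn.add ?_ c1
    exact ContinuousOn.div (by fun_prop) (by fun_prop) fun s hs => by
        have := h₁.r_pos s hs; positivity
  · intro s hs
    have := h₂.r_pos s hs
    positivity
  · intro s hs
    have p1 := h₁.r_pos s hs
    have p2 := h₂.r_pos s hs
    obtain ⟨x1, x2⟩ := h₂.X_bound ha0.le s hs
    -- If `r₂ Y₂ < 0` the first summand is strictly positive; if `r₂ Y₂ = 0` the second one is,
    -- because `a < 0`.
    rcases x2.lt_or_eq with h | h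
    · have : 0 ≤ (r₂ s * Y₂ s - a) * (r₁ s * r₂ s) := mul_nonneg (by linarith) (by positivity)
      have : 0 < s / 4 * -(r₂ s * Y₂ s) := mul_pos (by positivity) (by linarith)
      linarith
    · rw [h]
      have : 0 < (0 - a) * (r₁ s * r₂ s) := mul_pos (by linarith) (by positivity)
      linarith
  · intro s hs
    have p1 := h₁.r_pos s hs
    have p2 := h₂.r_pos s hs
    field_simp
    ring
  · intro s hs
    rw [mul_div_cancel₀ _ hs.ne']
  · intro s₀ h0 hall
    exact fwd h₁ h₂ s₀ h0 fun s hs => ⟨(inv_sub_inv_pos_iff h₁ h₂ (h0.trans_le hs)).1 (hall s hs).1,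
      (hall s hs).2⟩
  · intro s₀ h0 hall
    refine fwd h₂ h₁ s₀ h0 fun s hs => ⟨(inv_sub_inv_neg_iff h₁ h₂ (h0.trans_le hs)).1 (hall s hs).1,
      ?_⟩
    have := (hall s hs).2; linarith
  · intro s₀ h0 hall
    exact bwd h₁ h₂ s₀ h0 fun s hs => ⟨(inv_sub_inv_pos_iff h₁ h₂ hs.1).1 (hall s hs).1,
      (hall s hs).2⟩
  · intro s₀ h0 hall
    refine bwd h₂ h₁ s₀ h0 fun s hs => ⟨(inv_sub_inv_neg_iff h₁ h₂ hs.1).1 (hall s hs).1,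
      ?_⟩
    have := (hall s hs).2; linarith

/-- Here `Y` vanishes and `r` solves a scalar Riccati equation. The squared difference of two
solutions would blow up at `0`, although both are at most `s/8`. -/
lemma eq_of_zero (ha0 : a = 0) (h₁ : IsLimitSolution a r₁ Y₁)
    (h₂ : IsLimitSolution a r₂ Y₂) : ∀ s, 0 < s → r₁ s = r₂ s ∧ Y₁ s = Y₂ s := by
  subst ha0
  have z : ∀ {r Y : ℝ → ℝ}, IsLimitSolution 0 r Y → ∀ s, 0 < s → Y s = 0 := by
    intro r Y h s hs
    obtain ⟨θ, h, -⟩ := h.Y_eq s hs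
    simpa using h
  have key : ∀ {r₁ Y₁ r₂ Y₂ : ℝ → ℝ} (h₁ : IsLimitSolution 0 r₁ Y₁)
      (h₂ : IsLimitSolution 0 r₂ Y₂), ∀ s, 0 < s → r₂ s ≤ r₁ s := by
    intro r₁ Y₁ r₂ Y₂ h₁ h₂ s hs
    by_contra hc
    have hd : ∀ v ∈ Set.Ioc 0 s, HasDerivAt (fun u => (r₂ u - r₁ u) ^ 2) (2 * (r₂ v - r₁ v)
        * ((v / 4 - (0 + 2) * r₂ v - r₂ v ^ 2 + 2 * r₂ v ^ 2 * Y₂ v) / v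
          - (v / 4 - (0 + 2) * r₁ v - r₁ v ^ 2 + 2 * r₁ v ^ 2 * Y₁ v) / v)) v := by
      intro v hv
      refine (((h₂.deriv_r v hv.1).sub (h₁.deriv_r v hv.1)).pow 2).congr_deriv ?_
      simp
    refine no_bounded_decay (g := fun u => (r₂ u - r₁ u) ^ 2)
      (g' := fun s => 2 * (r₂ s - r₁ s)
        * ((s / 4 - (0 + 2) * r₂ s - r₂ s ^ 2 + 2 * r₂ s ^ 2 * Y₂ s) / s
          - (s / 4 - (0 + 2) * r₁ s - r₁ s ^ 2 + 2 * r₁ s ^ 2 * Y₁ s) / s)) (M := s ^ 2) hs hd ?_ ?_ ?_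
    · intro u hu
      have p1 := h₁.r_pos u hu.1
      have p2 := h₂.r_pos u hu.1
      rw [z h₁ u hu.1, z h₂ u hu.1]
      have hu0 := hu.1
      have e : u * (2 * (r₂ u - r₁ u) * ((u / 4 - (0 + 2) * r₂ u - r₂ u ^ 2 + 2 * r₂ u ^ 2 * 0) / u
          - (u / 4 - (0 + 2) * r₁ u - r₁ u ^ 2 + 2 * r₁ u ^ 2 * 0) / u))
          = -((r₂ u - r₁ u) ^ 2 * (4 + 2 * (r₁ u + r₂ u))) := by
        field_simp; ring
      rw [e]
      nlinarith [sq_nonneg (r₂ u - r₁ u)]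
    · intro u hu
      have p1 := h₁.r_pos u hu.1
      have p2 := h₂.r_pos u hu.1
      have q1 := h₁.r_le u hu.1
      have q2 := h₂.r_le u hu.1
      have := hu.2
      have hu0 := hu.1
      refine sq_le_sq' ?_ ?_ <;> linarith
    · have : 0 < r₂ s - r₁ s := by linarith
      positivity
  intro s hs
  exact ⟨le_antisymm (key h₂ h₁ s hs) (key h₁ h₂ s hs), by rw [z h₁ s hs, z h₂ s hs]⟩

/-- A zero of the nonnegative function `Y` would be a minimum, whereas the equation gives the
derivative `-a/s < 0` there. -/
lemma Y_pos (ha0 : 0 < a) (h : IsLimitSolution a r Y) : ∀ s, 0 < s → 0 < Y s := by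
  have hnn : ∀ s, 0 < s → 0 ≤ Y s := fun s hs => by
    obtain ⟨θ, h, h', -⟩ := h.Y_eq s hs
    rw [h]; positivity
  intro s hs
  refine lt_of_le_of_ne (hnn s hs) fun hc => ?_
  have hmin : IsLocalMin Y s := by
    filter_upwards [Ioi_mem_nhds hs] with u hu
    rw [← hc]; exact hnn u hu
  have h0 := hmin.hasDerivAt_eq_zero (h.deriv_Y s hs)
  rw [← hc, div_eq_zero_iff] at h0
  have := h0.resolve_right hs.ne'
  simp at this
  linarith

lemma Y_le (ha0 : 0 < a) (h : IsLimitSolution a r Y) (s : ℝ) (hs : 0 < s) :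
    (a + 2) * Y s ≤ a := by
  obtain ⟨θ, h, -, h'⟩ := h.Y_eq s hs
  rw [le_div_iff₀ (by linarith)] at h'
  rw [h]; nlinarith

lemma Y_lt_one (ha0 : 0 < a) (h : IsLimitSolution a r Y) (s : ℝ) (hs : 0 < s) : Y s < 1 := by
  have := h.Y_le ha0 s hs
  by_contra hc
  nlinarith

/-- For `a > 0` the second variable is `H = Y / (1 - Y)`, which lies in `(0, a/2]` and satisfies `s
H' = 2 H² + (2 - a) H - a + 2 r H`; the coefficient of `r` is positive, so the difference system is
cooperative. To the right `1 - H₁/H₂` would grow linearly, and to the left `1 - r₁/r₂` would blow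
up, although both are less than `1`. -/
lemma eq_of_pos (ha0 : 0 < a) (h₁ : IsLimitSolution a r₁ Y₁)
    (h₂ : IsLimitSolution a r₂ Y₂) : ∀ s, 0 < s → r₁ s = r₂ s ∧ Y₁ s = Y₂ s := by
  have dH : ∀ {r Y : ℝ → ℝ} (h : IsLimitSolution a r Y), ∀ s, 0 < s →
      HasDerivAt (fun u => Y u / (1 - Y u)) ((2 * (Y s / (1 - Y s)) ^ 2
        + (2 - a) * (Y s / (1 - Y s)) - a + 2 * r s * (Y s / (1 - Y s))) / s) s := by
    intro r Y h s hs
    have := h.Y_lt_one ha0 s hs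
    have hne : 1 - Y s ≠ 0 := by linarith
    refine ((h.deriv_Y s hs).div ((h.deriv_Y s hs).const_sub 1) hne).congr_deriv ?_
    field_simp
    ring
  have Hpos : ∀ {r Y : ℝ → ℝ} (h : IsLimitSolution a r Y), ∀ s, 0 < s →
      0 < Y s / (1 - Y s) ∧ Y s / (1 - Y s) ≤ a / 2 := by
    intro r Y h s hs
    have h1 := h.Y_lt_one ha0 s hs
    have h2 := h.Y_pos ha0 s hs
    have h3 := h.Y_le ha0 s hs
    refine ⟨div_pos h2 (by linarith), ?_⟩
    rw [div_le_div_iff₀ (by linarith) two_pos]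
    linarith
  have growth : ∀ {r₁ Y₁ r₂ Y₂ : ℝ → ℝ} (h₁ : IsLimitSolution a r₁ Y₁)
      (h₂ : IsLimitSolution a r₂ Y₂), ∀ s, 0 < s →
      HasDerivAt (fun u => Y₂ u / (1 - Y₂ u) - Y₁ u / (1 - Y₁ u))
        ((2 * (Y₁ s / (1 - Y₁ s)) * (r₁ s * r₂ s) * (1 / r₁ s - 1 / r₂ s)
          + (2 * (Y₁ s / (1 - Y₁ s) + Y₂ s / (1 - Y₂ s)) + 2 - a + 2 * r₂ s)
            * (Y₂ s / (1 - Y₂ s) - Y₁ s / (1 - Y₁ s))) / s) s := by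
    intro r₁ Y₁ r₂ Y₂ h₁ h₂ s hs
    have p1 := h₁.r_pos s hs
    have p2 := h₂.r_pos s hs
    refine ((dH h₂ s hs).sub (dH h₁ s hs)).congr_deriv ?_
    have e : 2 * (Y₁ s / (1 - Y₁ s)) * (r₁ s * r₂ s) * (1 / r₁ s - 1 / r₂ s)
      = 2 * (Y₁ s / (1 - Y₁ s)) * (r₂ s - r₁ s) := by field_simp
    rw [e]
    ring
  have fwd : ∀ {r₁ Y₁ r₂ Y₂ : ℝ → ℝ} (h₁ : IsLimitSolution a r₁ Y₁)
      (h₂ : IsLimitSolution a r₂ Y₂), ∀ s₀, 0 < s₀ →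
      ¬ ∀ s, s₀ ≤ s → r₁ s < r₂ s ∧ 0 < Y₂ s / (1 - Y₂ s) - Y₁ s / (1 - Y₁ s) := by
    intro r₁ Y₁ r₂ Y₂ h₁ h₂ s₀ h0 hall
    refine no_bounded_growth (M := 1)
      (g := fun s => 1 - (Y₁ s / (1 - Y₁ s)) / (Y₂ s / (1 - Y₂ s))) h0
      (fun s hs => ((dH h₁ s (h0.trans_le hs)).div (dH h₂ s (h0.trans_le hs))
        (Hpos h₂ s (h0.trans_le hs)).1.ne').const_sub 1) ?_ ?_ ?_
    · intro s hs
      have hs0 := h0.trans_le hs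
      obtain ⟨hA, hB⟩ := hall s hs
      obtain ⟨b1, -⟩ := Hpos h₁ s hs0
      obtain ⟨b2, c2⟩ := Hpos h₂ s hs0
      set x := Y₁ s / (1 - Y₁ s)
      set y := Y₂ s / (1 - Y₂ s)
      have e : s * -(((2 * x ^ 2 + (2 - a) * x - a + 2 * r₁ s * x) / s * y
          - x * ((2 * y ^ 2 + (2 - a) * y - a + 2 * r₂ s * y) / s)) / y ^ 2)
          = (y - x) * a / y ^ 2 + x / y * (2 * (y - x) + 2 * (r₂ s - r₁ s)) := by
        field_simp; ring
      rw [e]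
      have n1 : 0 ≤ x / y * (2 * (y - x) + 2 * (r₂ s - r₁ s)) :=
        mul_nonneg (by positivity) (by linarith)
      have n2 : 1 - x / y ≤ (y - x) * a / y ^ 2 := by
        rw [le_div_iff₀ (by positivity)]
        have : (1 - x / y) * y ^ 2 = (y - x) * y := by field_simp
        rw [this]
        exact mul_le_mul_of_nonneg_left (by linarith) hB.le
      linarith
    · intro s hs
      have hs0 := h0.trans_le hs
      have := div_pos (Hpos h₁ s hs0).1 (Hpos h₂ s hs0).1
      linarith
    · have := (div_lt_one (Hpos h₂ s₀ h0).1).2 (sub_pos.1 (hall s₀ le_rfl).2)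
      linarith
  have bwd : ∀ {r₁ Y₁ r₂ Y₂ : ℝ → ℝ} (h₁ : IsLimitSolution a r₁ Y₁)
      (h₂ : IsLimitSolution a r₂ Y₂), ∀ s₀, 0 < s₀ →
      ¬ ∀ s ∈ Set.Ioc 0 s₀, r₁ s < r₂ s ∧ Y₂ s / (1 - Y₂ s) - Y₁ s / (1 - Y₁ s) < 0 := by
    intro r₁ Y₁ r₂ Y₂ h₁ h₂ s₀ h0 hall
    -- For `s ≤ 8` one has `r₁ ≤ 1 ≤ s / (4 r₂) - 1`, which is the comparison needed below; only
    -- small `s` matters for the blow-up.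
    have hsub : ∀ s ∈ Set.Ioc 0 (min s₀ 8), s ∈ Set.Ioc 0 s₀ ∧ s ≤ 8 :=
      fun s hs => ⟨⟨hs.1, hs.2.trans (min_le_left _ _)⟩, hs.2.trans (min_le_right _ _)⟩
    refine ratio_contradiction h₁ h₂ (s₀ := min s₀ 8) (lt_min h0 (by norm_num))
      (fun s hs => (hall s (hsub s hs).1).1) fun s hs => ?_
    obtain ⟨hs', hs8⟩ := hsub s hs
    obtain ⟨hA, hB⟩ := hall s hs'
    have hs0 := hs.1
    have hρ := h₂.two_le hs0
    have p1 := h₁.r_pos s hs0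
    have p2 := h₂.r_pos s hs0
    have q1 := h₁.r_le s hs0
    have y1 := h₁.Y_lt_one ha0 s hs0
    have y2 := h₂.Y_lt_one ha0 s hs0
    have hY : Y₂ s ≤ Y₁ s := by
      rw [sub_neg, div_lt_div_iff₀ (by linarith) (by linarith)] at hB
      linarith
    have h1 : 2 * (r₂ s * Y₂ s - r₁ s * Y₁ s) - (r₂ s - r₁ s) ≤ r₂ s - r₁ s := by
      nlinarith
    have h2 : r₂ s - r₁ s ≤ (s / (4 * r₂ s) - 1) * (r₂ s - r₁ s) / r₁ s := by
      rw [le_div_iff₀ p1, mul_comm]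
      exact mul_le_mul_of_nonneg_right (by linarith) (by linarith)
    linarith
  have key := saddle_trivial (A := fun u => 1 / r₁ u - 1 / r₂ u)
    (B := fun u => Y₂ u / (1 - Y₂ u) - Y₁ u / (1 - Y₁ u))
    (α := fun s => s / (4 * r₁ s) + s / (4 * r₂ s) - (a + 2))
    (β := fun s => 2 * ((1 - Y₁ s) * (1 - Y₂ s)))
    (γ := fun s => 2 * (Y₁ s / (1 - Y₁ s)) * (r₁ s * r₂ s))
    (δ := fun s => 2 * (Y₁ s / (1 - Y₁ s) + Y₂ s / (1 - Y₂ s)) + 2 - a + 2 * r₂ s) ?_ ?_ ?_ ?_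
    (fun s hs => hasDerivAt_inv_sub_inv h₁ h₂ hs) (growth h₁ h₂) ?_ ?_ ?_ ?_ ?_ ?_
  · intro s hs
    obtain ⟨hA, hB⟩ := key s hs
    refine ⟨?_, ?_⟩
    · have : 1 / r₁ s = 1 / r₂ s := by linarith
      simpa using this
    · have y1 := h₁.Y_lt_one ha0 s hs
      have y2 := h₂.Y_lt_one ha0 s hs
      rw [sub_eq_zero, div_eq_div_iff (by linarith) (by linarith)] at hB
      linarith
  · have c1 := h₁.continuousOn_r
    have c2 := h₂.continuousOn_r
    refine ContinuousOn.sub (ContinuousOn.add ?_ ?_) (by fun_prop)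
    · exact ContinuousOn.div (by fun_prop) (by fun_prop) fun s hs => by
        have := h₁.r_pos s hs; positivity
    · exact ContinuousOn.div (by fun_prop) (by fun_prop) fun s hs => by
        have := h₂.r_pos s hs; positivity
  · have c1 := h₂.continuousOn_r
    have c2 := h₁.continuousOn_Y
    have c3 := h₂.continuousOn_Y
    have d1 : ContinuousOn (fun s => Y₁ s / (1 - Y₁ s)) (Set.Ioi 0) :=
      ContinuousOn.div (by fun_prop) (by fun_prop) fun s hs => by
        have := h₁.Y_lt_one ha0 s hs; linarith
    have d2 : ContinuousOn (fun s => Y₂ s / (1 - Y₂ s)) (Set.Ioi 0) :=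
      ContinuousOn.div (by fun_prop) (by fun_prop) fun s hs => by
        have := h₂.Y_lt_one ha0 s hs; linarith
    fun_prop
  · intro s hs
    have y1 := h₁.Y_lt_one ha0 s hs
    have y2 := h₂.Y_lt_one ha0 s hs
    exact mul_pos two_pos (mul_pos (by linarith) (by linarith))
  · intro s hs
    have p1 := h₁.r_pos s hs
    have p2 := h₂.r_pos s hs
    have := (Hpos h₁ s hs).1
    positivity
  · intro s hs
    have p1 := h₁.r_pos s hs
    have p2 := h₂.r_pos s hs
    have y1 := h₁.Y_lt_one ha0 s hs
    have y2 := h₂.Y_lt_one ha0 s hs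
    have e : 2 * ((1 - Y₁ s) * (1 - Y₂ s)) * (Y₂ s / (1 - Y₂ s) - Y₁ s / (1 - Y₁ s))
        = 2 * (Y₂ s - Y₁ s) := by
      have n1 : 1 - Y₁ s ≠ 0 := by linarith
      have n2 : 1 - Y₂ s ≠ 0 := by linarith
      field_simp; ring
    rw [e, mul_div_cancel₀ _ hs.ne']
    ring
  · intro s hs
    rw [mul_div_cancel₀ _ hs.ne']
  · intro s₀ h0 hall
    exact fwd h₁ h₂ s₀ h0 fun s hs => ⟨(inv_sub_inv_pos_iff h₁ h₂ (h0.trans_le hs)).1 (hall s hs).1,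
      (hall s hs).2⟩
  · intro s₀ h0 hall
    refine fwd h₂ h₁ s₀ h0 fun s hs => ⟨(inv_sub_inv_neg_iff h₁ h₂ (h0.trans_le hs)).1 (hall s hs).1,
      ?_⟩
    have := (hall s hs).2; linarith
  · intro s₀ h0 hall
    exact bwd h₁ h₂ s₀ h0 fun s hs => ⟨(inv_sub_inv_pos_iff h₁ h₂ hs.1).1 (hall s hs).1,
      (hall s hs).2⟩
  · intro s₀ h0 hall
    refine bwd h₂ h₁ s₀ h0 fun s hs => ⟨(inv_sub_inv_neg_iff h₁ h₂ hs.1).1 (hall s hs).1,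
      ?_⟩
    have := (hall s hs).2; linarith

theorem unique (ha : -1 < a) (h₁ : IsLimitSolution a r₁ Y₁) (h₂ : IsLimitSolution a r₂ Y₂) :
    ∀ s, 0 < s → r₁ s = r₂ s ∧ Y₁ s = Y₂ s := by
  rcases lt_trichotomy a 0 with h | h | h
  · exact eq_of_neg ha h h₁ h₂
  · exact eq_of_zero h h₁ h₂
  · exact eq_of_pos h h₁ h₂

end IsLimitSolution

/-! ### Convergence of the scaled pair. -/

/-- The limiting system as a first-order system on `ℝ × ℝ`. -/
def fieldPair (a : ℝ) (x : ℝ × ℝ × ℝ × ℝ) : ℝ × ℝ :=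
  (fieldR a x.1 x.2.1 x.2.2.1 x.2.2.2 / x.2.1, fieldY a x.1 x.2.1 x.2.2.1 x.2.2.2 / x.2.1)

lemma continuousOn_fieldPair (a : ℝ) {K : Set (ℝ × ℝ × ℝ × ℝ)} (hK : ∀ x ∈ K, x.2.1 ≠ 0 ∧
    1 - x.1 * x.2.2.1 * x.2.2.2 ≠ 0) : ContinuousOn (fieldPair a) K := by
  unfold fieldPair fieldR fieldY
  refine ContinuousOn.prodMk (ContinuousOn.div ?_ (by fun_prop) fun x hx => (hK x hx).1)
    (ContinuousOn.div ?_ (by fun_prop) fun x hx => (hK x hx).1)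
  · have : ContinuousOn (fun x : ℝ × ℝ × ℝ × ℝ => x.2.2.1 * (1 - x.2.2.2 * (2 - x.1 * x.2.2.1)) /
      (1 - x.1 * x.2.2.1 * x.2.2.2)) K :=
      ContinuousOn.div (by fun_prop) (by fun_prop) fun x hx => (hK x hx).2
    fun_prop
  · have : ContinuousOn (fun x : ℝ × ℝ × ℝ × ℝ => x.2.2.1 * x.2.2.2 * (1 - x.2.2.2) /
      (1 - x.1 * x.2.2.1 * x.2.2.2)) K :=
      ContinuousOn.div (by fun_prop) (by fun_prop) fun x hx => (hK x hx).2
    fun_prop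

/-- The bound for `Y`. -/
def boundY (a : ℝ) : ℝ := |a| / (a + 2)

lemma boundY_nonneg {a : ℝ} (ha : -1 < a) : 0 ≤ boundY a :=
  div_nonneg (abs_nonneg _) (by linarith)

lemma abs_scaledY_le (a : ℝ) (ha : -1 < a) (n : ℕ) (s : ℝ) (hs : 0 < s) :
    |scaledY a (n + 1) s| ≤ boundY a := by
  obtain ⟨θ, h, h0, h1⟩ := scaledY_eq a ha n s hs
  rw [h, abs_mul, abs_of_nonneg h0, boundY, div_eq_mul_one_div]
  exact mul_le_mul_of_nonneg_left h1 (abs_nonneg _)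

lemma scaledR_pos (a : ℝ) (ha : -1 < a) (n : ℕ) (s : ℝ) (hs : 0 < s) :
    0 < scaledR a (n + 1) s :=
  lt_of_lt_of_le (by positivity) (scaledR_bounds a ha n s hs).1

/-- The region of the extended phase space where the scaled quantities near `s` live. -/
def phaseBox (a s : ℝ) : Set (ℝ × ℝ × ℝ × ℝ) :=
  Set.Icc 0 (1 / (2 * (s / 4 * boundY a + 1))) ×ˢ Set.Icc (s / 2) (2 * s) ×ˢ
    Set.Icc 0 (s / 4) ×ˢ Set.Icc (-boundY a) (boundY a)

lemma isCompact_phaseBox (a s : ℝ) : IsCompact (phaseBox a s) :=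
  isCompact_Icc.prod (isCompact_Icc.prod (isCompact_Icc.prod isCompact_Icc))

/-- The cap on `ε` in `phaseBox` is chosen so that `ε r Y ≤ 1/2` on the whole box, which keeps the
vector field continuous there. -/
lemma phaseBox_denom {a s : ℝ} (ha : -1 < a) (hs : 0 < s) :
    ∀ x ∈ phaseBox a s, 0 < x.2.1 ∧ 1 / 2 ≤ 1 - x.1 * x.2.2.1 * x.2.2.2 := by
  rintro ⟨ε, u, r, Y⟩ ⟨⟨e1, e2⟩, ⟨u1, u2⟩, ⟨r1, r2⟩, ⟨y1, y2⟩⟩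
  simp only at *
  have hB := boundY_nonneg ha
  refine ⟨by linarith, ?_⟩
  have h1 : r * Y ≤ s / 4 * boundY a :=
    (mul_le_mul_of_nonneg_left y2 r1).trans (mul_le_mul_of_nonneg_right r2 hB)
  have h2 : ε * (r * Y) ≤ ε * (s / 4 * boundY a + 1) :=
    mul_le_mul_of_nonneg_left (by linarith) e1
  have h3 : ε * (s / 4 * boundY a + 1) ≤ 1 / 2 := by
    have hp : 0 < s / 4 * boundY a + 1 := by positivity
    refine (mul_le_mul_of_nonneg_right e2 hp.le).trans (le_of_eq ?_)
    field_simp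
  linarith [mul_assoc ε r Y]

lemma tendsto_inv_succ {l : Filter ℕ} (hl : l ≤ atTop) :
    Tendsto (fun n : ℕ => 1 / ((n + 1 : ℕ) : ℝ)) l (𝓝 0) := by
  have := (tendsto_one_div_add_atTop_nhds_zero_nat (𝕜 := ℝ)).mono_left hl
  simpa using this

lemma eventually_mem_phaseBox (a : ℝ) (ha : -1 < a) {s : ℝ} (hs : 0 < s) {l : Filter ℕ}
    (hl : l ≤ atTop) : ∀ᶠ n in l, ∀ u ∈ Metric.ball s (s / 2),
      (1 / ((n + 1 : ℕ) : ℝ), u, scaledR a (n + 1) u, scaledY a (n + 1) u) ∈ phaseBox a s := by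
  have hB := boundY_nonneg ha
  have hp : 0 < 1 / (2 * (s / 4 * boundY a + 1)) := by positivity
  filter_upwards [(tendsto_inv_succ hl).eventually_le_const hp] with n hn u hu
  rw [Metric.mem_ball, Real.dist_eq, abs_lt] at hu
  have hu0 : 0 < u := by linarith
  have hr := scaledR_bounds a ha n u hu0
  exact ⟨⟨by positivity, hn⟩, ⟨by linarith, by linarith⟩,
    ⟨(scaledR_pos a ha n u hu0).le, by linarith⟩, abs_le.1 (abs_scaledY_le a ha n u hu0)⟩

/-- Bounded scalar sequences converge along an ultrafilter for every `s` at once, so no diagonal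
extraction is needed. The differential equations pass to the limit on compact boxes, and the a
priori bounds are closed conditions. -/
lemma exists_ultrafilter_limit (a : ℝ) (ha : -1 < a) (𝒰 : Ultrafilter ℕ) (h𝒰 : (𝒰 : Filter ℕ) ≤ atTop) :
    ∃ r Y : ℝ → ℝ, IsLimitSolution a r Y ∧ ∀ s, 0 < s →
      Tendsto (fun n => scaledR a (n + 1) s) 𝒰 (𝓝 (r s)) ∧
      Tendsto (fun n => scaledY a (n + 1) s) 𝒰 (𝓝 (Y s)) := by
  have hex : ∀ s : ℝ, ∃ rθ : ℝ × ℝ, 0 < s → (rθ.1 ≤ s / 8 ∧ 0 ≤ rθ.2 ∧ rθ.2 ≤ 1 / (a + 2)) ∧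
      Tendsto (fun n => scaledR a (n + 1) s) 𝒰 (𝓝 rθ.1) ∧
      Tendsto (fun n => scaledY a (n + 1) s) 𝒰 (𝓝 (a * rθ.2)) := by
    intro s
    by_cases hs : 0 < s
    swap
    · exact ⟨0, fun h => absurd h hs⟩
    choose θ hθ using fun n => scaledY_eq a ha n s hs
    obtain ⟨r, hr, hr'⟩ := isCompact_Icc.ultrafilter_le_nhds
      (𝒰.map (fun n => scaledR a (n + 1) s)) (s := Set.Icc 0 (s / 8)) (by
        rw [Ultrafilter.coe_map, le_principal_iff, mem_map]
        exact Eventually.of_forall fun n =>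
          ⟨(scaledR_pos a ha n s hs).le, (scaledR_bounds a ha n s hs).2⟩)
    obtain ⟨y, hy, hy'⟩ := isCompact_Icc.ultrafilter_le_nhds
      (𝒰.map θ) (s := Set.Icc 0 (1 / (a + 2))) (by
        rw [Ultrafilter.coe_map, le_principal_iff, mem_map]
        exact Eventually.of_forall fun n => (hθ n).2)
    refine ⟨(r, y), fun _ => ⟨⟨hr.2, hy⟩, hr', ?_⟩⟩
    have e : (fun n => scaledY a (n + 1) s) = fun n => a * θ n := funext fun n => (hθ n).1
    rw [e]
    exact (show Tendsto θ 𝒰 (𝓝 y) from hy').const_mul a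
  choose rθ h using hex
  have hode : ∀ s, 0 < s → HasDerivAt (fun s => ((rθ s).1, a * (rθ s).2))
      (fieldPair a (0, s, (rθ s).1, a * (rθ s).2)) s := by
    intro s hs
    have hδ : 0 < s / 2 := by positivity
    refine hasDerivAt_of_tendsto_ode (l := (𝒰 : Filter ℕ)) (Φ := fieldPair a)
      (isCompact_phaseBox a s) (continuousOn_fieldPair a fun x hx => ?_)
      (ε := fun n : ℕ => 1 / ((n + 1 : ℕ) : ℝ)) (tendsto_inv_succ h𝒰)
      (F := fun n u => (scaledR a (n + 1) u, scaledY a (n + 1) u)) hδ ?_ ?_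
    · obtain ⟨h1, h2⟩ := phaseBox_denom ha hs x hx
      exact ⟨h1.ne', by linarith⟩
    · filter_upwards [eventually_mem_phaseBox a ha hs h𝒰] with n hn u hu
      refine ⟨hn u hu, ?_⟩
      rw [Metric.mem_ball, Real.dist_eq, abs_lt] at hu
      obtain ⟨d1, d2⟩ := hasDerivAt_scaled a ha n u (by linarith)
      exact d1.prodMk d2
    · intro u hu
      rw [Metric.mem_ball, Real.dist_eq, abs_lt] at hu
      obtain ⟨-, h1, h2⟩ := h u (by linarith)
      exact h1.prodMk_nhds h2
  refine ⟨fun s => (rθ s).1, fun s => a * (rθ s).2, ⟨?_, ?_, ?_, ?_, ?_, ?_⟩, fun s hs => (h s hs).2⟩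
  · intro s hs
    refine (hasFDerivAt_fst.comp_hasDerivAt s (hode s hs)).congr_deriv ?_
    simp only [fieldPair, fieldR, ContinuousLinearMap.coe_fst']
    ring
  · intro s hs
    refine (hasFDerivAt_snd.comp_hasDerivAt s (hode s hs)).congr_deriv ?_
    simp only [fieldPair, fieldY, ContinuousLinearMap.coe_snd']
    ring
  · intro s hs
    -- Strict positivity survives because the lower bound for `scaledR` does not depend on `n`.
    exact lt_of_lt_of_le (by positivity) (ge_of_tendsto (h s hs).2.1
      (Eventually.of_forall fun n => (scaledR_bounds a ha n s hs).1))
  · exact fun s hs => (h s hs).1.1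
  · exact fun s hs => ⟨(rθ s).2, rfl, (h s hs).1.2⟩
  · intro ha0 s hs
    obtain ⟨-, hr, hY⟩ := h s hs
    have hX : Tendsto (fun n => scaledR a (n + 1) s * scaledY a (n + 1) s /
        (1 - 1 / ((n + 1 : ℕ) : ℝ) * scaledR a (n + 1) s * scaledY a (n + 1) s)) 𝒰
        (𝓝 ((rθ s).1 * (a * (rθ s).2) / (1 - 0 * (rθ s).1 * (a * (rθ s).2)))) :=
      (hr.mul hY).div ((((tendsto_inv_succ h𝒰).mul hr).mul hY).const_sub 1) (by simp)
    rw [zero_mul, zero_mul, sub_zero, div_one] at hX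
    have hb : ∀ n, a ≤ scaledR a (n + 1) s * scaledY a (n + 1) s /
        (1 - 1 / ((n + 1 : ℕ) : ℝ) * scaledR a (n + 1) s * scaledY a (n + 1) s) ∧
        scaledR a (n + 1) s * scaledY a (n + 1) s /
        (1 - 1 / ((n + 1 : ℕ) : ℝ) * scaledR a (n + 1) s * scaledY a (n + 1) s) ≤ 0 := by
      intro n
      have hb := capX_bound a _ ha ha0 (scaled_param_pos n s hs) n
      have e : ratN a (s / (4 * ((n + 1 : ℕ) : ℝ))) (n + 1) *
          (1 - diagRatio a (s / (4 * ((n + 1 : ℕ) : ℝ))) (n + 1)) *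
          capY a (s / (4 * ((n + 1 : ℕ) : ℝ))) (n + 1)
          = scaledR a (n + 1) s * scaledY a (n + 1) s /
        (1 - 1 / ((n + 1 : ℕ) : ℝ) * scaledR a (n + 1) s * scaledY a (n + 1) s) := by
        rw [(ratN_eq a ha n s hs).2, div_mul_eq_mul_div, div_mul_eq_mul_div]
        rfl
      rwa [e] at hb
    exact ⟨ge_of_tendsto hX (Eventually.of_forall fun n => (hb n).1),
      le_of_tendsto hX (Eventually.of_forall fun n => (hb n).2)⟩

/-- A sequence converges as soon as it has the same limit along every ultrafilter finer than
`atTop`, and `IsLimitSolution.unique` identifies these limits. -/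
theorem exists_scaled_limit (a : ℝ) (ha : -1 < a) : ∃ r Y : ℝ → ℝ, IsLimitSolution a r Y ∧
    ∀ s, 0 < s → Tendsto (fun n => scaledR a (n + 1) s) atTop (𝓝 (r s)) ∧
      Tendsto (fun n => scaledY a (n + 1) s) atTop (𝓝 (Y s)) := by
  obtain ⟨r, Y, h, -⟩ := exists_ultrafilter_limit a ha (Ultrafilter.of atTop)
    (Ultrafilter.of_le atTop)
  refine ⟨r, Y, h, fun s hs => ⟨?_, ?_⟩⟩
  all_goals
    rw [tendsto_iff_ultrafilter]
    intro 𝒰 h𝒰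
    obtain ⟨r', Y', h', ht⟩ := exists_ultrafilter_limit a ha 𝒰 h𝒰
    obtain ⟨e1, e2⟩ := h.unique ha h' s hs
  · rw [e1]; exact (ht s hs).1
  · rw [e2]; exact (ht s hs).2

/-! ### The coefficients of the theorem in terms of `N`, `M`, `Y`, and their limits. -/

lemma gam_pos (a t : ℝ) (ht : 0 < t) (n : ℕ) : 0 < gam a t n :=
  ((orthoPoly_orthonormal a t ht).1 n).2

lemma gam_eq (a t : ℝ) (n : ℕ) : gam a t n = (Real.sqrt (normSq a t n))⁻¹ := by
  rw [gam, orthoPoly, coeff_C_mul, monicPoly_coeff_self, mul_one, normSq]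

lemma capGamma_eq (a t : ℝ) (ht : 0 < t) (n : ℕ) : capGamma a t n = subCoeff a t n := by
  have h := gam_pos a t ht n
  cases n with
  | zero => simp [capGamma, gamOne, subCoeff]
  | succ n =>
    rw [capGamma, div_eq_iff h.ne', gam_eq, gamOne, orthoPoly, coeff_C_mul, subCoeff, normSq,
      mul_comm]

lemma recB_eq (a t : ℝ) (ht : 0 < t) (n : ℕ) : recB a t n = recDiag a t n := by
  rw [recDiag_eq_sub a t ht, ← capGamma_eq a t ht, ← capGamma_eq a t ht]
  rfl

lemma recA_sq (a t : ℝ) (ht : 0 < t) (n : ℕ) : recA a t n ^ 2 = recSq a t n := by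
  cases n with
  | zero => simp [recA, recSq]
  | succ n =>
    rw [recA, gam_eq, gam_eq, recSq, div_pow, inv_pow, inv_pow, Real.sq_sqrt (normSq_pos a t ht n).le,
      Real.sq_sqrt (normSq_pos a t ht (n + 1)).le, inv_div_inv]

lemma one_sub_capY_pos (a t : ℝ) (ha : -1 < a) (ht : 0 < t) (n : ℕ) : 0 < 1 - capY a t n := by
  obtain ⟨θ, h, h0, h1⟩ := capY_eq a t ha ht n
  rw [le_div_iff₀ (by linarith)] at h1
  rw [h]
  nlinarith

lemma theta_eq (a t : ℝ) (ht : 0 < t) (n : ℕ) : theta a t n = -(t * (1 - capY a t n)) := by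
  rw [theta, recB_eq a t ht, recDiag_eq a t ht]; ring

lemma kappa_eq (a t : ℝ) (ha : -1 < a) (ht : 0 < t) (n : ℕ) :
    kappa a t (n + 1) = t * (1 + ratN a t (n + 1) * (1 - capY a t (n + 1))) := by
  rw [kappa, recA_sq a t ht, capGamma_eq a t ht, subCoeff_succ a t ha ht]; push_cast; ring

lemma combPlus_eq (a t : ℝ) (ha : -1 < a) (ht : 0 < t) (n : ℕ) :
    combPlus a t (n + 1) = ((n + 1 : ℕ) : ℝ) - ratN a t (n + 1) := by
  have := one_sub_capY_pos a t ha ht (n + 1)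
  rw [combPlus, theta_eq a t ht, kappa_eq a t ha ht]
  field_simp
  ring

/-- The fifth relation of `moment_normalized` with its moment evaluated by `capY` at level `n`, the
level that enters through `θ_{n-1}` in `combMinus`. -/
lemma ratM_mul (a t : ℝ) (ha : -1 < a) (ht : 0 < t) (n : ℕ) :
    ratM a t (n + 1) * (1 - capY a t n) = ratN a t (n + 1) * (1 - capY a t (n + 1)) + 2 := by
  have hn := normSq_pos a t ht n
  have h := (moment_normalized a t ha ht n).2.2.2.2.1
  have h2 := moment_sq_relation a t ht n
  have h3 : a * moment a t ht (X * (monicPoly a t n * monicPoly a t n))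
      = capY a t n * normSq a t n := by
    rw [capY, ip_sub_one_eq_moment a t ht]; field_simp
  have h4 : 2 * moment a t ht ((X + C t) * (monicPoly a t n * monicPoly a t n))
      = (1 - capY a t n) * normSq a t n := by linarith
  rw [h4] at h
  refine mul_right_cancel₀ hn.ne' ?_
  linarith

lemma combMinus_eq (a t : ℝ) (ha : -1 < a) (ht : 0 < t) (n : ℕ) :
    combMinus a t (n + 1) = ((n + 1 : ℕ) : ℝ) + a + 2 - ratM a t (n + 1) := by
  have := one_sub_capY_pos a t ha ht n
  rw [combMinus, Nat.add_sub_cancel, theta_eq a t ht, kappa_eq a t ha ht]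
  have h := ratM_mul a t ha ht n
  field_simp
  linarith

lemma ratioQ_eq (a t : ℝ) (ht : 0 < t) (n : ℕ) (x : ℂ) :
    ratioQ a t n x = aeval x (qPoly a t n) := by
  have h : ((Real.sqrt (normSq a t n))⁻¹ : ℝ) ≠ 0 := by
    rw [← gam_eq]; exact (gam_pos a t ht n).ne'
  rw [ratioQ, orthoPoly, qPoly, map_mul, map_mul, aeval_C, aeval_C, eval_mul, eval_C]
  change ((Real.sqrt (normSq a t n))⁻¹ : ℝ) * _ / (((Real.sqrt (normSq a t n))⁻¹ * _ : ℝ) : ℂ) =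
    (((monicPoly a t n).eval 0)⁻¹ : ℝ) * _
  push_cast
  rw [mul_div_mul_left _ _ (by exact_mod_cast h), div_eq_inv_mul]

/-- `N_n / n` at `t = s / 4n`. -/
def scaledK (a : ℝ) (n : ℕ) (s : ℝ) : ℝ := 1 / (1 - 1 / (n : ℝ) * scaledR a n s * scaledY a n s)

lemma ratN_eq_scaledK (a : ℝ) (ha : -1 < a) (n : ℕ) (s : ℝ) (hs : 0 < s) :
    ratN a (s / (4 * ((n + 1 : ℕ) : ℝ))) (n + 1) = ((n + 1 : ℕ) : ℝ) * scaledK a (n + 1) s := by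
  rw [(ratN_eq a ha n s hs).2, scaledK, mul_one_div]

/-- An exact form of the cancellation in `N - n`: no rate of convergence of `r` or `Y` is needed to
pass to the limit. -/
lemma scaledK_sub_one (a : ℝ) (ha : -1 < a) (n : ℕ) (s : ℝ) (hs : 0 < s) :
    ((n + 1 : ℕ) : ℝ) * (scaledK a (n + 1) s - 1)
      = scaledK a (n + 1) s * scaledR a (n + 1) s * scaledY a (n + 1) s := by
  have h := (ratN_eq a ha n s hs).1
  have hL : ((n + 1 : ℕ) : ℝ) * (1 / ((n + 1 : ℕ) : ℝ)) = 1 := by field_simp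
  rw [scaledK]
  generalize 1 / ((n + 1 : ℕ) : ℝ) = ε at *
  have h1 := one_div_mul_cancel h.ne'
  generalize hd : 1 - ε * scaledR a (n + 1) s * scaledY a (n + 1) s = d at *
  linear_combination 1 / d * scaledR a (n + 1) s * scaledY a (n + 1) s * hL
    + ((n + 1 : ℕ) : ℝ) * h1 + ((n + 1 : ℕ) : ℝ) * (1 / d) * hd

lemma diagRatio_eq_scaledR (a : ℝ) (n : ℕ) (s : ℝ) :
    diagRatio a (s / (4 * ((n + 1 : ℕ) : ℝ))) (n + 1)
      = 1 - 1 / ((n + 1 : ℕ) : ℝ) * scaledR a (n + 1) s := by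
  rw [scaledR]; field_simp; ring

lemma ratM_eq_scaled (a : ℝ) (ha : -1 < a) (n : ℕ) (s : ℝ) (hs : 0 < s) :
    ratM a (s / (4 * ((n + 1 : ℕ) : ℝ))) (n + 1) = ((n + 1 : ℕ) : ℝ) + a + 2
      - (a * (1 / ((n + 1 : ℕ) : ℝ)) * scaledR a (n + 1) s + scaledK a (n + 1) s *
        (1 - 1 / ((n + 1 : ℕ) : ℝ) * scaledR a (n + 1) s) * scaledR a (n + 1) s
          * scaledY a (n + 1) s) := by
  have hn : (0:ℝ) < ((n + 1 : ℕ) : ℝ) := by positivity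
  have h1 := ratN_relation a _ ha (scaled_param_pos n s hs) n
  rw [ratM_relation a _ ha (scaled_param_pos n s hs) n]
  rw [ratN_eq_scaledK a ha n s hs, diagRatio_eq_scaledR] at *
  change _ * (1 - scaledY a (n + 1) s + _ * scaledY a (n + 1) s) = _ at h1
  change _ * (1 - scaledY a (n + 1) s + _ * scaledY a (n + 1) s) + _ + _ = _
  have e : (n : ℝ) + 1 = ((n + 1 : ℕ) : ℝ) := by push_cast; ring
  rw [e] at h1
  generalize ((n + 1 : ℕ) : ℝ) = L at *
  generalize scaledK a (n + 1) s = k at *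
  generalize scaledR a (n + 1) s = r at *
  generalize scaledY a (n + 1) s = y at *
  have hL : L * (1 / L) = 1 := by field_simp
  generalize 1 / L = ε at *
  linear_combination h1 - k * (1 - ε * r) * r * y * hL

section limits
variable {a s r Y : ℝ}

lemma tendsto_scaledK (hr : Tendsto (fun n => scaledR a (n + 1) s) atTop (𝓝 r))
    (hY : Tendsto (fun n => scaledY a (n + 1) s) atTop (𝓝 Y)) :
    Tendsto (fun n => scaledK a (n + 1) s) atTop (𝓝 1) := by
  have h : Tendsto (fun n => scaledK a (n + 1) s) atTop (𝓝 (1 / (1 - 0 * r * Y))) :=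
    (tendsto_const_nhds (x := (1:ℝ))).div
    ((((tendsto_inv_succ le_rfl).mul hr).mul hY).const_sub 1) (by simp)
  simpa using h

theorem tendsto_coefficients (ha : -1 < a) (hs : 0 < s)
    (hr : Tendsto (fun n => scaledR a (n + 1) s) atTop (𝓝 r))
    (hY : Tendsto (fun n => scaledY a (n + 1) s) atTop (𝓝 Y)) :
    Tendsto (fun n : ℕ => 4 * n * theta a (s / (4 * n)) n) atTop (𝓝 (-(s * (1 - Y)))) ∧
    Tendsto (fun n : ℕ => n * (n + a + 2) + capGamma a (s / (4 * n)) n) atTop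
      (𝓝 (s / 4 * Y - (a + 2) * r * Y - r ^ 2 * Y + r ^ 2 * Y ^ 2 + a * r)) ∧
    Tendsto (fun n : ℕ => kappa a (s / (4 * n)) n) atTop (𝓝 (-(1 / 4) * -(s * (1 - Y)))) ∧
    Tendsto (fun n : ℕ => combPlus a (s / (4 * n)) n) atTop (𝓝 (-(r * Y))) ∧
    Tendsto (fun n : ℕ => combMinus a (s / (4 * n)) n) atTop (𝓝 (- -(r * Y))) ∧
    Tendsto (fun n : ℕ => n * (combPlus a (s / (4 * n)) n + combMinus a (s / (4 * n)) n)) atTop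
      (𝓝 (r * (a - r * Y))) := by
  have hk := tendsto_scaledK hr hY
  have hε := tendsto_inv_succ (le_refl (atTop : Filter ℕ))
  have hL : ∀ n : ℕ, ((n + 1 : ℕ) : ℝ) * (1 / ((n + 1 : ℕ) : ℝ)) = 1 := fun n => by field_simp
  have ht := fun n => scaled_param_pos n s hs
  have hcP : ∀ n : ℕ, combPlus a (s / (4 * ((n + 1 : ℕ) : ℝ))) (n + 1)
      = -(scaledK a (n + 1) s * scaledR a (n + 1) s * scaledY a (n + 1) s) := fun n => by
    rw [combPlus_eq a _ ha (ht n), ratN_eq_scaledK a ha n s hs, ← scaledK_sub_one a ha n s hs]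
    ring
  have hcM : ∀ n : ℕ, combMinus a (s / (4 * ((n + 1 : ℕ) : ℝ))) (n + 1)
      = a * (1 / ((n + 1 : ℕ) : ℝ)) * scaledR a (n + 1) s + scaledK a (n + 1) s *
        (1 - 1 / ((n + 1 : ℕ) : ℝ) * scaledR a (n + 1) s) * scaledR a (n + 1) s
          * scaledY a (n + 1) s := fun n => by
    rw [combMinus_eq a _ ha (ht n), ratM_eq_scaled a ha n s hs]
    ring
  refine ⟨?_, ?_, ?_, ?_, ?_, ?_⟩
  -- The exact formulas hold at index `n + 1`, which also avoids `n = 0`, where `s / (4 * n)` has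
  -- the default value `0`.
  all_goals refine (tendsto_add_atTop_iff_nat 1).1 ?_
  · refine ((hY.const_sub 1).const_mul s).neg.congr fun n => ?_
    rw [theta_eq a _ (ht n)]
    change _ = 4 * ((n + 1 : ℕ) : ℝ) * -(_ * (1 - scaledY a (n + 1) s))
    field_simp
  · have h : Tendsto (fun n => s / 4 - scaledK a (n + 1) s * (1 - scaledY a (n + 1) s) * (s / 4)
        + a * scaledR a (n + 1) s
        - scaledK a (n + 1) s * scaledR a (n + 1) s ^ 2 * scaledY a (n + 1) s
        - scaledK a (n + 1) s * scaledR a (n + 1) s * scaledY a (n + 1) s * (a + 2 -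
          (a * (1 / ((n + 1 : ℕ) : ℝ)) * scaledR a (n + 1) s + scaledK a (n + 1) s *
        (1 - 1 / ((n + 1 : ℕ) : ℝ) * scaledR a (n + 1) s) * scaledR a (n + 1) s
          * scaledY a (n + 1) s))) atTop
        (𝓝 (s / 4 - 1 * (1 - Y) * (s / 4) + a * r - 1 * r ^ 2 * Y
          - 1 * r * Y * (a + 2 - (a * 0 * r + 1 * (1 - 0 * r) * r * Y)))) :=
      ((((hk.mul (hY.const_sub 1)).mul_const (s / 4)).const_sub (s / 4)).add
        (hr.const_mul a)).sub ((hk.mul (hr.pow 2)).mul hY) |>.sub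
        (((hk.mul hr).mul hY).mul ((((hε.const_mul a).mul hr).add
          (((hk.mul ((hε.mul hr).const_sub 1)).mul hr).mul hY)).const_sub (a + 2)))
    refine (h.congr fun n => ?_).trans (le_of_eq (by congr 1; ring))
    -- Writing `a_n² = N M` lets the divergent part of `N M` cancel `n (n + a + 2)` exactly.
    rw [capGamma_eq a _ (ht n), subCoeff_succ a _ ha (ht n), ← ratN_mul_ratM a _ ha (ht n),
      ratN_eq_scaledK a ha n s hs, ratM_eq_scaled a ha n s hs]
    change _ = _ + (_ - _ - _ * (1 - scaledY a (n + 1) s) * _)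
    have e := scaledK_sub_one a ha n s hs
    have e3 : (n : ℝ) + 1 = ((n + 1 : ℕ) : ℝ) := by push_cast; ring
    have e2 : ((n + 1 : ℕ) : ℝ) * (s / (4 * ((n + 1 : ℕ) : ℝ))) = s / 4 := by field_simp
    rw [e3]
    have e1 := hL n
    generalize ((n + 1 : ℕ) : ℝ) = L at *
    generalize s / (4 * L) = t at *
    generalize scaledK a (n + 1) s = k at *
    generalize scaledR a (n + 1) s = r' at *
    generalize scaledY a (n + 1) s = y at *
    generalize 1 / L = ε at *
    linear_combination (L + a + 2 - (a * ε * r' + k * (1 - ε * r') * r' * y)) * e - (a * r' - k * r'^2 * y) * e1 + (k * (1 - y) - 1) * e2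
  · have h := ((hε.const_mul (s / 4)).add (((hk.mul (hY.const_sub 1))).const_mul (s / 4)))
    refine (h.congr fun n => ?_).trans (le_of_eq (by congr 1; ring))
    rw [kappa_eq a _ ha (ht n), ratN_eq_scaledK a ha n s hs]
    change _ = _ * (1 + _ * (1 - scaledY a (n + 1) s))
    field_simp
  · refine (((hk.mul hr).mul hY).neg.congr fun n => (hcP n).symm).trans (le_of_eq (by
      congr 1; ring))
  · refine ((((hε.const_mul a).mul hr).add
          (((hk.mul ((hε.mul hr).const_sub 1)).mul hr).mul hY)).congr fun n =>
      (hcM n).symm).trans (le_of_eq (by congr 1; ring))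
  · have h := (hr.const_mul a).sub ((hk.mul (hr.pow 2)).mul hY)
    refine (h.congr fun n => ?_).trans (le_of_eq (by congr 1; ring))
    rw [hcP, hcM]
    have e1 := hL n
    generalize ((n + 1 : ℕ) : ℝ) = L at *
    generalize 1 / L = ε at *
    linear_combination -(a * scaledR a (n + 1) s - scaledK a (n + 1) s * scaledR a (n + 1) s ^ 2
      * scaledY a (n + 1) s) * e1
end limits

/-! ### Taylor coefficients of the ratios in the scaled variable. -/

/-- The coefficient of `z^j` in `Q_n(-z / 4n; s / 4n)`. -/
def coefU (a : ℝ) (n j : ℕ) (s : ℝ) : ℝ := qCoeff a (s / (4 * (n : ℝ))) n j / (4 * (n : ℝ)) ^ j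

/-- The coefficient of `z^j` in `n R_n(-z / 4n; s / 4n)`. -/
def coefV (a : ℝ) (n j : ℕ) (s : ℝ) : ℝ :=
  n * (qCoeff a (s / (4 * (n : ℝ))) n j - qCoeff a (s / (4 * (n : ℝ))) (n - 1) j)
    / (4 * (n : ℝ)) ^ j

/-- Multiplication by `z` on coefficient sequences. -/
def prevCoeff (c : ℕ → ℝ) : ℕ → ℝ
  | 0 => 0
  | j + 1 => c j

lemma coefU_zero (a : ℝ) (ha : -1 < a) (n : ℕ) (s : ℝ) (hs : 0 < s) : coefU a (n + 1) 0 s = 1 := by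
  rw [coefU, qCoeff_zero_right a _ ha (scaled_param_pos n s hs)]; simp

lemma coefV_zero (a : ℝ) (ha : -1 < a) (n : ℕ) (s : ℝ) (hs : 0 < s) : coefV a (n + 1) 0 s = 0 := by
  rw [coefV, qCoeff_zero_right a _ ha (scaled_param_pos n s hs),
    qCoeff_zero_right a _ ha (scaled_param_pos n s hs)]; simp

/-- Since `n.choose j ≤ n^j / j!`, the scaling `(4n)^j` absorbs all growth in `n`. This bound,
uniform in `n` and `s`, is the dominating sequence for all limits of power series below. -/
lemma abs_coefU_le (a : ℝ) (ha : -1 < a) (n j : ℕ) (s : ℝ) (hs : 0 < s) :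
    |coefU a (n + 1) j s| ≤ 1 / (j.factorial : ℝ) := by
  obtain ⟨h0, -, h1⟩ := qCoeff_bounds a _ ha (scaled_param_pos n s hs) j
  have hL : (0:ℝ) < ((n + 1 : ℕ) : ℝ) := by positivity
  rw [coefU, abs_of_nonneg (div_nonneg (h0 _) (by positivity)), div_le_iff₀ (by positivity)]
  refine (h1 _).trans ((div_le_self (by positivity) (one_le_pow₀ one_le_two)).trans
    ((Nat.choose_le_pow_div j (n + 1)).trans ?_))
  rw [one_div_mul_eq_div]
  gcongr
  linarith

lemma abs_coefV_le (a : ℝ) (ha : -1 < a) (n j : ℕ) (s : ℝ) (hs : 0 < s) :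
    |coefV a (n + 1) j s| ≤ 1 / (j.factorial : ℝ) := by
  cases j with
  | zero => rw [coefV_zero a ha n s hs]; simp
  | succ j =>
  obtain ⟨h0, h1⟩ := qCoeff_sub_bounds a _ ha (scaled_param_pos n s hs) n j
  have hL : (0:ℝ) < ((n + 1 : ℕ) : ℝ) := by positivity
  rw [coefV, Nat.add_sub_cancel,
    abs_of_nonneg (div_nonneg (mul_nonneg hL.le h0) (by positivity)), div_le_iff₀ (by positivity)]
  have h2 : (n.choose j : ℝ) / 2 ^ (j + 1) ≤ ((n + 1 : ℕ) : ℝ) ^ j / j.factorial / 2 ^ (j + 1) := by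
    gcongr
    refine (Nat.choose_le_pow_div j n).trans ?_
    gcongr
    simp
  refine (mul_le_mul_of_nonneg_left (h1.trans h2) hL.le).trans ?_
  have e : ((n + 1 : ℕ) : ℝ) * (((n + 1 : ℕ) : ℝ) ^ j / j.factorial / 2 ^ (j + 1))
    = ((j:ℝ) + 1) / 8 ^ (j + 1) * (1 / ((j + 1).factorial : ℝ) * (4 * ((n + 1 : ℕ) : ℝ)) ^ (j + 1)) := by
    rw [Nat.factorial_succ, show (8:ℝ) = 4 * 2 by norm_num, mul_pow, mul_pow]
    push_cast
    field_simp
    ring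
  rw [e]
  refine mul_le_of_le_one_left (by positivity) ?_
  rw [div_le_one (by positivity)]
  -- Bernoulli's inequality gives `j + 1 ≤ 8^(j+1)`, which absorbs the factor `j + 1` coming from
  -- the shift in degree.
  have := one_add_mul_le_pow (show (-2:ℝ) ≤ 7 by norm_num) (j + 1)
  norm_num at this
  linarith

lemma qPoly_coeff_fst (a : ℝ) (n j : ℕ) (s : ℝ) :
    (qPoly a (s / (4 * ((n + 1 : ℕ) : ℝ))) (n + 1)).coeff j
      = (-1) ^ j * (4 * ((n + 1 : ℕ) : ℝ)) ^ j * coefU a (n + 1) j s := by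
  have hL : (0:ℝ) < ((n + 1 : ℕ) : ℝ) := by positivity
  rw [coefU, mul_assoc, mul_div_cancel₀ _ (by positivity), qCoeff, ← mul_assoc, ← mul_pow]
  simp

lemma qPoly_coeff_sub (a : ℝ) (n j : ℕ) (s : ℝ) :
    (qPoly a (s / (4 * ((n + 1 : ℕ) : ℝ))) (n + 1) - qPoly a (s / (4 * ((n + 1 : ℕ) : ℝ))) n).coeff j
      = (-1) ^ j * (4 * ((n + 1 : ℕ) : ℝ)) ^ j * (1 / ((n + 1 : ℕ) : ℝ) * coefV a (n + 1) j s) := by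
  have hL : (0:ℝ) < ((n + 1 : ℕ) : ℝ) := by positivity
  have e : (-1 : ℝ) ^ j * (-1) ^ j = 1 := by rw [← mul_pow]; simp
  rw [coefV, Nat.add_sub_cancel, qCoeff, qCoeff, coeff_sub, ← mul_sub]
  generalize (-1 : ℝ) ^ j = σ at *
  field_simp
  rw [pow_two, e, mul_one]

lemma coeff_X_mul_prev (f : ℝ[X]) (c : ℕ → ℝ) (b d : ℝ) (hb : b ≠ 0)
    (h : ∀ j, f.coeff j = (-1) ^ j * b ^ j * (d * c j)) (j : ℕ) :
    (X * f).coeff j = (-1) ^ j * b ^ j * (-(d / b) * prevCoeff c j) := by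
  cases j with
  | zero => simp [prevCoeff]
  | succ j =>
    rw [coeff_X_mul, h, prevCoeff]
    field_simp
    ring

/-- The `x`-derivative of `Q_{n+1}`, as a polynomial identity. -/
lemma spectral_fst_sub (a t : ℝ) (ha : -1 < a) (ht : 0 < t) (n : ℕ) :
    X * (X * derivative (qPoly a t (n + 1))) + C t * (X * derivative (qPoly a t (n + 1)))
      = C ((n : ℝ) + 1 - ratN a t (n + 1)) * (X * qPoly a t (n + 1))
        + C (ratN a t (n + 1)) * (X * (qPoly a t (n + 1) - qPoly a t n))
        + C (ratN a t (n + 1) * (1 - capY a t (n + 1)) * t)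
          * (qPoly a t (n + 1) - qPoly a t n) := by
  refine Polynomial.funext fun x => ?_
  have h1 := spectral_fst a t ha ht n x
  simp only [eval_add, eval_sub, eval_mul, eval_X, eval_C]
  linear_combination h1

/-- The coefficient of `x^(j+1)` in `spectral_sub`; the factor `j + 3` is `j + 1` from the Euler
operator plus `2` from the constant term `2 t`. -/
lemma coefV_recursion (a : ℝ) (ha : -1 < a) (n j : ℕ) (s : ℝ) (hs : 0 < s) :
    s * (j + 3) * coefV a (n + 1) (j + 1) s =
      -(scaledR a (n + 1) s * (a - scaledK a (n + 1) s * scaledR a (n + 1) s * scaledY a (n + 1) s)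
          - s / 4) * coefU a (n + 1) j s
      - prevCoeff (fun i => coefU a (n + 1) i s) j / 4
      - (scaledK a (n + 1) s * scaledR a (n + 1) s * scaledY a (n + 1) s
          + s / 4 * (1 / ((n + 1 : ℕ) : ℝ)) - 2 - a - j) * coefV a (n + 1) j s
      + 1 / ((n + 1 : ℕ) : ℝ) / 4 * prevCoeff (fun i => coefV a (n + 1) i s) j := by
  have hL : (0:ℝ) < ((n + 1 : ℕ) : ℝ) := by positivity
  have ht := scaled_param_pos n s hs
  have h := congrArg (fun p => p.coeff (j + 1)) (spectral_sub a _ ha ht n)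
  have hX1 := coeff_X_mul_prev _ (fun i => coefU a (n + 1) i s) (4 * ((n + 1 : ℕ) : ℝ)) 1
    (by positivity) (fun i => by rw [one_mul]; exact qPoly_coeff_fst a n i s) j
  have hX2 := coeff_X_mul_prev _ (fun i => coefV a (n + 1) i s) (4 * ((n + 1 : ℕ) : ℝ)) _
    (by positivity) (qPoly_coeff_sub a n · s) j
  simp only [coeff_add, coeff_sub (_ + _), coeff_sub (_ * (C _ * _)),
    coeff_X_mul, coeff_C_mul, coeff_X_mul_derivative] at h
  have eN : (((n + 1 : ℕ) : ℝ) * scaledK a (n + 1) s - (n + 1))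
      = scaledK a (n + 1) s * scaledR a (n + 1) s * scaledY a (n + 1) s := by
    rw [← scaledK_sub_one a ha n s hs]; push_cast; ring
  rw [hX1, hX2, coeff_derivative, qPoly_coeff_sub, qPoly_coeff_sub, qPoly_coeff_fst,
    ratN_eq_scaledK a ha n s hs, diagRatio_eq_scaledR, eN,
    show capY a (s / (4 * ((n + 1 : ℕ) : ℝ))) (n + 1) = scaledY a (n + 1) s from rfl] at h
  have hW : (-1 : ℝ) ^ j * (4 * ((n + 1 : ℕ) : ℝ)) ^ j ≠ 0 :=
    mul_ne_zero (pow_ne_zero _ (by norm_num)) (by positivity)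
  rw [pow_succ, pow_succ, show ∀ x y z : ℝ, x * -1 * (y * z) = x * y * -z by intros; ring] at h
  generalize (-1 : ℝ) ^ j * (4 * ((n + 1 : ℕ) : ℝ)) ^ j = W at *
  generalize ((n + 1 : ℕ) : ℝ) = L at *
  generalize scaledK a (n + 1) s = k at *
  generalize scaledR a (n + 1) s = r at *
  generalize scaledY a (n + 1) s = y at *
  generalize coefV a (n + 1) (j + 1) s = v1 at *
  generalize coefV a (n + 1) j s = v at *
  generalize coefU a (n + 1) j s = u at *
  generalize prevCoeff (fun i => coefU a (n + 1) i s) j = pu at *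
  generalize prevCoeff (fun i => coefV a (n + 1) i s) j = pv at *
  refine mul_left_cancel₀ hW ?_
  clear hW hX1 hX2 eN
  field_simp at h ⊢
  linear_combination -h

lemma coefU_recursion (a : ℝ) (ha : -1 < a) (n j : ℕ) (s : ℝ) (hs : 0 < s) :
    s * (j + 1) * coefU a (n + 1) (j + 1) s =
      (j + scaledK a (n + 1) s * scaledR a (n + 1) s * scaledY a (n + 1) s) * coefU a (n + 1) j s
      - scaledK a (n + 1) s * coefV a (n + 1) j s
      + scaledK a (n + 1) s * (1 - scaledY a (n + 1) s) * s * coefV a (n + 1) (j + 1) s := by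
  have hL : (0:ℝ) < ((n + 1 : ℕ) : ℝ) := by positivity
  have ht := scaled_param_pos n s hs
  have h := congrArg (fun p => p.coeff (j + 1)) (spectral_fst_sub a _ ha ht n)
  simp only [coeff_add, coeff_X_mul, coeff_C_mul, coeff_X_mul_derivative] at h
  have eN : ((n : ℝ) + 1 - ((n + 1 : ℕ) : ℝ) * scaledK a (n + 1) s)
      = -(scaledK a (n + 1) s * scaledR a (n + 1) s * scaledY a (n + 1) s) := by
    rw [← scaledK_sub_one a ha n s hs]; push_cast; ring
  rw [coeff_derivative, qPoly_coeff_sub, qPoly_coeff_sub, qPoly_coeff_fst, qPoly_coeff_fst,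
    ratN_eq_scaledK a ha n s hs, eN,
    show capY a (s / (4 * ((n + 1 : ℕ) : ℝ))) (n + 1) = scaledY a (n + 1) s from rfl] at h
  have hW : (-1 : ℝ) ^ j * (4 * ((n + 1 : ℕ) : ℝ)) ^ j ≠ 0 :=
    mul_ne_zero (pow_ne_zero _ (by norm_num)) (by positivity)
  rw [pow_succ, pow_succ, show ∀ x y z : ℝ, x * -1 * (y * z) = x * y * -z by intros; ring] at h
  generalize (-1 : ℝ) ^ j * (4 * ((n + 1 : ℕ) : ℝ)) ^ j = W at *
  generalize ((n + 1 : ℕ) : ℝ) = L at *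
  generalize scaledK a (n + 1) s = k at *
  generalize scaledR a (n + 1) s = r at *
  generalize scaledY a (n + 1) s = y at *
  generalize coefV a (n + 1) (j + 1) s = v1 at *
  generalize coefV a (n + 1) j s = v at *
  generalize coefU a (n + 1) j s = u at *
  generalize coefU a (n + 1) (j + 1) s = u1 at *
  refine mul_left_cancel₀ hW ?_
  clear hW eN
  field_simp at h ⊢
  linear_combination -h

/-! ### Convergence of the coefficients -/

lemma exists_tendsto_coef {a s r Y : ℝ} (ha : -1 < a) (hs : 0 < s)
    (hr : Tendsto (fun n => scaledR a (n + 1) s) atTop (𝓝 r))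
    (hY : Tendsto (fun n => scaledY a (n + 1) s) atTop (𝓝 Y)) :
    ∃ u v : ℕ → ℝ, ∀ j, Tendsto (fun n => coefU a (n + 1) j s) atTop (𝓝 (u j)) ∧
      Tendsto (fun n => coefV a (n + 1) j s) atTop (𝓝 (v j)) := by
  have hk := tendsto_scaledK hr hY
  have hε := tendsto_inv_succ (le_refl (atTop : Filter ℕ))
  -- The recursion for `V` reaches back two degrees, so the induction also carries `prevCoeff`. In
  -- each step `V` comes first, since the recursion for `U` at degree `j + 1` involves it.
  have step : ∀ j : ℕ, ((∃ u v : ℝ, Tendsto (fun n => coefU a (n + 1) j s) atTop (𝓝 u) ∧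
      Tendsto (fun n => coefV a (n + 1) j s) atTop (𝓝 v)) ∧
      ∃ u v : ℝ, Tendsto (fun n => prevCoeff (fun i => coefU a (n + 1) i s) j) atTop (𝓝 u) ∧
      Tendsto (fun n => prevCoeff (fun i => coefV a (n + 1) i s) j) atTop (𝓝 v)) := by
    intro j
    induction j with
    | zero =>
      refine ⟨⟨1, 0, ?_, ?_⟩, ⟨0, 0, tendsto_const_nhds, tendsto_const_nhds⟩⟩
      · exact tendsto_const_nhds.congr fun n => (coefU_zero a ha n s hs).symm
      · exact tendsto_const_nhds.congr fun n => (coefV_zero a ha n s hs).symm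
    | succ j ih =>
      obtain ⟨⟨u, v, hu, hv⟩, ⟨u', v', hu', hv'⟩⟩ := ih
      have hV := ((((((hr.mul (((hk.mul hr).mul hY).const_sub a)).sub_const (s / 4)).neg.mul hu).sub
        (hu'.div_const 4)).sub (((((((hk.mul hr).mul hY).add (hε.const_mul (s / 4))).sub_const
          2).sub_const a).sub_const (j : ℝ)).mul hv)).add ((hε.div_const 4).mul hv')).div_const
          (s * (j + 3))
      have hV' := hV.congr fun n => by
        rw [← coefV_recursion a ha n j s hs, mul_div_cancel_left₀ _ (by positivity)]
      have hU := ((((((hk.mul hr).mul hY).const_add (j : ℝ)).mul hu).sub (hk.mul hv)).add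
        (((hk.mul (hY.const_sub 1)).mul_const s).mul hV')).div_const (s * (j + 1))
      have hU' := hU.congr fun n => by
        rw [← coefU_recursion a ha n j s hs, mul_div_cancel_left₀ _ (by positivity)]
      exact ⟨⟨_, _, hU', hV'⟩, ⟨u, v, hu, hv⟩⟩
  choose u v h using fun j => (step j).1
  exact ⟨u, v, h⟩

/-! ### Entire functions with rapidly decaying coefficients -/

/-- The power series with coefficients `c`. -/
def entireSum (c : ℕ → ℝ) (z : ℂ) : ℂ := ∑' j, (c j : ℂ) * z ^ j

lemma norm_term_le {c : ℕ → ℝ} {j : ℕ} (hc : |c j| ≤ 1 / (j.factorial : ℝ)) {z : ℂ} {R : ℝ}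
    (hz : ‖z‖ ≤ R) : ‖(c j : ℂ) * z ^ j‖ ≤ R ^ j / j.factorial := by
  rw [norm_mul, norm_pow, Complex.norm_real, Real.norm_eq_abs, ← one_div_mul_eq_div]
  gcongr

lemma hasSum_entireSum {c : ℕ → ℝ} (hc : ∀ j, |c j| ≤ 1 / (j.factorial : ℝ)) (z : ℂ) :
    HasSum (fun j => (c j : ℂ) * z ^ j) (entireSum c z) :=
  (Summable.of_norm_bounded (Real.summable_pow_div_factorial ‖z‖)
    fun j => norm_term_le (hc j) le_rfl).hasSum

lemma tendsto_entireSum {c : ℕ → ℕ → ℝ} {d : ℕ → ℝ}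
    (hc : ∀ n j, |c n j| ≤ 1 / (j.factorial : ℝ))
    (h : ∀ j, Tendsto (fun n => c n j) atTop (𝓝 (d j))) (z : ℂ) :
    Tendsto (fun n => entireSum (c n) z) atTop (𝓝 (entireSum d z)) :=
  tendsto_tsum_of_dominated_convergence (Real.summable_pow_div_factorial ‖z‖)
    (fun j => ((Complex.continuous_ofReal.tendsto _).comp (h j)).mul_const _)
    (Eventually.of_forall fun n j => norm_term_le (hc n j) le_rfl)

/-- The coefficient sequence of the derivative. -/
def derivCoeff (c : ℕ → ℝ) (j : ℕ) : ℝ := (j + 1) * c (j + 1)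

/-- The factor `j + 1` is absorbed by the factorial, so the class of coefficient sequences is closed
under differentiation with the same bound. -/
lemma abs_derivCoeff_le {c : ℕ → ℝ} (hc : ∀ j, |c j| ≤ 1 / (j.factorial : ℝ)) (j : ℕ) :
    |derivCoeff c j| ≤ 1 / (j.factorial : ℝ) := by
  have h := hc (j + 1)
  rw [derivCoeff, abs_mul, abs_of_nonneg (by positivity)]
  refine (mul_le_mul_of_nonneg_left h (by positivity)).trans (le_of_eq ?_)
  rw [Nat.factorial_succ]; push_cast; field_simp

lemma hasDerivAt_entireSum {c : ℕ → ℝ} (hc : ∀ j, |c j| ≤ 1 / (j.factorial : ℝ)) (z : ℂ) :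
    HasDerivAt (entireSum c) (entireSum (derivCoeff c) z) z := by
  have hd : ∀ (j : ℕ) (w : ℂ), HasDerivAt (fun w => (c j : ℂ) * w ^ j)
      ((c j : ℂ) * (j * w ^ (j - 1))) w := fun j w => (hasDerivAt_pow j w).const_mul _
  have hU : IsOpen (Metric.ball (0:ℂ) (‖z‖ + 1)) := Metric.isOpen_ball
  have hz : z ∈ Metric.ball (0:ℂ) (‖z‖ + 1) := by simp
  have hF : ∀ (j : ℕ) (w : ℂ), w ∈ Metric.ball (0:ℂ) (‖z‖ + 1) →
      ‖(c j : ℂ) * w ^ j‖ ≤ (‖z‖ + 1) ^ j / j.factorial := fun j w hw =>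
    norm_term_le (hc j) (by simpa using (Metric.mem_ball.1 hw).le)
  have hsum := Real.summable_pow_div_factorial (‖z‖ + 1)
  have hdiff := Complex.differentiableOn_tsum_of_summable_norm hsum
    (fun j w _ => (hd j w).differentiableAt.differentiableWithinAt) hU hF
  have h := Complex.hasSum_deriv_of_summable_norm hsum
    (fun j w _ => (hd j w).differentiableAt.differentiableWithinAt) hU hF hz
  have h2 : HasSum (fun j => ((derivCoeff c j : ℝ) : ℂ) * z ^ j)
      (deriv (entireSum c) z) := by
    have h3 := (hasSum_nat_add_iff' 1).2 h
    simp only [(hd _ z).deriv, Finset.sum_range_one, Nat.cast_zero, zero_mul, mul_zero, sub_zero,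
      Nat.add_sub_cancel] at h3
    refine (congrArg (HasSum · _) (funext fun j => ?_)).mpr h3
    rw [derivCoeff]
    push_cast
    ring
  rw [(hasSum_entireSum (abs_derivCoeff_le hc) z).unique h2]
  exact ((hdiff z hz).differentiableAt (hU.mem_nhds hz)).hasDerivAt

lemma hasSum_prev {c : ℕ → ℝ} (hc : ∀ j, |c j| ≤ 1 / (j.factorial : ℝ)) (z : ℂ) :
    HasSum (fun j => (prevCoeff c j : ℂ) * z ^ j) (z * entireSum c z) := by
  have h := (hasSum_entireSum hc z).mul_left z
  rw [← hasSum_nat_add_iff' 1]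
  simp only [Finset.sum_range_one, prevCoeff, Complex.ofReal_zero, zero_mul, sub_zero]
  refine (congrArg (HasSum · _) (funext fun j => ?_)).mpr h
  ring

lemma hasSum_index_mul {c : ℕ → ℝ} (hc : ∀ j, |c j| ≤ 1 / (j.factorial : ℝ)) (z : ℂ) :
    HasSum (fun j : ℕ => ((j * c j : ℝ) : ℂ) * z ^ j) (z * entireSum (derivCoeff c) z) := by
  have h := hasSum_prev (abs_derivCoeff_le hc) z
  refine (congrArg (HasSum · _) (funext fun j => ?_)).mpr h
  cases j with
  | zero => simp [prevCoeff]
  | succ j => simp [prevCoeff, derivCoeff]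

lemma hasSum_succ {c : ℕ → ℝ} {z S : ℂ} (h : HasSum (fun j => (c j : ℂ) * z ^ j) S) (h0 : c 0 = 0) :
    HasSum (fun j => (c (j + 1) : ℂ) * z ^ (j + 1)) S := by
  have := (hasSum_nat_add_iff' 1).2 h
  simpa [h0] using this

lemma aeval_eq_entireSum (f : ℝ[X]) (c : ℕ → ℝ) (b d : ℝ) (hb : b ≠ 0) (hd : d ≠ 0)
    (h : ∀ j, f.coeff j = (-1) ^ j * b ^ j * (d * c j)) (z : ℂ) :
    aeval (-z / (b : ℂ)) f = d * entireSum c z := by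
  have hb' : (b : ℂ) ≠ 0 := by exact_mod_cast hb
  rw [aeval_eq_sum_range, entireSum, tsum_eq_sum (s := Finset.range (f.natDegree + 1)),
    Finset.mul_sum]
  · refine Finset.sum_congr rfl fun j _ => ?_
    have e : (-1 : ℂ) ^ j * (-z) ^ j = z ^ j := by rw [← mul_pow]; simp
    rw [h, Complex.real_smul, div_pow]
    push_cast
    rw [← e]
    field_simp
  · intro j hj
    have h0 : f.coeff j = 0 := coeff_eq_zero_of_natDegree_lt (by simpa using hj)
    rw [h] at h0
    have : c j = 0 := by simpa [hb, hd] using h0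
    simp [this]

lemma ratioQ_eq_entireSum (a : ℝ) (n : ℕ) (s : ℝ) (hs : 0 < s) (z : ℂ) :
    ratioQ a (s / (4 * ((n + 1 : ℕ) : ℝ))) (n + 1) (-z / (4 * ((n + 1 : ℕ) : ℂ)))
      = entireSum (fun j => coefU a (n + 1) j s) z := by
  have h := aeval_eq_entireSum _ _ (4 * ((n + 1 : ℕ) : ℝ)) 1 (by positivity) one_ne_zero
    (fun j => by rw [one_mul]; exact qPoly_coeff_fst a n j s) z
  rw [ratioQ_eq a _ (scaled_param_pos n s hs)]
  simpa using h

lemma ratioR_eq_entireSum (a : ℝ) (n : ℕ) (s : ℝ) (hs : 0 < s) (z : ℂ) :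
    ((n + 1 : ℕ) : ℂ) *
      ratioR a (s / (4 * ((n + 1 : ℕ) : ℝ))) (n + 1) (-z / (4 * ((n + 1 : ℕ) : ℂ)))
      = entireSum (fun j => coefV a (n + 1) j s) z := by
  have hL : ((n + 1 : ℕ) : ℂ) ≠ 0 := by exact_mod_cast n.succ_ne_zero
  have h := aeval_eq_entireSum _ _ (4 * ((n + 1 : ℕ) : ℝ)) (1 / ((n + 1 : ℕ) : ℝ)) (by positivity)
    (by positivity) (qPoly_coeff_sub a n · s) z
  rw [ratioR, Nat.add_sub_cancel, ratioQ_eq a _ (scaled_param_pos n s hs),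
    ratioQ_eq a _ (scaled_param_pos n s hs), ← map_sub]
  rw [Complex.ofReal_mul, Complex.ofReal_natCast] at h
  rw [show ((4 : ℝ) : ℂ) = 4 by norm_num] at h
  rw [h]
  push_cast at hL ⊢
  field_simp

/-! ### Dependence of the coefficients on `s` -/

lemma hasDerivAt_qCoeff_fst (a : ℝ) (ha : -1 < a) (n j : ℕ) (s : ℝ) (hs : 0 < s) :
    HasDerivAt (fun u => qCoeff a (u / (4 * ((n + 1 : ℕ) : ℝ))) (n + 1) j)
      ((4 * ((n + 1 : ℕ) : ℝ)) ^ j * ((scaledK a (n + 1) s * coefV a (n + 1) j s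
        - j * coefU a (n + 1) j s) / s)) s := by
  have hL : (0:ℝ) < ((n + 1 : ℕ) : ℝ) := by positivity
  have d0 : HasDerivAt (fun u : ℝ => u / (4 * ((n + 1 : ℕ) : ℝ))) (1 / (4 * ((n + 1 : ℕ) : ℝ))) s :=
    (hasDerivAt_id s).div_const _
  have h := (((hasDerivAt_qPoly_coeff_fst a _ ha (scaled_param_pos n s hs) n j).comp s d0).const_mul
    ((-1) ^ j))
  refine h.congr_deriv ?_
  have e : (-1 : ℝ) ^ j * (-1) ^ j = 1 := by rw [← mul_pow]; simp
  rw [coeff_C_mul, coeff_sub, coeff_C_mul, coeff_X_mul_derivative, qPoly_coeff_sub,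
    qPoly_coeff_fst, ratN_eq_scaledK a ha n s hs]
  generalize (-1 : ℝ) ^ j = σ at *
  field_simp
  rw [pow_two, e]
  ring

/-- `Q_{n+1}` is differentiated with the first formula and `Q_n` with the second. Only `N - M`
multiplies the difference, and the terms of order `n` cancel in it. -/
lemma hasDerivAt_qCoeff_sub (a : ℝ) (ha : -1 < a) (n j : ℕ) (s : ℝ) (hs : 0 < s) :
    HasDerivAt (fun u => qCoeff a (u / (4 * ((n + 1 : ℕ) : ℝ))) (n + 1) j
        - qCoeff a (u / (4 * ((n + 1 : ℕ) : ℝ))) n j)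
      ((4 * ((n + 1 : ℕ) : ℝ)) ^ j * (1 / ((n + 1 : ℕ) : ℝ)) *
        (((scaledK a (n + 1) s * scaledR a (n + 1) s * scaledY a (n + 1) s - a - 2
          + (a * (1 / ((n + 1 : ℕ) : ℝ)) * scaledR a (n + 1) s + scaledK a (n + 1) s *
          (1 - 1 / ((n + 1 : ℕ) : ℝ) * scaledR a (n + 1) s) * scaledR a (n + 1) s
          * scaledY a (n + 1) s) - j) * coefV a (n + 1) j s
          + 1 / 4 * (prevCoeff (fun i => coefU a (n + 1) i s) j
            - 1 / ((n + 1 : ℕ) : ℝ) * prevCoeff (fun i => coefV a (n + 1) i s) j)) / s)) s := by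
  have hL : (0:ℝ) < ((n + 1 : ℕ) : ℝ) := by positivity
  have ht := scaled_param_pos n s hs
  have d0 : HasDerivAt (fun u : ℝ => u / (4 * ((n + 1 : ℕ) : ℝ))) (1 / (4 * ((n + 1 : ℕ) : ℝ))) s :=
    (hasDerivAt_id s).div_const _
  have h := ((((hasDerivAt_qPoly_coeff_fst a _ ha ht n j).comp s d0).const_mul
    ((-1) ^ j))).sub ((((hasDerivAt_qPoly_coeff_snd a _ ha ht n j).comp s d0).const_mul
    ((-1) ^ j)))
  refine h.congr_deriv ?_
  have e : (-1 : ℝ) ^ j * (-1) ^ j = 1 := by rw [← mul_pow]; simp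
  have hX1 := coeff_X_mul_prev _ (fun i => coefU a (n + 1) i s) (4 * ((n + 1 : ℕ) : ℝ)) 1
    (by positivity) (fun i => by rw [one_mul]; exact qPoly_coeff_fst a n i s) j
  have hX2 := coeff_X_mul_prev _ (fun i => coefV a (n + 1) i s) (4 * ((n + 1 : ℕ) : ℝ)) _
    (by positivity) (qPoly_coeff_sub a n · s) j
  have hD := qPoly_coeff_sub a n j s
  have hk := scaledK_sub_one a ha n s hs
  rw [mul_sub, coeff_sub] at hX2
  rw [coeff_sub] at hD
  rw [coeff_C_mul, coeff_C_mul, coeff_sub, coeff_add, coeff_sub, coeff_C_mul, coeff_C_mul,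
    coeff_X_mul_derivative, coeff_X_mul_derivative, coeff_sub,
    ratN_eq_scaledK a ha n s hs, ratM_eq_scaled a ha n s hs]
  have hσ : (-1 : ℝ) ^ j ≠ 0 := pow_ne_zero _ (by norm_num)
  generalize (-1 : ℝ) ^ j = σ at *
  generalize hb : (4 * ((n + 1 : ℕ) : ℝ)) ^ j = b at *
  rw [hX1] at hX2
  have hA : ∀ x y : ℝ, x - y = σ * b * (1 / ((n + 1 : ℕ) : ℝ) * coefV a (n + 1) j s) →
      y = x - σ * b * (1 / ((n + 1 : ℕ) : ℝ) * coefV a (n + 1) j s) := fun x y h => by linarith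
  rw [hA _ _ hD]
  have hB : (X * qPoly a (s / (4 * ((n + 1 : ℕ) : ℝ))) n).coeff j = σ * b *
      (-(1 / (4 * ((n + 1 : ℕ) : ℝ))) * prevCoeff (fun i => coefU a (n + 1) i s) j)
      - σ * b * (-(1 / ((n + 1 : ℕ) : ℝ) / (4 * ((n + 1 : ℕ) : ℝ)))
        * prevCoeff (fun i => coefV a (n + 1) i s) j) := by linarith
  rw [hB]
  clear hX1 hX2 hD hA hB h d0 ht hb
  generalize (qPoly a (s / (4 * ((n + 1 : ℕ) : ℝ))) (n + 1)).coeff j = x at *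
  generalize ((n + 1 : ℕ) : ℝ) = L at *
  generalize scaledK a (n + 1) s = k at *
  generalize scaledR a (n + 1) s = r at *
  generalize scaledY a (n + 1) s = y at *
  generalize coefV a (n + 1) j s = v at *
  generalize prevCoeff (fun i => coefU a (n + 1) i s) j = pu at *
  generalize prevCoeff (fun i => coefV a (n + 1) i s) j = pv at *
  field_simp
  ring_nf
  rw [show σ ^ 2 = 1 by rw [pow_two, e]]
  linear_combination 4 * L * b * v * hk

/-- Evaluation of a finite sequence, extended by `0`. -/
def extendZero {J : ℕ} (w : Fin J → ℝ × ℝ) (j : ℕ) : ℝ × ℝ :=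
  if h : j < J then w ⟨j, h⟩ else 0

lemma continuous_extendZero {J : ℕ} (j : ℕ) :
    Continuous fun w : Fin J → ℝ × ℝ => extendZero w j := by
  unfold extendZero
  split_ifs
  · exact continuous_apply _
  · exact continuous_const

/-- The system for `r, Y` and the first coefficients of `q` and `p`. -/
def fieldCoef (a : ℝ) {J : ℕ} (x : ℝ × ℝ × ℝ × ℝ × (Fin J → ℝ × ℝ)) :
    ℝ × ℝ × (Fin J → ℝ × ℝ) :=
  ((fieldPair a (x.1, x.2.1, x.2.2.1, x.2.2.2.1)).1,
    (fieldPair a (x.1, x.2.1, x.2.2.1, x.2.2.2.1)).2,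
    fun i => ((1 / (1 - x.1 * x.2.2.1 * x.2.2.2.1) * (x.2.2.2.2 i).2 - (i : ℕ) * (x.2.2.2.2 i).1)
        / x.2.1,
      ((1 / (1 - x.1 * x.2.2.1 * x.2.2.2.1) * x.2.2.1 * x.2.2.2.1 - a - 2
          + (a * x.1 * x.2.2.1 + 1 / (1 - x.1 * x.2.2.1 * x.2.2.2.1) *
          (1 - x.1 * x.2.2.1) * x.2.2.1 * x.2.2.2.1) - (i : ℕ)) * (x.2.2.2.2 i).2
        + 1 / 4 * (prevCoeff (fun j => (extendZero x.2.2.2.2 j).1) i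
            - x.1 * prevCoeff (fun j => (extendZero x.2.2.2.2 j).2) i)) / x.2.1))

lemma continuousOn_fieldCoef (a : ℝ) {J : ℕ} {K : Set (ℝ × ℝ × ℝ × ℝ × (Fin J → ℝ × ℝ))}
    (hK : ∀ x ∈ K, x.2.1 ≠ 0 ∧ 1 - x.1 * x.2.2.1 * x.2.2.2.1 ≠ 0) :
    ContinuousOn (fieldCoef a) K := by
  have hpair : ContinuousOn (fun x : ℝ × ℝ × ℝ × ℝ × (Fin J → ℝ × ℝ) =>
      fieldPair a (x.1, x.2.1, x.2.2.1, x.2.2.2.1)) K :=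
    (continuousOn_fieldPair a (K := {y | y.2.1 ≠ 0 ∧ 1 - y.1 * y.2.2.1 * y.2.2.2 ≠ 0})
      fun y hy => hy).comp (by fun_prop) hK
  refine hpair.fst.prodMk (hpair.snd.prodMk (continuousOn_pi.2 fun i => ?_))
  have hk : ContinuousOn (fun x : ℝ × ℝ × ℝ × ℝ × (Fin J → ℝ × ℝ) =>
      1 / (1 - x.1 * x.2.2.1 * x.2.2.2.1)) K :=
    ContinuousOn.div (by fun_prop) (by fun_prop) fun x hx => (hK x hx).2
  have hprev : ∀ φ : ℝ × ℝ → ℝ, Continuous φ → Continuous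
      (fun x : ℝ × ℝ × ℝ × ℝ × (Fin J → ℝ × ℝ) =>
        prevCoeff (fun j => φ (extendZero x.2.2.2.2 j)) i) := by
    intro φ hφ
    cases (i : ℕ) with
    | zero => exact continuous_const
    | succ j => exact hφ.comp ((continuous_extendZero j).comp (by fun_prop))
  have h1 := (hprev _ continuous_fst).continuousOn (s := K)
  have h2 := (hprev _ continuous_snd).continuousOn (s := K)
  refine ContinuousOn.prodMk ?_ ?_
  · exact ContinuousOn.div (by fun_prop) (by fun_prop) fun x hx => (hK x hx).1
  · exact ContinuousOn.div (by fun_prop) (by fun_prop) fun x hx => (hK x hx).1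

/-- The coefficients of degree at most `j` together with `r` and `Y` form a closed finite system, so
`hasDerivAt_of_tendsto_ode` applies. The factorial bound keeps the coefficients in the closed unit
ball, which supplies the compact set. -/
lemma hasDerivAt_coef_limit {a : ℝ} (ha : -1 < a) {r Y : ℝ → ℝ} {u v : ℕ → ℝ → ℝ}
    (hr : ∀ s, 0 < s → Tendsto (fun n => scaledR a (n + 1) s) atTop (𝓝 (r s)))
    (hY : ∀ s, 0 < s → Tendsto (fun n => scaledY a (n + 1) s) atTop (𝓝 (Y s)))
    (hu : ∀ j s, 0 < s → Tendsto (fun n => coefU a (n + 1) j s) atTop (𝓝 (u j s)))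
    (hv : ∀ j s, 0 < s → Tendsto (fun n => coefV a (n + 1) j s) atTop (𝓝 (v j s)))
    (j : ℕ) (s : ℝ) (hs : 0 < s) :
    HasDerivAt (u j) ((v j s - j * u j s) / s) s ∧
    HasDerivAt (v j) (((2 * r s * Y s - a - 2 - j) * v j s
      + prevCoeff (fun i => u i s) j / 4) / s) s := by
  have hδ : 0 < s / 2 := by positivity
  have key := hasDerivAt_of_tendsto_ode (l := (atTop : Filter ℕ))
    (E := ℝ × ℝ × (Fin (j + 1) → ℝ × ℝ)) (Φ := fieldCoef a)
    (K := Set.Icc 0 (1 / (2 * (s / 4 * boundY a + 1))) ×ˢ Set.Icc (s / 2) (2 * s) ×ˢ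
      Set.Icc 0 (s / 4) ×ˢ Set.Icc (-boundY a) (boundY a) ×ˢ Metric.closedBall 0 1)
    (isCompact_Icc.prod (isCompact_Icc.prod (isCompact_Icc.prod (isCompact_Icc.prod
      (isCompact_closedBall _ _)))))
    (continuousOn_fieldCoef a fun x hx => ?_) (tendsto_inv_succ le_rfl)
    (F := fun n w => (scaledR a (n + 1) w, scaledY a (n + 1) w,
      fun i => (coefU a (n + 1) i w, coefV a (n + 1) i w)))
    (f := fun w => (r w, Y w, fun i => (u i w, v i w))) (s := s) hδ ?_ ?_
  · have h1 := hasDerivAt_pi.1 (hasFDerivAt_snd.comp_hasDerivAt s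
      (hasFDerivAt_snd.comp_hasDerivAt s key)) (Fin.last j)
    have hu1 := hasFDerivAt_fst.comp_hasDerivAt s h1
    have hv1 := hasFDerivAt_snd.comp_hasDerivAt s h1
    have hprev : ∀ w : ℕ → ℝ × ℝ, ∀ φ : ℝ × ℝ → ℝ,
        prevCoeff (fun i => φ (extendZero (fun k : Fin (j + 1) => w k) i)) j
          = prevCoeff (fun i => φ (w i)) j := by
      intro w φ
      cases j with
      | zero => rfl
      | succ j => simp [prevCoeff, extendZero]
    refine ⟨hu1.congr_deriv ?_, hv1.congr_deriv ?_⟩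
    · simp [fieldCoef]
    · have h3 := hprev (fun i => (u i s, v i s)) Prod.fst
      simp only [fieldCoef, ContinuousLinearMap.coe_snd', Fin.val_last] at h3 ⊢
      rw [h3]
      ring
  · obtain ⟨e, w, r, y, p⟩ := x
    obtain ⟨he, hw, hr, hy, -⟩ := hx
    obtain ⟨h1, h2⟩ := phaseBox_denom ha hs (e, w, r, y) ⟨he, hw, hr, hy⟩
    simp only at h1 h2
    exact ⟨h1.ne', by simp only; linarith⟩
  · filter_upwards [eventually_mem_phaseBox a ha hs le_rfl] with n hn w hw
    obtain ⟨he, hw', hr, hy⟩ := hn w hw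
    rw [Metric.mem_ball, Real.dist_eq, abs_lt] at hw
    have hw0 : 0 < w := by linarith
    have hL : (0:ℝ) < ((n + 1 : ℕ) : ℝ) := by positivity
    refine ⟨⟨he, hw', hr, hy, ?_⟩, ?_⟩
    · rw [mem_closedBall_zero_iff, pi_norm_le_iff_of_nonneg zero_le_one]
      intro i
      have hfac : 1 / (((i : ℕ).factorial : ℕ) : ℝ) ≤ 1 := by
        rw [div_le_one (by positivity)]; exact_mod_cast (i : ℕ).factorial_pos
      exact max_le ((abs_coefU_le a ha n i w hw0).trans hfac)
        ((abs_coefV_le a ha n i w hw0).trans hfac)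
    · obtain ⟨d1, d2⟩ := hasDerivAt_scaled a ha n w hw0
      refine d1.prodMk (d2.prodMk (hasDerivAt_pi.2 fun i => HasDerivAt.prodMk ?_ ?_))
      · refine ((hasDerivAt_qCoeff_fst a ha n i w hw0).div_const _).congr_deriv ?_
        rw [mul_div_cancel_left₀ _ (by positivity)]
        rfl
      · refine (((hasDerivAt_qCoeff_sub a ha n i w hw0).const_mul ((n + 1 : ℕ) : ℝ)).div_const
          ((4 * ((n + 1 : ℕ) : ℝ)) ^ (i : ℕ))).congr_deriv ?_
        have hprev : ∀ g : ℕ → ℝ × ℝ, ∀ φ : ℝ × ℝ → ℝ,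
            prevCoeff (fun m => φ (extendZero (fun k : Fin (j + 1) => g k) m)) i
              = prevCoeff (fun m => φ (g m)) i := by
          intro g φ
          obtain ⟨i, hi⟩ := i
          cases i with
          | zero => rfl
          | succ i => simp [prevCoeff, extendZero, Nat.lt_of_succ_lt hi]
        have h1 := hprev (fun m => (coefU a (n + 1) m w, coefV a (n + 1) m w)) Prod.fst
        have h2 := hprev (fun m => (coefU a (n + 1) m w, coefV a (n + 1) m w)) Prod.snd
        simp only at h1 h2
        rw [h1, h2]
        simp only [scaledK]
        field_simp
  · intro w hw
    rw [Metric.mem_ball, Real.dist_eq, abs_lt] at hw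
    have hw0 : 0 < w := by linarith
    exact (hr w hw0).prodMk_nhds ((hY w hw0).prodMk_nhds (tendsto_pi_nhds.2 fun i =>
      (hu i w hw0).prodMk_nhds (hv i w hw0)))

/-- Termwise differentiation; the allowance `2^j` covers the factor `j` that the `s`-derivative of a
coefficient brings in and is harmless for summability. -/
lemma hasDerivAt_entireSum_param {c c' : ℕ → ℝ → ℝ} {s δ B : ℝ} (hδ : 0 < δ)
    (hc : ∀ j, ∀ w ∈ Metric.ball s δ, |c j w| ≤ 1 / (j.factorial : ℝ))
    (hd : ∀ j, ∀ w ∈ Metric.ball s δ, HasDerivAt (c j) (c' j w) w)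
    (hb : ∀ j, ∀ w ∈ Metric.ball s δ, |c' j w| ≤ B * (2 ^ j / (j.factorial : ℝ))) {z S : ℂ}
    (hS : HasSum (fun j => (c' j s : ℂ) * z ^ j) S) :
    HasDerivAt (fun w => entireSum (fun j => c j w) z) S s := by
  have hs : s ∈ Metric.ball s δ := Metric.mem_ball_self hδ
  rw [← hS.tsum_eq]
  refine hasDerivAt_tsum_of_isPreconnected (t := Metric.ball s δ)
    (g := fun j w => (c j w : ℂ) * z ^ j)
    (g' := fun j w => (c' j w : ℂ) * z ^ j) (y₀ := s)
    ((Real.summable_pow_div_factorial (2 * ‖z‖)).mul_left B)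
    Metric.isOpen_ball (convex_ball s δ).isPreconnected
    (fun j w hw => ((hd j w hw).ofReal_comp.mul_const _)) (fun j w hw => ?_) hs
    (hasSum_entireSum (c := fun j => c j s) (fun j => hc j s hs) z).summable hs
  rw [norm_mul, norm_pow, Complex.norm_real, Real.norm_eq_abs]
  refine (mul_le_mul_of_nonneg_right (hb j w hw) (by positivity)).trans (le_of_eq ?_)
  rw [mul_pow]
  ring

/-! ### The limiting functions -/

/-- The limits of the scaled quantities together with the limits of the coefficients. -/
structure IsScalingLimit (a : ℝ) (r Y : ℝ → ℝ) (u v : ℕ → ℝ → ℝ) : Prop where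
  sol : IsLimitSolution a r Y
  tendsto_r : ∀ s, 0 < s → Tendsto (fun n => scaledR a (n + 1) s) atTop (𝓝 (r s))
  tendsto_Y : ∀ s, 0 < s → Tendsto (fun n => scaledY a (n + 1) s) atTop (𝓝 (Y s))
  tendsto_u : ∀ j s, 0 < s → Tendsto (fun n => coefU a (n + 1) j s) atTop (𝓝 (u j s))
  tendsto_v : ∀ j s, 0 < s → Tendsto (fun n => coefV a (n + 1) j s) atTop (𝓝 (v j s))

theorem exists_isScalingLimit (a : ℝ) (ha : -1 < a) : ∃ r Y u v, IsScalingLimit a r Y u v := by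
  obtain ⟨r, Y, h, ht⟩ := exists_scaled_limit a ha
  have hex : ∀ s : ℝ, ∃ u v : ℕ → ℝ, 0 < s → ∀ j,
      Tendsto (fun n => coefU a (n + 1) j s) atTop (𝓝 (u j)) ∧
      Tendsto (fun n => coefV a (n + 1) j s) atTop (𝓝 (v j)) := by
    intro s
    by_cases hs : 0 < s
    · obtain ⟨u, v, huv⟩ := exists_tendsto_coef ha hs (ht s hs).1 (ht s hs).2
      exact ⟨u, v, fun _ => huv⟩
    · exact ⟨0, 0, fun h => absurd h hs⟩
  choose u v huv using hex
  exact ⟨r, Y, fun j s => u s j, fun j s => v s j, h, fun s hs => (ht s hs).1,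
    fun s hs => (ht s hs).2, fun j s hs => (huv s hs j).1, fun j s hs => (huv s hs j).2⟩

namespace IsScalingLimit
variable {a : ℝ} {r Y : ℝ → ℝ} {u v : ℕ → ℝ → ℝ}

lemma u_zero (ha : -1 < a) (h : IsScalingLimit a r Y u v) {s : ℝ} (hs : 0 < s) : u 0 s = 1 :=
  tendsto_nhds_unique (h.tendsto_u 0 s hs)
    (tendsto_const_nhds.congr fun n => (coefU_zero a ha n s hs).symm)

lemma v_zero (ha : -1 < a) (h : IsScalingLimit a r Y u v) {s : ℝ} (hs : 0 < s) : v 0 s = 0 :=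
  tendsto_nhds_unique (h.tendsto_v 0 s hs)
    (tendsto_const_nhds.congr fun n => (coefV_zero a ha n s hs).symm)

lemma abs_u_le (ha : -1 < a) (h : IsScalingLimit a r Y u v) {s : ℝ} (hs : 0 < s) (j : ℕ) :
    |u j s| ≤ 1 / (j.factorial : ℝ) :=
  le_of_tendsto (h.tendsto_u j s hs).abs (Eventually.of_forall fun n => abs_coefU_le a ha n j s hs)

lemma abs_v_le (ha : -1 < a) (h : IsScalingLimit a r Y u v) {s : ℝ} (hs : 0 < s) (j : ℕ) :
    |v j s| ≤ 1 / (j.factorial : ℝ) :=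
  le_of_tendsto (h.tendsto_v j s hs).abs (Eventually.of_forall fun n => abs_coefV_le a ha n j s hs)

lemma tendsto_prev {c : ℕ → ℕ → ℝ} {d : ℕ → ℝ} (h : ∀ j, Tendsto (fun n => c n j) atTop (𝓝 (d j)))
    (j : ℕ) : Tendsto (fun n => prevCoeff (c n) j) atTop (𝓝 (prevCoeff d j)) := by
  cases j with
  | zero => exact tendsto_const_nhds
  | succ j => exact h j

lemma recursion_u (ha : -1 < a) (h : IsScalingLimit a r Y u v) {s : ℝ} (hs : 0 < s) (j : ℕ) :
    s * (j + 1) * u (j + 1) s =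
      (j + r s * Y s) * u j s - v j s + (1 - Y s) * s * v (j + 1) s := by
  have hk := tendsto_scaledK (h.tendsto_r s hs) (h.tendsto_Y s hs)
  have hr := h.tendsto_r s hs
  have hY := h.tendsto_Y s hs
  have lim := ((((hk.mul hr).mul hY).const_add (j : ℝ)).mul (h.tendsto_u j s hs)).sub
    (hk.mul (h.tendsto_v j s hs)) |>.add
    (((hk.mul (hY.const_sub 1)).mul_const s).mul (h.tendsto_v (j + 1) s hs))
  refine (tendsto_nhds_unique ((h.tendsto_u (j + 1) s hs).const_mul (s * (j + 1)))
    (lim.congr fun n => (coefU_recursion a ha n j s hs).symm)).trans ?_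
  ring

lemma recursion_v (ha : -1 < a) (h : IsScalingLimit a r Y u v) {s : ℝ} (hs : 0 < s) (j : ℕ) :
    s * (j + 3) * v (j + 1) s =
      -(r s * (a - r s * Y s) - s / 4) * u j s - prevCoeff (fun i => u i s) j / 4
      - (r s * Y s - 2 - a - j) * v j s := by
  have hk := tendsto_scaledK (h.tendsto_r s hs) (h.tendsto_Y s hs)
  have hr := h.tendsto_r s hs
  have hY := h.tendsto_Y s hs
  have hε := tendsto_inv_succ (le_refl (atTop : Filter ℕ))
  have lim := (((((hr.mul (((hk.mul hr).mul hY).const_sub a)).sub_const (s / 4)).neg.mul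
    (h.tendsto_u j s hs)).sub
    ((tendsto_prev (h.tendsto_u · s hs) j).div_const 4)).sub
    (((((((hk.mul hr).mul hY).add (hε.const_mul (s / 4))).sub_const
          2).sub_const a).sub_const (j : ℝ)).mul (h.tendsto_v j s hs))).add
    ((hε.div_const 4).mul (tendsto_prev (h.tendsto_v · s hs) j))
  refine (tendsto_nhds_unique ((h.tendsto_v (j + 1) s hs).const_mul (s * (j + 3)))
    (lim.congr fun n => (coefV_recursion a ha n j s hs).symm)).trans ?_
  ring

/-- The coefficient recursion multiplied by `z^(j+1)` and summed over `j`; the shifted sums lose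
nothing because the terms of index `0` vanish (`v 0 s = 0`). -/
lemma spectral_q (ha : -1 < a) (h : IsScalingLimit a r Y u v) {s : ℝ} (hs : 0 < s) (z : ℂ) :
    (s - z) * z * deriv (entireSum fun j => u j s) z
      = z * (r s * Y s) * entireSum (fun j => u j s) z
        + (s * (1 - Y s) - z) * entireSum (fun j => v j s) z := by
  have bu := h.abs_u_le ha hs
  have bv := h.abs_v_le ha hs
  rw [(hasDerivAt_entireSum bu z).deriv]
  have U := (hasSum_entireSum bu z).mul_left z
  have V := (hasSum_entireSum bv z).mul_left z
  have U' := hasSum_index_mul bu z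
  have U1 := hasSum_succ (c := fun j => j * u j s) U' (by simp)
  have V1 := hasSum_succ (hasSum_entireSum bv z) (h.v_zero ha hs)
  have e := (U1.mul_left (s : ℂ)).tsum_eq.symm.trans ((tsum_congr fun j => ?_).trans
    (((U'.mul_left z).add (U.mul_left ((r s * Y s : ℝ) : ℂ))).sub V |>.add
      (V1.mul_left (((1 - Y s) * s : ℝ) : ℂ))).tsum_eq)
  · push_cast at e
    linear_combination e
  · have hrec := congrArg (fun x : ℝ => (x : ℂ)) (h.recursion_u ha hs j)
    push_cast at hrec ⊢
    linear_combination z ^ (j + 1) * hrec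

lemma spectral_p (ha : -1 < a) (h : IsScalingLimit a r Y u v) {s : ℝ} (hs : 0 < s) (z : ℂ) :
    (s - z) * z * deriv (entireSum fun j => v j s) z
      = -z * (r s * (a - r s * Y s) + (z - s) / 4) * entireSum (fun j => u j s) z
        + (-2 * s + z * (-(r s * Y s) + a + 2)) * entireSum (fun j => v j s) z := by
  have bu := h.abs_u_le ha hs
  have bv := h.abs_v_le ha hs
  rw [(hasDerivAt_entireSum bv z).deriv]
  have U := (hasSum_entireSum bu z).mul_left z
  have V := (hasSum_entireSum bv z).mul_left z
  have W := (hasSum_prev bu z).mul_left z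
  have V' := hasSum_index_mul bv z
  have V2 := hasSum_succ (c := fun j => j * v j s) V' (by simp)
  have V1 := hasSum_succ (hasSum_entireSum bv z) (h.v_zero ha hs)
  have e := ((V2.mul_left (s : ℂ)).add (V1.mul_left (2 * s : ℂ))).tsum_eq.symm.trans
    ((tsum_congr fun j => ?_).trans
    ((U.mul_left ((-(r s * (a - r s * Y s) - s / 4) : ℝ) : ℂ)).sub (W.mul_left (1 / 4)) |>.sub
      (V.mul_left ((r s * Y s - 2 - a : ℝ) : ℂ)) |>.add (V'.mul_left z)).tsum_eq)
  · push_cast at e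
    linear_combination e
  · have hrec := congrArg (fun x : ℝ => (x : ℂ)) (h.recursion_v ha hs j)
    push_cast at hrec ⊢
    linear_combination z ^ (j + 1) * hrec

lemma hasDerivAt_coef (ha : -1 < a) (h : IsScalingLimit a r Y u v) (j : ℕ) {s : ℝ} (hs : 0 < s) :
    HasDerivAt (u j) ((v j s - j * u j s) / s) s ∧
    HasDerivAt (v j) (((2 * r s * Y s - a - 2 - j) * v j s
      + prevCoeff (fun i => u i s) j / 4) / s) s :=
  hasDerivAt_coef_limit ha h.tendsto_r h.tendsto_Y h.tendsto_u h.tendsto_v j s hs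

lemma add_mul_index_le {c : ℝ} (hc : 0 ≤ c) (d : ℝ) (hd : 0 ≤ d) (j : ℕ) :
    c + d * j ≤ (c + d) * 2 ^ j := by
  have h1 : (j : ℝ) ≤ 2 ^ j := by exact_mod_cast Nat.lt_two_pow_self.le
  have h2 : (1 : ℝ) ≤ 2 ^ j := one_le_pow₀ one_le_two
  nlinarith

lemma abs_div_le_of_half_le {x s w b : ℝ} (hs : 0 < s) (hw : s / 2 ≤ w) (hx : |x| ≤ b) :
    |x / w| ≤ 2 / s * b := by
  have hw0 : 0 < w := by linarith
  rw [abs_div, abs_of_pos hw0, div_le_iff₀ hw0]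
  have hb : 0 ≤ b := (abs_nonneg x).trans hx
  have h1 : 1 ≤ 2 / s * w := by rw [div_mul_eq_mul_div, le_div_iff₀ hs]; linarith
  nlinarith

/-- Summing the coefficient equations gives `s ∂_s q = p - z ∂_z q`; the spectral equation later
eliminates `z ∂_z q`. -/
lemma hasDerivAt_q (ha : -1 < a) (h : IsScalingLimit a r Y u v) {s : ℝ} (hs : 0 < s) (z : ℂ) :
    HasDerivAt (fun w => entireSum (fun j => u j w) z)
      ((entireSum (fun j => v j s) z - z * deriv (entireSum fun j => u j s) z) / s) s := by
  have bu := h.abs_u_le ha hs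
  have bv := h.abs_v_le ha hs
  rw [(hasDerivAt_entireSum bu z).deriv]
  have hball : ∀ w ∈ Metric.ball s (s / 2), s / 2 ≤ w ∧ 0 < w := fun w hw => by
    rw [Metric.mem_ball, Real.dist_eq, abs_lt] at hw
    constructor <;> linarith
  refine hasDerivAt_entireSum_param (δ := s / 2) (B := 2 / s * (1 + 1))
    (c' := fun j w => (v j w - j * u j w) / w) (by positivity)
    (fun j w hw => h.abs_u_le ha (hball w hw).2 j)
    (fun j w hw => (h.hasDerivAt_coef ha j (hball w hw).2).1) (fun j w hw => ?_) ?_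
  · have h1 := h.abs_v_le ha (hball w hw).2 j
    have h2 := h.abs_u_le ha (hball w hw).2 j
    rw [mul_assoc]
    refine abs_div_le_of_half_le hs (hball w hw).1 ((abs_sub _ _).trans ?_)
    rw [abs_mul, Nat.abs_cast, mul_div_assoc']
    have h3 : |v j w| + j * |u j w| ≤ (1 + 1 * j) / (j.factorial : ℝ) := by
      have := mul_le_mul_of_nonneg_left h2 (Nat.cast_nonneg (α := ℝ) j)
      rw [add_div, one_mul]
      rw [mul_one_div] at this
      linarith
    refine h3.trans ?_
    gcongr
    exact add_mul_index_le zero_le_one 1 zero_le_one j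
  · refine (congrArg (HasSum · _) (funext fun j => ?_)).mpr
      (((hasSum_entireSum bv z).sub (hasSum_index_mul bu z)).div_const (s : ℂ))
    push_cast
    ring

lemma abs_prev_le {c : ℕ → ℝ} (hc : ∀ j, |c j| ≤ 1 / (j.factorial : ℝ)) (j : ℕ) :
    |prevCoeff c j| ≤ j / (j.factorial : ℝ) := by
  cases j with
  | zero => simp [prevCoeff]
  | succ j =>
    refine (hc j).trans (le_of_eq ?_)
    rw [Nat.factorial_succ]
    push_cast
    field_simp

lemma hasDerivAt_p (ha : -1 < a) (h : IsScalingLimit a r Y u v) {s : ℝ} (hs : 0 < s) (z : ℂ) :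
    HasDerivAt (fun w => entireSum (fun j => v j w) z)
      (((2 * r s * Y s - a - 2) * entireSum (fun j => v j s) z
        - z * deriv (entireSum fun j => v j s) z + z / 4 * entireSum (fun j => u j s) z) / s) s := by
  have bu := h.abs_u_le ha hs
  have bv := h.abs_v_le ha hs
  have hB := boundY_nonneg ha
  rw [(hasDerivAt_entireSum bv z).deriv]
  have hball : ∀ w ∈ Metric.ball s (s / 2), s / 2 ≤ w ∧ 0 < w ∧ w ≤ 2 * s := fun w hw => by
    rw [Metric.mem_ball, Real.dist_eq, abs_lt] at hw
    refine ⟨?_, ?_, ?_⟩ <;> linarith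
  refine hasDerivAt_entireSum_param (δ := s / 2) (B := 2 / s * ((s * boundY a + a + 2) + 2))
    (c' := fun j w => ((2 * r w * Y w - a - 2 - j) * v j w
      + prevCoeff (fun i => u i w) j / 4) / w) (by positivity)
    (fun j w hw => h.abs_v_le ha (hball w hw).2.1 j)
    (fun j w hw => (h.hasDerivAt_coef ha j (hball w hw).2.1).2) (fun j w hw => ?_) ?_
  · obtain ⟨w1, w0, w2⟩ := hball w hw
    have h1 := h.abs_v_le ha w0 j
    have h2 := abs_prev_le (h.abs_u_le ha w0) j
    have hy : |Y w| ≤ boundY a := le_of_tendsto (h.tendsto_Y w w0).abs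
      (Eventually.of_forall fun n => abs_scaledY_le a ha n w w0)
    have r0 := h.sol.r_pos w w0
    have r1 := h.sol.r_le w w0
    have h3 : |2 * r w * Y w - a - 2 - j| ≤ s * boundY a + a + 2 + j := by
      have e : |2 * r w * Y w| ≤ s * boundY a := by
        rw [abs_mul, abs_of_pos (by linarith)]
        exact mul_le_mul (by linarith) hy (abs_nonneg _) hs.le
      rw [abs_le] at e ⊢
      have : (0:ℝ) ≤ j := Nat.cast_nonneg j
      constructor <;> linarith
    rw [mul_assoc (2 / s)]
    refine abs_div_le_of_half_le hs w1 ((abs_add_le _ _).trans ?_)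
    rw [abs_mul, abs_div, mul_div_assoc']
    have hc0 : 0 ≤ s * boundY a + a + 2 := by nlinarith
    have h4 := mul_le_mul h3 h1 (abs_nonneg _) (add_nonneg hc0 (Nat.cast_nonneg j))
    have h5 : |prevCoeff (fun i => u i w) j| / |(4:ℝ)| ≤ j / (j.factorial : ℝ) := by
      rw [abs_of_pos (by norm_num : (0:ℝ) < 4)]
      exact (div_le_self (abs_nonneg _) (by norm_num)).trans h2
    refine (add_le_add h4 h5).trans ?_
    rw [mul_one_div, ← add_div]
    gcongr
    refine le_trans (le_of_eq ?_) (add_mul_index_le hc0 2 zero_le_two j)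
    ring
  · have hsum := ((((hasSum_entireSum bv z).mul_left ((2 * r s * Y s - a - 2 : ℝ) : ℂ)).sub
        (hasSum_index_mul bv z)).add ((hasSum_prev bu z).mul_left (1 / 4))).div_const (s : ℂ)
    refine (congrArg₂ HasSum (funext fun j => ?_) ?_).mpr hsum
    · push_cast
      ring
    · push_cast
      ring

end IsScalingLimit

/-! ### The `σ`-form -/

/-- The limit of `n(n + a + 2) + Γ_n`. -/
def limitNu (a : ℝ) (r Y : ℝ → ℝ) (s : ℝ) : ℝ :=
  s / 4 * Y s - (a + 2) * r s * Y s - r s ^ 2 * Y s + r s ^ 2 * Y s ^ 2 + a * r s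

namespace IsLimitSolution
variable {a : ℝ} {r Y : ℝ → ℝ}

/-- After inserting both differential equations every term containing `r` cancels. This also gives
`4 s ν' = s Y = μ + s`. -/
lemma hasDerivAt_nu (h : IsLimitSolution a r Y) (s : ℝ) (hs : 0 < s) :
    HasDerivAt (limitNu a r Y) (Y s / 4) s := by
  have hr := h.deriv_r s hs
  have hY := h.deriv_Y s hs
  refine (((((((hasDerivAt_id s).div_const 4).mul hY).sub ((hr.const_mul (a + 2)).mul hY)).sub
    ((hr.pow 2).mul hY)).add ((hr.pow 2).mul (hY.pow 2))).add (hr.const_mul a)).congr_deriv ?_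
  simp only [id, Pi.pow_apply]
  field_simp
  ring

/-- The functions `σ`, `σ'` and `s σ''` are polynomials in `s`, `r`, `Y`, and the `σ`-form reduces
to a polynomial identity. Only continuity of the explicit second derivative is needed for the `C²`
claim. -/
lemma sigma_form (h : IsLimitSolution a r Y) :
    IsSigmaPIIIPrime (a + 2) (a - 2) (fun s => -limitNu a r Y s + s / 4 - a - 2) := by
  have d1 : ∀ s, 0 < s → HasDerivAt (fun s => -limitNu a r Y s + s / 4 - a - 2)
      (1 / 4 - Y s / 4) s := fun s hs =>
    ((((h.hasDerivAt_nu s hs).neg.add ((hasDerivAt_id s).div_const 4)).sub_const a).sub_const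
      2).congr_deriv (by ring)
  have e1 : Set.EqOn (deriv fun s => -limitNu a r Y s + s / 4 - a - 2) (fun s => 1 / 4 - Y s / 4)
      (Set.Ioi 0) := fun s hs => (d1 s hs).deriv
  have d2 : ∀ s, 0 < s → HasDerivAt (fun s => 1 / 4 - Y s / 4)
      (-((-a + (a + 2) * Y s + 2 * r s * Y s - 2 * r s * Y s ^ 2) / s / 4)) s := fun s hs =>
    ((h.deriv_Y s hs).div_const 4).const_sub _
  have e2 : Set.EqOn (deriv fun s => 1 / 4 - Y s / 4)
      (fun s => -((-a + (a + 2) * Y s + 2 * r s * Y s - 2 * r s * Y s ^ 2) / s / 4))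
      (Set.Ioi 0) := fun s hs => (d2 s hs).deriv
  have cr := h.continuousOn_r
  have cY := h.continuousOn_Y
  constructor
  · rw [show (2 : WithTop ℕ∞) = 1 + 1 by norm_num, contDiffOn_succ_iff_deriv_of_isOpen isOpen_Ioi]
    refine ⟨fun s hs => (d1 s hs).differentiableAt.differentiableWithinAt, by simp, ?_⟩
    refine ContDiffOn.congr ?_ e1
    rw [show (1 : WithTop ℕ∞) = 0 + 1 by norm_num, contDiffOn_succ_iff_deriv_of_isOpen isOpen_Ioi]
    refine ⟨fun s hs => (d2 s hs).differentiableAt.differentiableWithinAt, by simp, ?_⟩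
    refine ContDiffOn.congr (contDiffOn_zero.2 ?_) e2
    refine (ContinuousOn.div_const (ContinuousOn.div (by fun_prop) continuousOn_id ?_) 4).neg
    exact fun s hs => ne_of_gt hs
  · intro s hs
    have e3 : deriv (deriv fun s => -limitNu a r Y s + s / 4 - a - 2) s
        = -((-a + (a + 2) * Y s + 2 * r s * Y s - 2 * r s * Y s ^ 2) / s / 4) := by
      rw [← (d2 s hs).deriv]
      exact Filter.EventuallyEq.deriv_eq (e1.eventuallyEq_of_mem (Ioi_mem_nhds hs))
    rw [e3, e1 hs]
    simp only [limitNu]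
    field_simp
    ring

end IsLimitSolution

end HardEdge

end

theorem mainTheorem3 (a : ℝ) (ha : -1 < a) :
    ∃ (μ ν C ξ : ℝ → ℝ) (q p : ℂ → ℝ → ℂ),
      -- the coefficient functions are the hard edge limits, `t = s / 4n`
      (∀ s : ℝ, 0 < s →
        Tendsto (fun n : ℕ => 4 * n * HardEdge.theta a (s / (4 * n)) n) atTop (𝓝 (μ s)) ∧
        Tendsto (fun n : ℕ => n * (n + a + 2) + HardEdge.capGamma a (s / (4 * n)) n)
          atTop (𝓝 (ν s)) ∧
        Tendsto (fun n : ℕ => HardEdge.kappa a (s / (4 * n)) n) atTop (𝓝 (-(1 / 4) * μ s)) ∧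
        Tendsto (fun n : ℕ => HardEdge.combPlus a (s / (4 * n)) n) atTop (𝓝 (C s)) ∧
        Tendsto (fun n : ℕ => HardEdge.combMinus a (s / (4 * n)) n) atTop (𝓝 (-C s)) ∧
        Tendsto (fun n : ℕ => n * (HardEdge.combPlus a (s / (4 * n)) n
          + HardEdge.combMinus a (s / (4 * n)) n)) atTop (𝓝 (ξ s))) ∧
      -- `q, p` are the hard edge limits of the ratios, `x = -z / 4n`, and are entire in `z`
      (∀ s : ℝ, 0 < s → ∀ z : ℂ,
        Tendsto (fun n : ℕ => HardEdge.ratioQ a (s / (4 * n)) n (-z / (4 * n)))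
          atTop (𝓝 (q z s)) ∧
        Tendsto (fun n : ℕ => n * HardEdge.ratioR a (s / (4 * n)) n (-z / (4 * n)))
          atTop (𝓝 (p z s))) ∧
      (∀ s : ℝ, 0 < s →
        Differentiable ℂ (fun z => q z s) ∧ Differentiable ℂ (fun z => p z s)) ∧
      -- the Painlevé III′ characterisation of `μ` and `ν`
      HardEdge.IsSigmaPIIIPrime (a + 2) (a - 2) (fun s => -ν s + s / 4 - a - 2) ∧
      (∀ s : ℝ, 0 < s → μ s + s = 4 * s * deriv ν s) ∧
      -- the isomonodromy (compatibility) equations for the coefficients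
      (∀ s : ℝ, 0 < s →
        DifferentiableAt ℝ μ s ∧ DifferentiableAt ℝ C s ∧ DifferentiableAt ℝ ξ s ∧
        s * (deriv μ s - 2) = (2 * C s + a + 3) * μ s ∧
        s * deriv C s = ξ s - (μ s + s) / 4 ∧
        s * deriv ξ s = -(2 * C s + a + 2) * ξ s + s * (2 * C s + a) / 4) ∧
      -- spectral derivatives
      (∀ s : ℝ, 0 < s → ∀ z : ℂ,
        (s - z) * z * deriv (fun w => q w s) z = -z * C s * q z s - (μ s + z) * p z s ∧
        (s - z) * z * deriv (fun w => p w s) z =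
          -z * (ξ s + (z - s) / 4) * q z s + (-2 * s + z * (C s + a + 2)) * p z s) ∧
      -- deformation derivatives
      (∀ s : ℝ, 0 < s → ∀ z : ℂ,
        DifferentiableAt ℝ (fun u => q z u) s ∧ DifferentiableAt ℝ (fun u => p z u) s ∧
        (s - z) * s * deriv (fun u => q z u) s = z * C s * q z s + (μ s + s) * p z s ∧
        (s - z) * s * deriv (fun u => p z u) s =
          z * ξ s * q z s - (s * (2 * C s + a) - z * C s) * p z s) ∧
      -- boundary conditions
      (∀ s : ℝ, 0 < s → q 0 s = 1 ∧ p 0 s = 0) := by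
  obtain ⟨r, Y, u, v, h⟩ := HardEdge.exists_isScalingLimit a ha
  have hσ := h.sol.sigma_form
  have hr := h.sol.deriv_r
  have hY := h.sol.deriv_Y
  have hν := h.sol.hasDerivAt_nu
  refine ⟨fun s => -(s * (1 - Y s)), HardEdge.limitNu a r Y, fun s => -(r s * Y s),
    fun s => r s * (a - r s * Y s), fun z s => HardEdge.entireSum (fun j => u j s) z,
    fun z s => HardEdge.entireSum (fun j => v j s) z, fun s hs =>
      HardEdge.tendsto_coefficients ha hs (h.tendsto_r s hs) (h.tendsto_Y s hs), ?_, ?_, hσ,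
    ?_, ?_, ?_, ?_, ?_⟩
  · intro s hs z
    constructor
    · refine (tendsto_add_atTop_iff_nat 1).1 ?_
      refine (HardEdge.tendsto_entireSum (fun n j => HardEdge.abs_coefU_le a ha n j s hs)
        (h.tendsto_u · s hs) z).congr fun n => ?_
      exact (HardEdge.ratioQ_eq_entireSum a n s hs z).symm
    · refine (tendsto_add_atTop_iff_nat 1).1 ?_
      refine (HardEdge.tendsto_entireSum (fun n j => HardEdge.abs_coefV_le a ha n j s hs)
        (h.tendsto_v · s hs) z).congr fun n => ?_
      exact (HardEdge.ratioR_eq_entireSum a n s hs z).symm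
  · exact fun s hs => ⟨fun z => (HardEdge.hasDerivAt_entireSum (h.abs_u_le ha hs) z).differentiableAt,
      fun z => (HardEdge.hasDerivAt_entireSum (h.abs_v_le ha hs) z).differentiableAt⟩
  · intro s hs
    rw [(hν s hs).deriv]; ring
  -- In these coordinates the compatibility equations are restatements of the two differential
  -- equations for `r` and `Y`.
  · intro s hs
    have hμ := ((hasDerivAt_id s).mul ((hY s hs).const_sub 1)).neg
    have hC := ((hr s hs).mul (hY s hs)).neg
    have hξ := (hr s hs).mul (((hr s hs).mul (hY s hs)).const_sub a)
    refine ⟨hμ.differentiableAt, hC.differentiableAt, hξ.differentiableAt, ?_, ?_, ?_⟩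
    · refine (congrArg (fun x => s * (x - 2)) hμ.deriv).trans ?_
      simp only [id]; field_simp; ring
    · refine (congrArg (fun x => s * x) hC.deriv).trans ?_
      field_simp; ring
    · refine (congrArg (fun x => s * x) hξ.deriv).trans ?_
      simp only [Pi.mul_apply]; field_simp; ring
  · intro s hs z
    have h1 := h.spectral_q ha hs z
    have h2 := h.spectral_p ha hs z
    push_cast
    constructor
    · linear_combination h1
    · linear_combination h2
  · intro s hs z
    have h1 := h.spectral_q ha hs z
    have h2 := h.spectral_p ha hs z
    have d1 := h.hasDerivAt_q ha hs z
    have d2 := h.hasDerivAt_p ha hs z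
    have hs' : (s : ℂ) ≠ 0 := by exact_mod_cast hs.ne'
    refine ⟨d1.differentiableAt, d2.differentiableAt, ?_, ?_⟩
    -- After multiplication by `s - z`, the spectral equation replaces `(s - z) z ∂_z q`.
    · rw [d1.deriv, mul_assoc, mul_div_cancel₀ _ hs']
      push_cast
      linear_combination -h1
    · rw [d2.deriv, mul_assoc, mul_div_cancel₀ _ hs']
      push_cast
      linear_combination -h2
  · intro s hs
    have e : ∀ c : ℕ → ℝ, HardEdge.entireSum c 0 = c 0 := fun c => by
      rw [HardEdge.entireSum, tsum_eq_single 0 fun j hj => by simp [hj]]; simp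
    simp only [e, h.u_zero ha hs, h.v_zero ha hs]
    simp
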